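/- Let $1\le m\le n$, $a\in\mathbb H^n$ and $\kappa_m=\frac{2n}{m}-1$. Write $q_l=x_{4l}+x_{4l+1}\mathbf i+x_{4l+2}\mathbf j+x_{4l+3}\mathbf k$ ($0\le l\le n-1$) for the coordinates of $q\in\mathbb H^n$. **Notation.** Let $\omega^0,\dots,\omega^{2n-1}$ be a basis of $\mathbb C^{2n}$, $\beta_n=\sum_{l=0}^{n-1}\omega^l\wedge\omega^{n+l}$ and $\Omega_{2n}=\omega^0\wedge\omega^n\wedge\cdots\wedge\omega^{n-1}\wedge\omega^{2n-1}$; put $\int f\,\Omega_{2n}=\int f\,dV$. For $\wedge^p\mathbb C^{2n}$-valued functions $F=\sum_I f_I\omega^I$ on $\mathbb H^n$ let $d_\alpha F=\sum_{I}\sum_{A=0}^{2n-1}\nabla_{A\alpha}f_I\,\omega^A\wedge\omega^I$ ($\alpha=0,1$) with $\nabla_{l0}=\partial_{x_{4l}}+\mathbf i\partial_{x_{4l+1}}$, $\nabla_{l1}=-\partial_{x_{4l+2}}-\mathbf i\partial_{x_{4l+3}}$, $\nabla_{(n+l)0}=\partial_{x_{4l+2}}-\mathbf i\partial_{x_{4l+3}}$,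 $\nabla_{(n+l)1}=\partial_{x_{4l}}-\mathbf i\partial_{x_{4l+1}}$, and let $\Delta=d_0d_1$. A real $C^4$ function $v$ is quaternionic $m$-subharmonic if at every point its quaternionic Hessian $\big(\frac{\partial^2 v}{\partial\bar q_l\partial q_k}\big)$, where $\frac{\partial}{\partial\bar q_l}=\partial_{x_{4l}}+\mathbf i\partial_{x_{4l+1}}+\mathbf j\partial_{x_{4l+2}}+\mathbf k\partial_{x_{4l+3}}$ and $\frac{\partial}{\partial q_l}$ is its conjugate, lies in the closure of $\Gamma_m=\{A \text{ hyperhermitian}: S_m(\lambda(sI+A))>0 \text{ for all } s\ge 0\}$, with $S_m$ the $m$-th elementary symmetric function and $\lambda(\cdot)$ the eigenvalues. An upper semicontinuous $u:\mathbb H^n\to[-\infty,\infty)$ in $L^1_{loc}$ is quaternionic $m$-subharmonic ($u\in QSH_m(\mathbb H^n)$) if $\int u\,\Delta v_1\wedge\dots\wedge\Delta v_{m-1}\wedge\beta_n^{n-m}\wedge\Delta\eta\ge 0$ for all $C^4$ quaternionic $m$-subharmonic $v_1,\dots,v_{m-1}$ on $\mathbb H^n$ and all nonnegative $\eta\in C_0^\infty(\mathbb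 H^n)$. For $k=1,\dots,m$ the current $(\Delta u)^k\wedge\beta_n^{n-m}$ is defined by the recurrence $$\big((\Delta u)^k\wedge\beta_n^{n-m}\big)(F)=\int u\,(\Delta u)^{k-1}\wedge\beta_n^{n-m}\wedge\Delta F$$ for all smooth compactly supported $(2m-2k)$-forms $F$, whenever the current $(\Delta u)^{k-1}\wedge\beta_n^{n-m}$ is of measure type (a $\wedge^{2(n-m+k-1)}\mathbb C^{2n}$-valued Radon measure) and $u$ is locally integrable with respect to it. For a Radon measure $\mu$ one writes $\mathcal H_m(u)=\mu$ if $(\Delta u)^m\wedge\beta_n^{n-m}$ is defined in this way and equals $m!\,(n-m)!\,\mu\,\Omega_{2n}$. **Proposition.** The function $K_m(q)=\dfrac{-1}{|q-a|^{2\kappa_m}}$ (with $K_m(a)=-\infty$) is in $QSH_m(\mathbb H^n)$ and is the fundamental solution of the quaternionic $m$-Hessian operator: the currents $(\Delta K_m)^k\wedge\beta_n^{n-m}$, $0\le k\le m$, are defined by the above recurrence and of measure type, and $$\mathcal H_m(K_m)=C_{m,n}\,\delta_a,\qquad C_{m,n}=\frac{8^m\,n!\,\pi^{2n}\,\kappa_m^m}{(2n)!\,m!\,(n-m)!}.$$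 -/

import Mathlib

open MeasureTheory Topology
open scoped ContDiff Nat

noncomputable section

namespace QHessian

/-- The space `ℍⁿ` in its real coordinates: the coordinate `(l, c)` of `q` is `x_{4l+c}`, where
`q_l = x_{4l} + x_{4l+1} i + x_{4l+2} j + x_{4l+3} k`.  The norm is the Euclidean one. -/
abbrev HSpace (n : ℕ) : Type := EuclideanSpace ℝ (Fin n × Fin 4)

/-- The partial derivative of `f` in the real coordinate `c`. -/
def partialD {n : ℕ} {E : Type*} [NormedAddCommGroup E] [NormedSpace ℝ E]
    (c : Fin n × Fin 4) (f : HSpace n → E) (q : HSpace n) : E :=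
  fderiv ℝ f q (EuclideanSpace.single c 1)

/-! ### The quaternionic Hessian and smooth quaternionic `m`-subharmonic functions -/

/-- The quaternionic units `1, i, j, k`. -/
def unit (c : Fin 4) : Quaternion ℝ :=
  match c with
  | 0 => ⟨1, 0, 0, 0⟩
  | 1 => ⟨0, 1, 0, 0⟩
  | 2 => ⟨0, 0, 1, 0⟩
  | 3 => ⟨0, 0, 0, 1⟩

/-- The Cauchy–Fueter operator `∂/∂q̄_l = ∂_{4l} + i ∂_{4l+1} + j ∂_{4l+2} + k ∂_{4l+3}`. -/
def cauchyFueter {n : ℕ} (l : Fin n) (f : HSpace n → Quaternion ℝ) (q : HSpace n) :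
    Quaternion ℝ :=
  ∑ c : Fin 4, unit c * partialD (l, c) f q

/-- The conjugate operator `∂/∂q_l = ∂_{4l} - i ∂_{4l+1} - j ∂_{4l+2} - k ∂_{4l+3}`. -/
def cauchyFueterConj {n : ℕ} (l : Fin n) (f : HSpace n → Quaternion ℝ) (q : HSpace n) :
    Quaternion ℝ :=
  ∑ c : Fin 4, star (unit c) * partialD (l, c) f q

/-- The quaternionic Hessian `(∂²u / ∂q̄_l ∂q_k)_{l,k}` of a real function. -/
def qHessian {n : ℕ} (u : HSpace n → ℝ) (q : HSpace n) :
    Matrix (Fin n) (Fin n) (Quaternion ℝ) :=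
  Matrix.of fun l k => cauchyFueter l (cauchyFueterConj k fun p => (u p : Quaternion ℝ)) q

/-- `ev` lists the eigenvalues (with multiplicity) of the hyperhermitian matrix `A`, that is,
`U* A U = diag (ev)` for a quaternionic unitary matrix `U`. -/
def HasEigenvalues {n : ℕ} (A : Matrix (Fin n) (Fin n) (Quaternion ℝ)) (ev : Fin n → ℝ) : Prop :=
  ∃ U ∈ unitary (Matrix (Fin n) (Fin n) (Quaternion ℝ)),
    star U * A * U = Matrix.diagonal fun i => (ev i : Quaternion ℝ)

/-- The elementary symmetric function `S_m`. -/
def elemSymm {n : ℕ} (m : ℕ) (x : Fin n → ℝ) : ℝ :=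
  ∑ t ∈ Finset.powersetCard m (Finset.univ : Finset (Fin n)), ∏ i ∈ t, x i

/-- The cone `Γ_m` of the hyperhermitian matrices `A` with `H_m(s I + A) > 0` for all `s ≥ 0`,
where `H_m` is `S_m` of the eigenvalues; the eigenvalues of `s I + A` are those of `A` shifted
by `s`. -/
def gardingCone (n m : ℕ) : Set (Matrix (Fin n) (Fin n) (Quaternion ℝ)) :=
  {A | ∃ ev : Fin n → ℝ, HasEigenvalues A ev ∧ ∀ s : ℝ, 0 ≤ s → 0 < elemSymm m fun i => s + ev i}

/-- A function of class `C^4` on `Ω` is quaternionic `m`-subharmonic if its quaternionic Hessian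
lies in the closure of `Γ_m` at every point of `Ω`. -/
structure IsC4QSH {n : ℕ} (m : ℕ) (Ω : Set (HSpace n)) (v : HSpace n → ℝ) : Prop where
  contDiffOn : ContDiffOn ℝ 4 v Ω
  hessian_mem : ∀ q ∈ Ω, qHessian v q ∈ closure (gardingCone n m)

/-! ### Forms -/

/-- Indices of the basis of `ℂ^{2n}`: `(l, 0)` stands for `l` and `(l, 1)` for `n + l`.  In the
lexicographic order they are `0, n, 1, n + 1, …, n - 1, 2n - 1`. -/
abbrev Idx (n : ℕ) : Type := Fin n ×ₗ Fin 2

/-- The complex exterior algebra of `ℂ^{2n}`; the multiplication is the wedge product. -/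
abbrev Ext (n : ℕ) : Type := ExteriorAlgebra ℂ (Idx n → ℂ)

/-- The basis `ω^I` of the exterior algebra. -/
def extBasis (n : ℕ) : Module.Basis (Finset (Idx n)) ℂ (Ext n) :=
  (Pi.basisFun ℂ (Idx n)).ExteriorAlgebra

/-- The basis element `ω^A` of `ℂ^{2n}`. -/
def om {n : ℕ} (A : Idx n) : Ext n := ExteriorAlgebra.ι ℂ (Pi.single A 1)

/-- `β_n = ∑_l ω^l ∧ ω^{n+l}`. -/
def beta (n : ℕ) : Ext n := ∑ l : Fin n, om (toLex (l, 0)) * om (toLex (l, 1))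

/-- `Ω_{2n} = ω^0 ∧ ω^n ∧ ⋯ ∧ ω^{n-1} ∧ ω^{2n-1}`. -/
def volForm (n : ℕ) : Ext n :=
  (List.ofFn fun l : Fin n => om (toLex (l, 0)) * om (toLex (l, 1))).prod

/-- The coefficient of `Ω_{2n}` in an element of the exterior algebra, so that
`∫ F = ∫ topCoeff F dV`. -/
def topCoeff (n : ℕ) : Ext n →ₗ[ℂ] ℂ := (extBasis n).coord Finset.univ

/-- The first-order operators `∇_{A α}`. -/
def nabla {n : ℕ} (A : Idx n) (α : Fin 2) (f : HSpace n → ℂ) (q : HSpace n) : ℂ :=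
  let l := (ofLex A).1
  match (ofLex A).2, α with
  | 0, 0 => partialD (l, 0) f q + Complex.I * partialD (l, 1) f q
  | 0, 1 => -partialD (l, 2) f q - Complex.I * partialD (l, 3) f q
  | 1, 0 => partialD (l, 2) f q - Complex.I * partialD (l, 3) f q
  | 1, 1 => partialD (l, 0) f q - Complex.I * partialD (l, 1) f q

/-- The operators `d_0` and `d_1`: `d_α F = ∑_I ∑_A ∇_{A α} f_I ω^A ∧ ω^I` for
`F = ∑_I f_I ω^I`. -/
def dOp {n : ℕ} (α : Fin 2) (F : HSpace n → Ext n) (q : HSpace n) : Ext n :=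
  ∑ I : Finset (Idx n), ∑ A : Idx n,
    nabla A α (fun p => (extBasis n).repr (F p) I) q • (om A * extBasis n I)

/-- The Baston operator `Δ = d_0 d_1` on forms. -/
def baston {n : ℕ} (F : HSpace n → Ext n) : HSpace n → Ext n := dOp 0 (dOp 1 F)

/-- A real function as a `0`-form. -/
def ofFun {n : ℕ} (u : HSpace n → ℝ) (q : HSpace n) : Ext n :=
  algebraMap ℂ (Ext n) (u q : ℂ)

/-! ### Quaternionic `m`-subharmonic functions -/

/-- The class `QSH_m(Ω)`, for `1 ≤ m ≤ n` and `Ω` open: the upper semicontinuous functions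
`u : Ω → [-∞, ∞)` in `L¹_loc(Ω)` such that the distribution
`η ↦ ∫ u Δv_1 ∧ ⋯ ∧ Δv_{m-1} ∧ β_n^{n-m} ∧ Δη` is nonnegative for all quaternionic
`m`-subharmonic functions `v_1, …, v_{m-1}` of class `C^4` on `Ω`. -/
structure IsQSH {n : ℕ} (m : ℕ) (Ω : Set (HSpace n)) (u : HSpace n → EReal) : Prop where
  upperSemicontinuousOn : UpperSemicontinuousOn u Ω
  ne_top : ∀ q ∈ Ω, u q ≠ ⊤
  ae_ne_bot : ∀ᵐ q ∂(volume.restrict Ω), u q ≠ ⊥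
  locallyIntegrableOn : LocallyIntegrableOn (fun q => (u q).toReal) Ω
  nonneg : ∀ v : Fin (m - 1) → HSpace n → ℝ, (∀ j, IsC4QSH m Ω (v j)) →
    ∀ η : HSpace n → ℝ, ContDiff ℝ ∞ η → HasCompactSupport η → tsupport η ⊆ Ω →
      (∀ q, 0 ≤ η q) →
      ∃ r : ℝ, 0 ≤ r ∧
        ∫ q in Ω, ((u q).toReal : ℂ) *
          topCoeff n ((List.ofFn fun j => baston (ofFun (v j)) q).prod * beta n ^ (n - m) *
            baston (ofFun η) q) = (r : ℂ)

/-! ### Currents of measure type and the `m`-Hessian measure -/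

/-- The test forms `𝓓^p(Ω)`: smooth `p`-forms with compact support in `Ω`. -/
structure IsTestForm {n : ℕ} (p : ℕ) (Ω : Set (HSpace n)) (F : HSpace n → Ext n) : Prop where
  degree : ∀ q, F q ∈ ⋀[ℂ]^p (Idx n → ℂ)
  smooth : ∀ I, ContDiff ℝ ∞ fun q => (extBasis n).repr (F q) I
  compact : HasCompactSupport F
  support : tsupport F ⊆ Ω

/-- `T · μ` is a `p`-current of measure type on `Ω`, i.e. a `⋀^p`-valued Radon measure, written
as a density `T` with respect to a positive Radon measure `μ`. -/
structure IsMeasureCurrent {n : ℕ} (p : ℕ) (Ω : Set (HSpace n)) (μ : Measure (HSpace n))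
    (T : HSpace n → Ext n) : Prop where
  finite_of_compact : ∀ K ⊆ Ω, IsCompact K → μ K < ⊤
  degree : ∀ q, T q ∈ ⋀[ℂ]^p (Idx n → ℂ)
  locallyIntegrableOn : ∀ I, LocallyIntegrableOn (fun q => (extBasis n).repr (T q) I) Ω μ

/-- The function `u` is locally integrable on `Ω` with respect to the `⋀`-valued measure
`T · μ`. -/
structure LocIntegrableCurrent {n : ℕ} (Ω : Set (HSpace n)) (u : HSpace n → EReal)
    (μ : Measure (HSpace n)) (T : HSpace n → Ext n) : Prop where
  ae_finite : ∀ᵐ q ∂(μ.restrict Ω), T q ≠ 0 → u q ≠ ⊥ ∧ u q ≠ ⊤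
  locallyIntegrableOn : ∀ I, LocallyIntegrableOn
    (fun q => ((u q).toReal : ℂ) * (extBasis n).repr (T q) I) Ω μ

/-- `T · μ` is the current `(Δu)^k ∧ β_n^{n-m}` on `Ω`, defined by the recurrence
`((Δu)^k ∧ β_n^{n-m})(F) = ∫ u (Δu)^{k-1} ∧ β_n^{n-m} ∧ ΔF` for test forms `F` of degree
`2m - 2k`.  At each step the preceding current has to be of measure type and `u` has to be locally
integrable with respect to it. -/
def IsHessianCurrent {n : ℕ} (m : ℕ) (Ω : Set (HSpace n)) (u : HSpace n → EReal) :
    ℕ → Measure (HSpace n) → (HSpace n → Ext n) → Prop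
  | 0, μ, T => IsMeasureCurrent (2 * (n - m)) Ω μ T ∧
      ∀ F, IsTestForm (2 * m) Ω F →
        ∫ q in Ω, topCoeff n (T q * F q) ∂μ = ∫ q in Ω, topCoeff n (beta n ^ (n - m) * F q)
  | k + 1, μ, T => IsMeasureCurrent (2 * (n - m + (k + 1))) Ω μ T ∧
      ∃ (ν : Measure (HSpace n)) (S : HSpace n → Ext n),
        IsHessianCurrent m Ω u k ν S ∧ LocIntegrableCurrent Ω u ν S ∧
        ∀ F, IsTestForm (2 * (m - (k + 1))) Ω F →
          ∫ q in Ω, topCoeff n (T q * F q) ∂μ =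
            ∫ q in Ω, ((u q).toReal : ℂ) * topCoeff n (S q * baston F q) ∂ν

/-- `H_m(u) = μ` on `Ω`, that is, `(Δu)^m ∧ β_n^{n-m} = m! (n-m)! μ Ω_{2n}`. -/
def IsHessianMeasure {n : ℕ} (m : ℕ) (Ω : Set (HSpace n)) (u : HSpace n → EReal)
    (μ : Measure (HSpace n)) : Prop :=
  IsHessianCurrent m Ω u m μ fun _ => ((m ! : ℂ) * ((n - m) ! : ℂ)) • volForm n

/-! ### The function `K_m` -/

/-- `κ_m = 2n/m - 1`. -/
def kappa (n m : ℕ) : ℝ := 2 * (n : ℝ) / (m : ℝ) - 1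

/-- `K_m(q) = -1 / |q - a|^{2 κ_m}`, with the value `-∞` at `a`. -/
def fundSol {n : ℕ} (m : ℕ) (a q : HSpace n) : EReal :=
  if q = a then ⊥ else ((-1 / ‖q - a‖ ^ (2 * kappa n m) : ℝ) : EReal)

/-- `C_{m,n} = 8^m n! π^{2n} κ_m^m / ((2n)! m! (n-m)!)`. -/
def fundConst (n m : ℕ) : ℝ :=
  8 ^ m * (n ! : ℝ) * Real.pi ^ (2 * n) * kappa n m ^ m /
    (((2 * n) ! : ℝ) * (m ! : ℝ) * ((n - m) ! : ℝ))

end QHessian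

end

/-! The singular function is replaced by the smooth `regSol`, u_ε = -(|q-a|² + ε)^{-κ}. With s =
|q-a|² + ε and y = (q-a)/√s, the radial Hessian gives (`baston_regSol`) Δu_ε = 4κ s^{-(κ+1)} (2β_n -
(κ+1)θ_y), where θ_y is the two-form of the rank one matrix y y*. Since θ_y² = 0, the m-th power
stops after the linear term, and m(κ+1) = 2n makes the result proportional to 1 - |y|² = ε/s. Hence
(`hessFunctional_regBaston`) (Δu_ε)^m ∧ β_n^{n-m} = (8κ)^m n! ε s^{-(2n+1)} Ω_{2n}, an approximate
identity on ℝ^{4n} whose mass is (8κ)^m n! times the volume π^{2n}/(2n)! of the unit ball. This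
produces the Dirac mass and the constant.

For k < m the density of (Δu_ε)^k ∧ β_n^{n-m} is s^{-(κ+1)k} times a bounded continuous function of
y. Since 2(κ + (κ+1)k) < 4n (`exponent_lt`), this density and its product with u_ε are dominated
near a by integrable powers of the distance. Integration by parts (`integral_mul_baston`) links step
k to step k+1 for ε > 0, and dominated convergence (`tendsto_integral_regDist_rpow_mul`) passes to ε
= 0. The recurrence follows by uniqueness of limits.

Membership in QSH_m needs Δv_1 ∧ … ∧ Δv_{m-1} ∧ β_n^{n-m} ∧ Δu_ε ≥ 0 pointwise, which is Gårding's
inequality (`garding`, `mixed_hessian_nonneg`). On functions Δ is the two-form `theta` of the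
quaternionic Hessian (`baston_eq_theta`), and a unitary diagonalization turns the form A ↦ θ(A)^m ∧
β_n^{n-m} into an elementary symmetric function of the eigenvalues (`HasEigenvalues.topCoeff_pow`).
This polynomial is hyperbolic in the direction β_n. Gårding's inequality is proved by stability:
nonvanishing on R + i·(cone) survives differentiation in a cone direction by Gauss–Lucas, and the
sign is carried along by a logarithmic derivative. All of this takes place in the centre of the
exterior algebra, a commutative ring containing every product of two one-forms. -/

noncomputable section

namespace QHessian

/-! ### Gårding's inequality for powers in a commutative algebra -/

section Garding

open Polynomial
open scoped ComplexOrder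

/-- A polynomial none of whose roots lies in a closed half plane has a derivative with the same
property (Gauss–Lucas). -/
theorem eval_derivative_ne_zero_of_halfPlane {g : ℂ[X]} (hg : 0 < g.degree) (z₀ : ℂ)
    (h : ∀ z : ℂ, z₀.im ≤ z.im → g.eval z ≠ 0) : g.derivative.eval z₀ ≠ 0 := by
  intro h0
  have hg0 : g.derivative ≠ 0 := by
    intro h1
    have := derivative_eq_zero.mp h1
    rw [← natDegree_pos_iff_degree_pos] at hg
    omega
  have hmem : z₀ ∈ g.derivative.rootSet ℂ := by
    rw [mem_rootSet_of_ne hg0]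
    simpa [aeval_def] using h0
  have hsub : convexHull ℝ (g.rootSet ℂ) ⊆ {z : ℂ | z.im < z₀.im} := by
    refine convexHull_min ?_ (convex_halfSpace_im_lt _)
    intro z hz
    by_contra hcon
    have h1 := h z (not_lt.mp hcon)
    have h2 := (mem_rootSet.mp hz).2
    exact h1 (by simpa [aeval_def] using h2)
  have hlt : z₀.im < z₀.im := hsub (rootSet_derivative_subset_convexHull_rootSet hg hmem)
  exact lt_irrefl _ hlt

/-- The logarithmic derivative at 0 is the sum of 1/(0 - r) over the roots r. Each term is positive
because r is a negative real, and positive degree ensures that there is at least one term. -/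
theorem eval_derivative_div_eval_pos {g : ℂ[X]} (hg : 0 < g.degree)
    (h : ∀ z : ℂ, g.eval z = 0 → z < 0) : 0 < g.derivative.eval 0 / g.eval 0 := by
  have h0 : g.eval 0 ≠ 0 := fun h1 => lt_irrefl _ (h 0 h1)
  have hg0 : g ≠ 0 := by rintro rfl; simp at hg
  rw [(IsAlgClosed.splits g).eval_derivative_div_eval_of_ne_zero h0]
  obtain ⟨w, hw⟩ := IsAlgClosed.exists_root g hg.ne'
  have hpos : ∀ r ∈ g.roots, (0 : ℂ) < 1 / (0 - r) := by
    intro r hr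
    have hr0 := h r (isRoot_of_mem_roots hr)
    rw [Complex.neg_iff] at hr0
    have hre : r = (r.re : ℂ) := Complex.ext rfl (by simpa using hr0.2)
    rw [hre, zero_sub, ← Complex.ofReal_neg, ← Complex.ofReal_one, ← Complex.ofReal_div]
    rw [Complex.zero_lt_real]
    exact one_div_pos.mpr (neg_pos.mpr hr0.1)
  obtain ⟨s, hs⟩ := Multiset.exists_cons_of_mem ((mem_roots hg0).mpr hw)
  rw [hs] at hpos ⊢
  rw [Multiset.map_cons, Multiset.sum_cons]
  refine add_pos_of_pos_of_nonneg (hpos _ (Multiset.mem_cons_self _ _)) ?_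
  refine Multiset.sum_nonneg ?_
  intro x hx
  obtain ⟨r, hr, rfl⟩ := Multiset.mem_map.mp hx
  exact (hpos r (Multiset.mem_cons_of_mem hr)).le

/-- Roots that never meet the real axis stay in the lower half plane along a continuous path of
polynomials with constant leading coefficient. -/
theorem roots_lowerHalfPlane_of_homotopy {m : ℕ} {c : ℂ} (hc : c ≠ 0) (g : ℝ → ℂ[X])
    (hdeg : ∀ s, (g s).natDegree ≤ m) (hlead : ∀ s, (g s).coeff m = c)
    (hcont : ∀ j, Continuous fun s => (g s).coeff j)
    (hreal : ∀ s ∈ Set.Icc (0 : ℝ) 1, ∀ t : ℝ, (g s).eval (t : ℂ) ≠ 0)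
    (h0 : ∀ z : ℂ, 0 ≤ z.im → (g 0).eval z ≠ 0) (z : ℂ) (hz : 0 ≤ z.im) :
    (g 1).eval z ≠ 0 := by
  have hev : ∀ s z, (g s).eval z = ∑ j ∈ Finset.range (m + 1), (g s).coeff j * z ^ j := fun s z =>
    eval_eq_sum_range' (Nat.lt_succ_of_le (hdeg s)) z
  have hjoint : Continuous fun p : ℝ × ℂ => (g p.1).eval p.2 := by
    simp_rw [hev]
    exact continuous_finsetSum _ fun j _ =>
      ((hcont j).comp continuous_fst).mul (continuous_snd.pow j)
  have hne : ∀ s, g s ≠ 0 := fun s h => hc (by rw [← hlead s, h, coeff_zero])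
  have hnat : ∀ s, (g s).natDegree = m := fun s =>
    le_antisymm (hdeg s) (le_natDegree_of_ne_zero (by rw [hlead s]; exact hc))
  have hlc : ∀ s, (g s).leadingCoeff = c := fun s => by rw [leadingCoeff, hnat, hlead]
  -- the roots are bounded uniformly
  obtain ⟨M, hM⟩ : ∃ M : ℝ, ∀ s ∈ Set.Icc (0 : ℝ) 1, ∀ z, (g s).eval z = 0 → ‖z‖ ≤ M := by
    have hb : ∀ j, ∃ C : ℝ, ∀ s ∈ Set.Icc (0 : ℝ) 1, ‖(g s).coeff j‖ ≤ C := fun j =>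
      isCompact_Icc.exists_bound_of_continuousOn (hcont j).continuousOn
    choose C hC using hb
    -- Cauchy's root bound. The maximum with 1 allows |z|^j ≤ |z|^{m-1} for all j < m.
    refine ⟨max 1 ((∑ j ∈ Finset.range m, C j) / ‖c‖), fun s hs z hz => ?_⟩
    by_contra! hlt
    obtain ⟨h1, h2⟩ := max_lt_iff.mp hlt
    have hcp : 0 < ‖c‖ := norm_pos_iff.mpr hc
    rw [div_lt_iff₀ hcp] at h2
    rw [hev, Finset.sum_range_succ, hlead] at hz
    have hz' : c * z ^ m = -∑ j ∈ Finset.range m, (g s).coeff j * z ^ j :=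
      eq_neg_of_add_eq_zero_right hz
    rcases Nat.eq_zero_or_pos m with rfl | hmp
    · simp at hz'; exact hc hz'
    have h3 : ‖c‖ * ‖z‖ ^ m ≤ (∑ j ∈ Finset.range m, C j) * ‖z‖ ^ (m - 1) := by
      rw [← norm_pow, ← norm_mul, hz', norm_neg, Finset.sum_mul]
      refine (norm_sum_le _ _).trans (Finset.sum_le_sum fun j hj => ?_)
      rw [norm_mul, norm_pow]
      have hj' := Finset.mem_range.mp hj
      exact mul_le_mul (hC j s hs) (pow_le_pow_right₀ h1.le (by omega)) (by positivity)
        ((norm_nonneg _).trans (hC j s hs))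
    have h4 : ‖z‖ ^ m = ‖z‖ * ‖z‖ ^ (m - 1) := by
      rw [← pow_succ']; congr 1; omega
    rw [h4, ← mul_assoc, mul_comm ‖c‖] at h3
    exact absurd (le_of_mul_le_mul_right h3 (by positivity)) (not_le.mpr h2)
  -- `A` is a closed condition that holds whenever all roots lie in the open lower half plane, since
  -- then |z - r| ≥ Im z for each root r. The projection of `K` is the closed set of parameters
  -- having a root in the closed upper half plane. These sets cover [0,1] and both meet it if the
  -- claim fails, so by connectedness they share a parameter. Its root in the closed upper half
  -- plane cannot have Im > 0 by `A`, nor be real by `hreal`.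
  let A : Set ℝ := {s | ∀ z : ℂ, 0 < z.im → ‖c‖ * z.im ^ m ≤ ‖(g s).eval z‖}
  let K : Set (ℝ × ℂ) :=
    (Set.Icc (0 : ℝ) 1 ×ˢ Metric.closedBall (0 : ℂ) M) ∩
      {p | 0 ≤ p.2.im ∧ (g p.1).eval p.2 = 0}
  have hA : IsClosed A := by
    simp only [A, Set.ofPred_forall]
    refine isClosed_iInter fun z => isClosed_iInter fun _ => ?_
    exact isClosed_le continuous_const
      ((hjoint.comp (Continuous.prodMk_left z)).norm)
  have hK : IsCompact K := by
    refine (isCompact_Icc.prod (isCompact_closedBall _ _)).inter_right ?_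
    exact (isClosed_le continuous_const (Complex.continuous_im.comp continuous_snd)).inter
      (isClosed_eq hjoint continuous_const)
  have hB : IsClosed (Prod.fst '' K) := (hK.image continuous_fst).isClosed
  have hmemB : ∀ s ∈ Set.Icc (0 : ℝ) 1, ∀ z : ℂ, 0 ≤ z.im → (g s).eval z = 0 →
      s ∈ Prod.fst '' K := fun s hs z hz h =>
    ⟨(s, z), ⟨⟨hs, by simpa using hM s hs z h⟩, hz, h⟩, rfl⟩
  have hmemA : ∀ s, (∀ z : ℂ, 0 ≤ z.im → (g s).eval z ≠ 0) → s ∈ A := by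
    intro s hs z hz
    have hsp := IsAlgClosed.splits (g s)
    have hcard := hsp.natDegree_eq_card_roots
    rw [hsp.eval_eq_prod_roots, hlc, norm_mul]
    refine mul_le_mul_of_nonneg_left ?_ (norm_nonneg _)
    rw [hnat] at hcard
    rw [hcard]
    have key : ∀ S : Multiset ℂ, (∀ r ∈ S, (g s).eval r = 0) →
        z.im ^ S.card ≤ ‖(S.map fun r => z - r).prod‖ := by
      intro S
      induction S using Multiset.induction_on with
      | empty => intro _; simp
      | cons r S ih =>
        intro hr
        rw [Multiset.map_cons, Multiset.prod_cons, norm_mul, Multiset.card_cons, pow_succ']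
        have h1 : z.im ≤ ‖z - r‖ := by
          have h2 : r.im < 0 := by
            by_contra! h3
            exact hs r h3 (hr r (Multiset.mem_cons_self _ _))
          calc z.im ≤ (z - r).im := by rw [Complex.sub_im]; linarith
            _ ≤ |(z - r).im| := le_abs_self _
            _ ≤ _ := Complex.abs_im_le_norm _
        exact mul_le_mul h1 (ih fun r' h' => hr r' (Multiset.mem_cons_of_mem h'))
          (pow_nonneg hz.le _) (norm_nonneg _)
    exact key _ fun r hr => isRoot_of_mem_roots hr
  intro h1
  have hconn := isPreconnected_closed_iff.mp (isPreconnected_Icc (a := (0 : ℝ)) (b := 1)) A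
    (Prod.fst '' K) hA hB
    (fun s hs => by
      by_cases h : ∃ z : ℂ, 0 ≤ z.im ∧ (g s).eval z = 0
      · obtain ⟨z, hz, h⟩ := h
        exact Or.inr (hmemB s hs z hz h)
      · push Not at h
        exact Or.inl (hmemA s h))
    ⟨0, by simp, hmemA 0 h0⟩ ⟨1, by simp, hmemB 1 (by simp) z hz h1⟩
  obtain ⟨s, hs, hsA, ⟨⟨s', w⟩, ⟨⟨_, _⟩, hw, hw0⟩, rfl⟩⟩ := hconn
  dsimp only at hs hsA hw hw0
  rcases hw.lt_or_eq with hw | hw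
  · have := hsA w hw
    rw [hw0, norm_zero] at this
    exact absurd this (not_le.mpr (by positivity))
  · refine hreal s' hs w.re ?_
    rwa [show ((w.re : ℝ) : ℂ) = w from Complex.ext (by simp) (by simpa using hw)]

variable {E : Type*} [CommRing E] [Algebra ℂ E] (L : E →ₗ[ℂ] ℂ)

/-- The polynomial `z ↦ L (B (x + z b)^k)`. -/
def linePoly (B x b : E) (k : ℕ) : ℂ[X] :=
  ∑ j ∈ Finset.range (k + 1), monomial j (L (B * (b ^ j * x ^ (k - j))) * (k.choose j : ℂ))

theorem eval_linePoly (B x b : E) (k : ℕ) (z : ℂ) :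
    (linePoly L B x b k).eval z = L (B * (x + z • b) ^ k) := by
  rw [linePoly, eval_finsetSum, add_comm x, add_pow, Finset.mul_sum, map_sum]
  refine Finset.sum_congr rfl fun j _ => ?_
  rw [eval_monomial, _root_.smul_pow]
  have : B * (z ^ j • b ^ j * x ^ (k - j) * (k.choose j : E)) =
      (z ^ j * (k.choose j : ℂ)) • (B * (b ^ j * x ^ (k - j))) := by
    rw [mul_smul, Algebra.smul_def (k.choose j : ℂ), map_natCast, smul_mul_assoc, smul_mul_assoc,
      mul_smul_comm]
    congr 1
    ring
  rw [this, map_smul, smul_eq_mul]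
  ring

theorem coeff_linePoly (B x b : E) (k j : ℕ) (hj : j ≤ k) :
    (linePoly L B x b k).coeff j = L (B * (b ^ j * x ^ (k - j))) * (k.choose j : ℂ) := by
  rw [linePoly, finsetSum_coeff]
  simp only [coeff_monomial]
  rw [Finset.sum_ite_eq' , if_pos (Finset.mem_range.mpr (by omega))]

theorem natDegree_linePoly_le (B x b : E) (k : ℕ) : (linePoly L B x b k).natDegree ≤ k :=
  natDegree_sum_le_of_forall_le _ _ fun _ hj =>
    (natDegree_monomial_le _).trans (Nat.lt_succ_iff.mp (Finset.mem_range.mp hj))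

theorem coeff_linePoly_self (B x b : E) (k : ℕ) :
    (linePoly L B x b k).coeff k = L (B * b ^ k) := by
  simp [coeff_linePoly]

/-- Differentiating along b trades one factor of the power for a factor b in the multiplier.
Iteration polarizes L(x^m) into mixed products. -/
theorem derivative_linePoly (B x b : E) (k : ℕ) :
    derivative (linePoly L B x b (k + 1)) = C ((k : ℂ) + 1) * linePoly L (B * b) x b k := by
  ext j
  rw [coeff_derivative, coeff_C_mul]
  rcases le_or_gt j k with h | h
  · rw [coeff_linePoly _ _ _ _ _ _ (by omega), coeff_linePoly _ _ _ _ _ _ h]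
    have h1 : ((k + 1).choose (j + 1) : ℂ) * (j + 1) = (k + 1) * (k.choose j : ℂ) := by
      exact_mod_cast (Nat.add_one_mul_choose_eq k j).symm
    have h2 : B * (b ^ (j + 1) * x ^ (k + 1 - (j + 1))) = B * b * (b ^ j * x ^ (k - j)) := by
      rw [Nat.add_sub_add_right]; ring
    rw [h2, mul_assoc, h1]; ring
  · rw [coeff_eq_zero_of_natDegree_lt ((natDegree_linePoly_le _ _ _ _ _).trans_lt (by omega)),
      coeff_eq_zero_of_natDegree_lt ((natDegree_linePoly_le _ _ _ _ _).trans_lt (by omega))]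
    simp

theorem degree_linePoly_pos {B b : E} {k : ℕ} (x : E) (h : L (B * b ^ (k + 1)) ≠ 0) :
    0 < (linePoly L B x b (k + 1)).degree := by
  rw [← natDegree_pos_iff_degree_pos]
  exact (Nat.succ_pos k).trans_le
    (le_natDegree_of_ne_zero (by rw [coeff_linePoly_self]; exact h))

theorem map_smul_pow (B x : E) (k : ℕ) (z : ℂ) :
    L (B * (z • x) ^ k) = z ^ k * L (B * x ^ k) := by
  rw [_root_.smul_pow, mul_smul_comm, map_smul, smul_eq_mul]

/-- Along z ↦ L((u + s v + z a)^m) the leading coefficient L(a^m) does not depend on s, so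
`roots_lowerHalfPlane_of_homotopy` applies. -/
theorem linePoly_homotopy {m : ℕ} {u v a : E} (ha : L (a ^ m) ≠ 0)
    (hreal : ∀ s ∈ Set.Icc (0 : ℝ) 1, ∀ t : ℝ, L ((u + (s : ℂ) • v + (t : ℂ) • a) ^ m) ≠ 0)
    (h0 : ∀ z : ℂ, 0 ≤ z.im → L ((u + z • a) ^ m) ≠ 0) (z : ℂ) (hz : 0 ≤ z.im) :
    L ((u + v + z • a) ^ m) ≠ 0 := by
  have h := roots_lowerHalfPlane_of_homotopy ha
    (fun s : ℝ => linePoly L 1 (u + (s : ℂ) • v) a m) (fun s => natDegree_linePoly_le _ _ _ _ _)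
    (fun s => by rw [coeff_linePoly_self, one_mul]) ?_ ?_ ?_ z hz
  · simpa [eval_linePoly] using h
  · intro j
    rcases le_or_gt j m with hj | hj
    · simp_rw [coeff_linePoly L _ _ _ _ _ hj, one_mul, ← eval_linePoly]
      fun_prop
    · simp_rw [coeff_eq_zero_of_natDegree_lt ((natDegree_linePoly_le L _ _ _ _).trans_lt hj)]
      exact continuous_const
  · intro s hs t
    simpa [eval_linePoly] using hreal s hs t
  · intro z hz
    simpa [eval_linePoly] using h0 z hz

variable (R : AddSubgroup E) (e : E) (m : ℕ)

/-- Stability in the imaginary direction y can be enlarged by one cone direction a: with z = i s it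
yields stability in the direction y + s a. -/
theorem stable_of_cone (hRs : ∀ (t : ℝ), ∀ w ∈ R, (t : ℂ) • w ∈ R) (hem : L (e ^ m) ≠ 0)
    (h1 : ∀ x ∈ R, ∀ z : ℂ, z.im ≠ 0 → L ((x + z • e) ^ m) ≠ 0)
    {y a : E}
    (hy : ∀ x ∈ R, ∀ α : ℝ, 0 ≤ α → L ((x + Complex.I • (y + (α : ℂ) • e)) ^ m) ≠ 0)
    (haR : a ∈ R) (ha : ∀ t : ℝ, 0 ≤ t → L ((a + (t : ℂ) • e) ^ m) ≠ 0) {x : E} (hx : x ∈ R)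
    {z : ℂ} (hz : 0 ≤ z.im) : L ((x + Complex.I • y + z • a) ^ m) ≠ 0 := by
  -- The path runs from i e to x + i y. For s > 0, division by s turns a point of it, shifted by t
  -- a, into a real element plus i(y + ((1-s)/s) e), which `hy` covers. At s = 0 hyperbolicity in
  -- the direction e suffices.
  have key := linePoly_homotopy L (m := m) (u := Complex.I • e)
    (v := x + Complex.I • (y - e)) (a := a) (by simpa using ha 0 le_rfl) ?_ ?_ z hz
  · convert key using 3
    rw [smul_sub]; abel
  · intro s hs t
    rcases hs.1.eq_or_lt with rfl | hs0
    · rw [Complex.ofReal_zero, zero_smul, add_zero, add_comm]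
      exact h1 _ (hRs t a haR) _ (by simp)
    · have hsc : (s : ℂ) ≠ 0 := by exact_mod_cast hs0.ne'
      have hval := hy (x + ((t / s : ℝ) : ℂ) • a) (R.add_mem hx (hRs _ _ haR)) ((1 - s) / s)
        (div_nonneg (by linarith [hs.2]) hs0.le)
      have heq : Complex.I • e + (s : ℂ) • (x + Complex.I • (y - e)) + (t : ℂ) • a =
          (s : ℂ) • (x + ((t / s : ℝ) : ℂ) • a + Complex.I • (y + (((1 - s) / s : ℝ) : ℂ) • e)) := by
        push_cast
        match_scalars <;> field_simp
        ring
      have := map_smul_pow L 1 (x + ((t / s : ℝ) : ℂ) • a +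
        Complex.I • (y + (((1 - s) / s : ℝ) : ℂ) • e)) m s
      rw [one_mul, one_mul] at this
      rw [heq, this]
      exact mul_ne_zero (pow_ne_zero _ hsc) hval
  · intro w hw
    rcases eq_or_ne w 0 with rfl | hw0
    · have := map_smul_pow L 1 e m Complex.I
      rw [one_mul, one_mul] at this
      rw [zero_smul, add_zero, this]
      exact mul_ne_zero (pow_ne_zero _ Complex.I_ne_zero) hem
    · have heq : Complex.I • e + w • a = w • (a + (Complex.I / w) • e) := by
        match_scalars <;> field_simp
      have := map_smul_pow L 1 (a + (Complex.I / w) • e) m w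
      rw [one_mul, one_mul] at this
      rw [heq, this]
      refine mul_ne_zero (pow_ne_zero _ hw0) ?_
      -- A nonreal i/w is excluded by hyperbolicity. A real one equals Im w / |w|² ≥ 0, so a + (i/w)
      -- e is covered by the cone hypothesis on a.
      by_cases him : (Complex.I / w).im = 0
      · have hre : Complex.I / w = ((Complex.I / w).re : ℂ) := Complex.ext rfl (by simpa using him)
        rw [hre]
        refine ha _ ?_
        rw [Complex.div_re]
        simp only [Complex.I_re, Complex.I_im, zero_mul, zero_div, one_mul, zero_add]
        exact div_nonneg hw (Complex.normSq_nonneg _)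
      · exact h1 a haR _ him

/-- The cone directions are added one at a time by `stable_of_cone` with z = i s_i. Quantifying over
all α > 0 in the induction supplies the required stability of y + α' e for every α' ≥ 0. -/
theorem stable_sum (hRs : ∀ (t : ℝ), ∀ w ∈ R, (t : ℂ) • w ∈ R) (hem : L (e ^ m) ≠ 0)
    (h1 : ∀ x ∈ R, ∀ z : ℂ, z.im ≠ 0 → L ((x + z • e) ^ m) ≠ 0) {ι : Type*} (a : ι → E)
    (haR : ∀ i, a i ∈ R) (ha : ∀ i, ∀ t : ℝ, 0 ≤ t → L ((a i + (t : ℂ) • e) ^ m) ≠ 0)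
    (s : ι → ℝ) (hs : ∀ i, 0 ≤ s i) (F : Finset ι) :
    ∀ x ∈ R, ∀ α : ℝ, 0 < α →
      L ((x + Complex.I • ((∑ i ∈ F, (s i : ℂ) • a i) + (α : ℂ) • e)) ^ m) ≠ 0 := by
  classical
  induction F using Finset.induction_on with
  | empty =>
    intro x hx α hα
    rw [Finset.sum_empty, zero_add, smul_smul]
    exact h1 x hx _ (by simpa using hα.ne')
  | insert i F hi ih =>
    intro x hx α hα
    have := stable_of_cone L R e m hRs hem h1
      (y := (∑ i ∈ F, (s i : ℂ) • a i) + (α : ℂ) • e) (a := a i) ?_ (haR i) (ha i) hx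
      (z := Complex.I * s i) (by simpa using hs i)
    · convert this using 3
      rw [Finset.sum_insert hi, mul_smul]
      simp only [smul_add]
      abel
    · intro x' hx' α' hα'
      have := ih x' hx' (α + α') (by linarith)
      rwa [add_assoc, ← add_smul, ← Complex.ofReal_add]

/-- Differentiation in a direction of the cone preserves stability and positivity. -/
theorem stable_derivative (hRs : ∀ (t : ℝ), ∀ w ∈ R, (t : ℂ) • w ∈ R) {D : Set E} (hDR : D ⊆ R)
    (hadd : ∀ x ∈ D, ∀ y ∈ D, x + y ∈ D) (hsmul : ∀ x ∈ D, ∀ t : ℝ, 0 < t → (t : ℂ) • x ∈ D)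
    {B b : E} {k : ℕ} (hB : ∀ x ∈ R, ∀ y ∈ D, L (B * (x + Complex.I • y) ^ (k + 1)) ≠ 0)
    (hb : b ∈ D) :
    (∀ x ∈ R, ∀ y ∈ D, L (B * b * (x + Complex.I • y) ^ k) ≠ 0) ∧
      (∀ y ∈ D, 0 < L (B * y ^ (k + 1)) → 0 < L (B * b * y ^ k)) := by
  have hD0 : ∀ y ∈ D, L (B * y ^ (k + 1)) ≠ 0 := by
    intro y hy
    have := hB 0 R.zero_mem y hy
    rw [zero_add, map_smul_pow] at this
    exact right_ne_zero_of_mul this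
  have hk : ((k : ℂ) + 1) ≠ 0 := by exact_mod_cast Nat.succ_ne_zero k
  have hbz : ∀ y ∈ D, ∀ t : ℝ, 0 ≤ t → y + (t : ℂ) • b ∈ D := by
    intro y hy t ht
    rcases ht.eq_or_lt with rfl | ht
    · simpa using hy
    · exact hadd _ hy _ (hsmul _ hb _ ht)
  constructor
  · intro x hx y hy
    -- Gauss–Lucas for z ↦ L(B (x + i y + z b)^{k+1}) at 0: when Im z ≥ 0, the real part of z moves
    -- x inside R and the imaginary part moves y inside D.
    have := eval_derivative_ne_zero_of_halfPlane
      (degree_linePoly_pos L (x + Complex.I • y) (hD0 b hb)) 0 ?_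
    · rw [derivative_linePoly, eval_mul, eval_linePoly] at this
      simpa using right_ne_zero_of_mul this
    · intro z hz
      rw [eval_linePoly]
      have h := hB (x + (z.re : ℂ) • b) (R.add_mem hx (hRs _ _ (hDR hb))) _ (hbz y hy z.im hz)
      convert h using 4
      nth_rewrite 1 [← Complex.re_add_im z]
      module
  · intro y hy hpos
    -- All roots of z ↦ L(B (y + z b)^{k+1}) are negative reals, so (k+1) L(B b y^k) / L(B y^{k+1})
    -- is positive, as a logarithmic derivative at 0.
    have h := eval_derivative_div_eval_pos (degree_linePoly_pos L y (hD0 b hb)) ?_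
    · rw [derivative_linePoly, eval_mul, eval_linePoly, eval_linePoly, eval_C, zero_smul,
        add_zero] at h
      have h2 := mul_pos h hpos
      rw [div_mul_cancel₀ _ hpos.ne'] at h2
      have h3 : (0 : ℂ) < ((k + 1 : ℝ) : ℂ) := by
        rw [Complex.zero_lt_real]; positivity
      push_cast at h3
      exact pos_of_mul_pos_right h2 h3.le
    · intro z hz
      rw [eval_linePoly] at hz
      by_contra hneg
      rw [Complex.neg_iff, not_and_or, not_lt] at hneg
      by_cases him : z.im = 0
      · have hre : 0 ≤ z.re := hneg.resolve_right (not_not.mpr him)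
        have hz' : z = (z.re : ℂ) := Complex.ext rfl (by simpa using him)
        rw [hz'] at hz
        exact hD0 _ (hbz y hy _ hre) hz
      · have hyR : y + (z.re : ℂ) • b ∈ R := R.add_mem (hDR hy) (hRs _ _ (hDR hb))
        -- A root in the lower half plane is handled by multiplying y + z b by -1, which makes its
        -- imaginary direction a positive multiple of b.
        rcases lt_or_gt_of_ne him with hlt | hgt
        · have h := hB _ (R.neg_mem hyR) _ (hsmul b hb (-z.im) (by linarith))
          have heq : -(y + (z.re : ℂ) • b) + Complex.I • ((-z.im : ℝ) : ℂ) • b =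
              (-1 : ℂ) • (y + z • b) := by
            nth_rewrite 3 [← Complex.re_add_im z]
            push_cast
            module
          rw [heq, map_smul_pow, hz, mul_zero] at h
          exact h rfl
        · have h := hB _ hyR _ (hsmul b hb z.im hgt)
          have heq : (y + (z.re : ℂ) • b) + Complex.I • ((z.im : ℝ) : ℂ) • b = y + z • b := by
            nth_rewrite 3 [← Complex.re_add_im z]
            module
          rw [heq] at h
          exact h hz

/-- **Gårding's inequality**: a mixed product of elements of the hyperbolicity cone is positive. -/
theorem garding (hRs : ∀ (t : ℝ), ∀ w ∈ R, (t : ℂ) • w ∈ R) (he : e ∈ R) (hem : 0 < L (e ^ m))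
    (h1 : ∀ x ∈ R, ∀ z : ℂ, z.im ≠ 0 → L ((x + z • e) ^ m) ≠ 0) {ι : Type*} [Fintype ι]
    (hι : Fintype.card ι = m) (a : ι → E)
    (haR : ∀ i, a i ∈ R) (ha : ∀ i, ∀ t : ℝ, 0 ≤ t → L ((a i + (t : ℂ) • e) ^ m) ≠ 0)
    {δ : ℝ} (hδ : 0 < δ) : 0 < L (∏ i, (a i + (δ : ℂ) • e)) := by
  classical
  -- The coefficient of e is strictly positive on this convex cone; the shift by δ > 0 is what
  -- places the factors a_i + δ e in it.
  let D : Set E := {y | ∃ (s : ι → ℝ) (α : ℝ), (∀ i, 0 ≤ s i) ∧ 0 < α ∧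
    y = (∑ i, (s i : ℂ) • a i) + (α : ℂ) • e}
  have hDR : D ⊆ R := by
    rintro y ⟨s, α, _, _, rfl⟩
    exact R.add_mem (R.sum_mem fun i _ => hRs _ _ (haR i)) (hRs _ _ he)
  have hadd : ∀ x ∈ D, ∀ y ∈ D, x + y ∈ D := by
    rintro _ ⟨s, α, hs, hα, rfl⟩ _ ⟨s', α', hs', hα', rfl⟩
    refine ⟨s + s', α + α', fun i => add_nonneg (hs i) (hs' i), add_pos hα hα', ?_⟩
    simp only [Pi.add_apply, Complex.ofReal_add, add_smul, Finset.sum_add_distrib]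
    abel
  have hsmul : ∀ x ∈ D, ∀ t : ℝ, 0 < t → (t : ℂ) • x ∈ D := by
    rintro _ ⟨s, α, hs, hα, rfl⟩ t ht
    refine ⟨fun i => t * s i, t * α, fun i => mul_nonneg ht.le (hs i), mul_pos ht hα, ?_⟩
    simp only [Complex.ofReal_mul, mul_smul, smul_add, Finset.smul_sum]
  have heD : e ∈ D := ⟨0, 1, fun _ => le_rfl, one_pos, by simp⟩
  have hbD : ∀ i, a i + (δ : ℂ) • e ∈ D := fun i =>
    ⟨Pi.single i 1, δ, fun j => by
      by_cases h : j = i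
      · subst h; simp
      · simp [h], hδ, by
      simp only [Pi.single_apply]
      simp [ite_smul]⟩
  -- The factors e of e^m are replaced one by one by a_i + δ e. Stability has to be carried along
  -- with positivity, because each replacement is a differentiation that uses it.
  have key : ∀ F : Finset ι, ∀ k, F.card + k = m →
      (∀ x ∈ R, ∀ y ∈ D, L ((∏ i ∈ F, (a i + (δ : ℂ) • e)) * (x + Complex.I • y) ^ k) ≠ 0) ∧
      0 < L ((∏ i ∈ F, (a i + (δ : ℂ) • e)) * e ^ k) := by
    intro F
    induction F using Finset.induction_on with
    | empty =>
      rintro k hk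
      rw [Finset.card_empty, zero_add] at hk
      subst hk
      simp only [Finset.prod_empty, one_mul]
      refine ⟨?_, hem⟩
      rintro x hx _ ⟨s, α, hs, hα, rfl⟩
      exact stable_sum L R e k hRs hem.ne' h1 a haR ha s hs _ x hx α hα
    | insert i F hi ih =>
      intro k hk
      rw [Finset.card_insert_of_notMem hi] at hk
      obtain ⟨h3, h4⟩ := ih (k + 1) (by omega)
      have := stable_derivative L R hRs hDR hadd hsmul h3 (hbD i)
      rw [Finset.prod_insert hi, mul_comm (a i + _)]
      exact ⟨this.1, this.2 e heD h4⟩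
  simpa using (key Finset.univ 0 (by simpa using hι)).2

/-- Hyperbolicity passes to the derivatives in the direction `e`. -/
theorem hyperbolic_mul_pow (hem : ∀ x ∈ R, ∀ z : ℂ, z.im ≠ 0 → L ((x + z • e) ^ m) ≠ 0)
    (he : L (e ^ m) ≠ 0) (j k : ℕ) (hjk : j + k = m) :
    ∀ x ∈ R, ∀ z : ℂ, z.im ≠ 0 → L (e ^ j * (x + z • e) ^ k) ≠ 0 := by
  suffices h : ∀ j k, j + k = m → ∀ x ∈ R, ∀ z : ℂ, 0 < z.im →
      L (e ^ j * (x + z • e) ^ k) ≠ 0 by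
    intro x hx z hz
    rcases lt_or_gt_of_ne hz with hlt | hgt
    · have := h j k hjk (-x) (R.neg_mem hx) (-z) (by simpa using hlt)
      rw [show -x + -z • e = (-1 : ℂ) • (x + z • e) by module, map_smul_pow] at this
      exact right_ne_zero_of_mul this
    · exact h j k hjk x hx z hgt
  intro j
  induction j with
  | zero =>
    intro k hk x hx z hz
    rw [zero_add] at hk
    subst hk
    simpa using hem x hx z hz.ne'
  | succ j ih =>
    intro k hk x hx z hz
    -- Gauss–Lucas is used at z itself: the half plane Im w ≥ Im z lies inside Im w > 0, where the
    -- previous polynomial has no root.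
    have h := eval_derivative_ne_zero_of_halfPlane
      (degree_linePoly_pos L (B := e ^ j) (b := e) (k := k) x
        (by rw [← pow_add]; rwa [show j + (k + 1) = m by omega])) z ?_
    · rw [derivative_linePoly, eval_mul, eval_linePoly] at h
      rw [pow_succ]
      exact right_ne_zero_of_mul h
    · intro w hw
      rw [eval_linePoly]
      exact ih (k + 1) (by omega) x hx w (hz.trans_le hw)

end Garding

/-! ### The exterior algebra -/

section Exterior

variable {n : ℕ}

theorem om_mul_self (A : Idx n) : om A * om A = 0 := ExteriorAlgebra.ι_sq_zero _

theorem om_mul_swap (A B : Idx n) : om A * om B = -(om B * om A) :=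
  eq_neg_of_add_eq_zero_left (ExteriorAlgebra.ι_add_mul_swap _ _)

/-- Moving a one-form past two others changes the sign twice. Centrality of these products is what
allows the commutative algebra of the preceding section to be applied to forms. -/
theorem ι_mul_ι_mem_center (v w : Idx n → ℂ) :
    ExteriorAlgebra.ι ℂ v * ExteriorAlgebra.ι ℂ w ∈ Subalgebra.center ℂ (Ext n) := by
  have hswap : ∀ x y : Idx n → ℂ, ExteriorAlgebra.ι ℂ x * ExteriorAlgebra.ι ℂ y =
      -(ExteriorAlgebra.ι ℂ y * ExteriorAlgebra.ι ℂ x) := fun x y =>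
    eq_neg_of_add_eq_zero_left (ExteriorAlgebra.ι_add_mul_swap _ _)
  rw [Subalgebra.mem_center_iff]
  intro b
  induction b using ExteriorAlgebra.induction with
  | algebraMap r => exact Algebra.commutes _ _
  | ι x =>
    rw [← mul_assoc, hswap x v, neg_mul, mul_assoc, hswap x w, mul_neg, neg_neg, mul_assoc]
  | mul a b ha hb => rw [mul_assoc, hb, ← mul_assoc, ha, mul_assoc]
  | add a b ha hb => rw [add_mul, mul_add, ha, hb]

theorem om_mul_om_mem_center (A B : Idx n) : om A * om B ∈ Subalgebra.center ℂ (Ext n) :=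
  ι_mul_ι_mem_center _ _

theorem extBasis_eq_prod (I : Finset (Idx n)) :
    extBasis n I = ((I.sort (· ≤ ·)).map om).prod := by
  rw [extBasis, ExteriorAlgebra.basis_apply_ofCard _ rfl, ExteriorAlgebra.ιMulti_family,
    ExteriorAlgebra.ιMulti_apply]
  congr 1
  refine List.ext_getElem (by simp) fun i h1 h2 => ?_
  simp only [List.getElem_ofFn, List.getElem_map, Function.comp_apply, om]
  rw [Pi.basisFun_apply]
  congr 2

/-- In the lexicographic order on `Idx n` the indices l and n + l are adjacent, so the sorted
product is Ω_{2n} with sign +1 and `topCoeff` has the right normalization. -/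
theorem extBasis_univ : extBasis n Finset.univ = volForm n := by
  have hsort : (Finset.univ : Finset (Idx n)).sort (· ≤ ·) =
      (List.finRange n).flatMap fun l => [toLex (l, (0 : Fin 2)), toLex (l, 1)] := by
    have hnd : ((List.finRange n).flatMap
        fun l => [toLex (l, (0 : Fin 2)), toLex (l, 1)]).Nodup := by
      rw [List.nodup_flatMap]
      refine ⟨fun l _ => by simp, (List.nodup_finRange n).imp ?_⟩
      intro a b hab
      simp [Function.onFun, hab.symm]
    have huniv : (Finset.univ : Finset (Idx n)) = ((List.finRange n).flatMap
        fun l => [toLex (l, (0 : Fin 2)), toLex (l, 1)]).toFinset := by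
      ext A
      obtain ⟨⟨l, c⟩, rfl⟩ := toLex.surjective A
      fin_cases c <;> simp
    rw [huniv, List.toFinset_sort _ hnd, List.pairwise_flatMap]
    refine ⟨fun l _ => ?_, ?_⟩
    · simp [Prod.Lex.le_iff]
    · refine (List.pairwise_lt_finRange n).imp ?_
      intro a b hab
      simp [Prod.Lex.le_iff, hab]
  rw [extBasis_eq_prod, hsort, volForm, List.ofFn_eq_map]
  induction List.finRange n with
  | nil => simp
  | cons a l ih =>
    rw [List.flatMap_cons, List.map_append, List.prod_append, ih]
    simp

theorem topCoeff_volForm : topCoeff n (volForm n) = 1 := by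
  rw [← extBasis_univ, topCoeff, Module.Basis.coord_apply, Module.Basis.repr_self,
    Finsupp.single_eq_same]

/-- The `2`-form `ω^l ∧ ω^{n+l}` as an element of the centre of the exterior algebra. -/
def pairForm (l : Fin n) : Subalgebra.center ℂ (Ext n) :=
  ⟨om (toLex (l, 0)) * om (toLex (l, 1)), om_mul_om_mem_center _ _⟩

/-- The form `β_n` as an element of the centre. -/
def betaC (n : ℕ) : Subalgebra.center ℂ (Ext n) := ∑ l : Fin n, pairForm l

theorem coe_betaC : (betaC n : Ext n) = beta n := by
  simp [betaC, beta, pairForm]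

theorem pairForm_sq (l : Fin n) : pairForm l * pairForm l = 0 := by
  apply Subtype.ext
  change om _ * om _ * (om _ * om _) = 0
  rw [mul_assoc, ← mul_assoc (om (toLex (l, 1))), om_mul_swap (toLex (l, 1)), neg_mul, mul_assoc,
    om_mul_self, mul_zero, neg_zero, mul_zero]

theorem coe_prod_pairForm : ((∏ l : Fin n, pairForm l : Subalgebra.center ℂ (Ext n)) : Ext n) =
    volForm n := by
  rw [← List.prod_ofFn, volForm]
  have : ∀ L : List (Subalgebra.center ℂ (Ext n)),
      ((L.prod : Subalgebra.center ℂ (Ext n)) : Ext n) = (L.map Subtype.val).prod := fun L =>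
    map_list_prod (Subalgebra.center ℂ (Ext n)).val L
  rw [this, List.map_ofFn]
  rfl

end Exterior

/-! ### Powers of sums of commuting square-zero elements -/

section SquareZero

variable {E : Type*} [CommRing E]

theorem add_pow_succ_of_sq_zero {a : E} (ha : a * a = 0) (y : E) (k : ℕ) :
    (a + y) ^ (k + 1) = y ^ (k + 1) + (k + 1 : ℕ) * a * y ^ k := by
  induction k with
  | zero => simp [add_comm]
  | succ k ih =>
    rw [pow_succ, ih]
    push_cast
    linear_combination ((k : E) + 1) * y ^ k * ha

/-- Only squarefree monomials survive in the multinomial expansion. The vanishing of the next power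
is included because the inductive step needs it. -/
theorem sum_pow_card_of_sq_zero {ι : Type*} (N : ι → E) (hN : ∀ i, N i * N i = 0)
    (F : Finset ι) : (∑ i ∈ F, N i) ^ F.card = (F.card ! : E) * ∏ i ∈ F, N i ∧
      (∑ i ∈ F, N i) ^ (F.card + 1) = 0 := by
  classical
  induction F using Finset.induction_on with
  | empty => simp
  | insert i F hi ih =>
    rw [Finset.sum_insert hi, Finset.card_insert_of_notMem hi, Finset.prod_insert hi,
      add_pow_succ_of_sq_zero (hN i), add_pow_succ_of_sq_zero (hN i), ih.1, ih.2,
      pow_succ _ (F.card + 1), ih.2, Nat.factorial_succ]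
    constructor
    · push_cast; ring
    · ring

variable [Algebra ℂ E]

/-- Compare the coefficients of z^{n-m} in L((∑ (z + x_i) N_i)^n) = n! ∏ (z + x_i) · L(∏ N_i): one
side is binomial, the other is Vieta's formula. -/
theorem map_sum_pow_mul_sum_pow {n m : ℕ} (hmn : m ≤ n) (N : Fin n → E)
    (hN : ∀ i, N i * N i = 0) (L : E →ₗ[ℂ] ℂ) (x : Fin n → ℂ) :
    L ((∑ i, x i • N i) ^ m * (∑ i, N i) ^ (n - m)) =
      (m ! : ℂ) * ((n - m) ! : ℂ) *
        (∑ t ∈ Finset.powersetCard m (Finset.univ : Finset (Fin n)), ∏ i ∈ t, x i) *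
        L (∏ i, N i) := by
  have hpoly : linePoly L 1 (∑ i, x i • N i) (∑ i, N i) n =
      Polynomial.C ((n ! : ℂ) * L (∏ i, N i)) *
        ∏ i : Fin n, (Polynomial.X + Polynomial.C (x i)) := by
    refine Polynomial.funext fun z => ?_
    rw [eval_linePoly, one_mul, Polynomial.eval_mul, Polynomial.eval_C, Polynomial.eval_prod]
    have h1 : (∑ i, x i • N i) + z • ∑ i, N i = ∑ i, (z + x i) • N i := by
      simp only [Finset.smul_sum, add_smul, Finset.sum_add_distrib]
      rw [add_comm]
    have h2 := (sum_pow_card_of_sq_zero (fun i => (z + x i) • N i)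
      (fun i => by rw [smul_mul_smul_comm, hN, smul_zero]) Finset.univ).1
    rw [Finset.card_univ, Fintype.card_fin] at h2
    rw [h1, h2, Finset.prod_smul, mul_smul_comm, map_smul, ← nsmul_eq_mul, map_nsmul]
    simp
    ring
  have hc := congrArg (fun p => p.coeff (n - m)) hpoly
  rw [coeff_linePoly _ _ _ _ _ _ (Nat.sub_le _ _), Polynomial.coeff_C_mul,
    Finset.prod_X_add_C_coeff _ _ (by simp), Finset.card_univ, Fintype.card_fin,
    Nat.sub_sub_self hmn, one_mul, Nat.choose_symm hmn] at hc
  have hch : (n.choose m : ℂ) * (m ! * (n - m) !) = n ! := by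
    have := Nat.choose_mul_factorial_mul_factorial hmn
    rw [mul_assoc] at this
    exact_mod_cast this
  have hne : (n.choose m : ℂ) ≠ 0 := by exact_mod_cast (Nat.choose_pos hmn).ne'
  refine mul_right_cancel₀ hne ?_
  rw [mul_comm (_ ^ m), hc, ← hch]
  ring

end SquareZero

/-! ### Functions with values in the exterior algebra -/

section Coordinates

variable {n : ℕ} {X : Type*}

/-- The coordinates of `F` belong to the algebra `S` of complex functions. -/
def CoordIn (S : Subalgebra ℂ (X → ℂ)) (F : X → Ext n) : Prop :=
  ∀ I, (fun x => (extBasis n).repr (F x) I) ∈ S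

theorem repr_mul (a b : Ext n) (K : Finset (Idx n)) :
    (extBasis n).repr (a * b) K = ∑ I, ∑ J, (extBasis n).repr a I * (extBasis n).repr b J *
      (extBasis n).repr (extBasis n I * extBasis n J) K := by
  conv_lhs => rw [← (extBasis n).sum_repr a, ← (extBasis n).sum_repr b]
  rw [Finset.sum_mul_sum]
  simp only [map_sum, Finsupp.coe_finsetSum, Finset.sum_apply, smul_mul_smul_comm, map_smul,
    Finsupp.smul_apply, smul_eq_mul]

namespace CoordIn

variable {S : Subalgebra ℂ (X → ℂ)} {F G : X → Ext n}

theorem const (w : Ext n) : CoordIn S fun _ => w := fun _ => S.algebraMap_mem _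

theorem add (hF : CoordIn S F) (hG : CoordIn S G) : CoordIn S fun x => F x + G x := fun I => by
  have := S.add_mem (hF I) (hG I)
  simpa [Pi.add_def] using this

theorem smul {f : X → ℂ} (hf : f ∈ S) (hF : CoordIn S F) : CoordIn S fun x => f x • F x :=
  fun I => by
    have := S.mul_mem hf (hF I)
    simpa [Pi.mul_def] using this

/-- The coordinates of a product are bilinear in those of the factors, with constant structure
coefficients. Any algebra of functions therefore works, which treats continuity and C^k regularity
at once without a topology on the exterior algebra. -/
theorem mul (hF : CoordIn S F) (hG : CoordIn S G) : CoordIn S fun x => F x * G x := fun K => by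
  have : (∑ I, ∑ J, (fun x => (extBasis n).repr (F x) I) * (fun x => (extBasis n).repr (G x) J) *
      algebraMap ℂ (X → ℂ) ((extBasis n).repr (extBasis n I * extBasis n J) K)) ∈ S :=
    S.sum_mem fun I _ => S.sum_mem fun J _ =>
      S.mul_mem (S.mul_mem (hF I) (hG J)) (S.algebraMap_mem _)
  convert this using 1
  funext x
  rw [repr_mul]
  simp only [Finset.sum_apply, Pi.mul_apply, Pi.algebraMap_apply, Algebra.algebraMap_self,
    RingHom.id_apply]

theorem sum {ι : Type*} {F : ι → X → Ext n} (s : Finset ι) (hF : ∀ i ∈ s, CoordIn S (F i)) :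
    CoordIn S fun x => ∑ i ∈ s, F i x := fun I => by
  have := S.sum_mem fun i hi => hF i hi I
  convert this using 1
  funext x
  simp

theorem pow (hF : CoordIn S F) (k : ℕ) : CoordIn S fun x => F x ^ k := by
  induction k with
  | zero => simpa using const 1
  | succ k ih => simpa only [pow_succ] using ih.mul hF

theorem list_prod {k : ℕ} {F : Fin k → X → Ext n} (hF : ∀ i, CoordIn S (F i)) :
    CoordIn S fun x => (List.ofFn fun i => F i x).prod := by
  induction k with
  | zero => simpa using const 1
  | succ k ih =>
    simp only [List.ofFn_succ, List.prod_cons]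
    exact (hF 0).mul (ih fun i => hF i.succ)

theorem linear (hF : CoordIn S F) (L : Ext n →ₗ[ℂ] ℂ) : (fun x => L (F x)) ∈ S := by
  have : (∑ I, (fun x => (extBasis n).repr (F x) I) * algebraMap ℂ (X → ℂ) (L (extBasis n I))) ∈ S :=
    S.sum_mem fun I _ => S.mul_mem (hF I) (S.algebraMap_mem _)
  convert this using 1
  funext x
  conv_lhs => rw [← (extBasis n).sum_repr (F x), map_sum]
  simp

end CoordIn

end Coordinates

/-! ### The two-form of a quaternionic matrix -/

section Theta

variable {n : ℕ}

/-- The complex number `x_0 + x_1 i` for the quaternion `x_0 + x_1 i + x_2 j + x_3 k`. -/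
def zPart (a : Quaternion ℝ) : ℂ := ⟨a.re, a.imI⟩

/-- The complex number `x_2 + x_3 i` for the quaternion `x_0 + x_1 i + x_2 j + x_3 k`. -/
def wPart (a : Quaternion ℝ) : ℂ := ⟨a.imJ, a.imK⟩

/-- The contribution of the entry `a` in position `(l, k)` to the two-form of a matrix. -/
def thetaEntry (a : Quaternion ℝ) (l k : Fin n) : Ext n :=
  wPart a • (om (toLex (l, 0)) * om (toLex (k, 0))) +
    zPart a • (om (toLex (l, 0)) * om (toLex (k, 1))) -
    star (zPart a) • (om (toLex (l, 1)) * om (toLex (k, 0))) +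
    star (wPart a) • (om (toLex (l, 1)) * om (toLex (k, 1)))

/-- The two-form of a hyperhermitian matrix. -/
def theta (A : Matrix (Fin n) (Fin n) (Quaternion ℝ)) : Ext n :=
  (1 / 2 : ℂ) • ∑ l, ∑ k, thetaEntry (A l k) l k

/-- The complex coordinates of the quaternionic vector `h`. -/
def vecC (h : Fin n → Quaternion ℝ) (A : Idx n) : ℂ :=
  match (ofLex A).2 with
  | 0 => zPart (h (ofLex A).1)
  | 1 => star (wPart (h (ofLex A).1))

/-- The complex coordinates of the image of the quaternionic vector `h` under the quaternionic
structure. -/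
def vecD (h : Fin n → Quaternion ℝ) (A : Idx n) : ℂ :=
  match (ofLex A).2 with
  | 0 => -wPart (h (ofLex A).1)
  | 1 => star (zPart (h (ofLex A).1))

theorem sum_idx {M : Type*} [AddCommMonoid M] (f : Idx n → M) :
    ∑ A, f A = ∑ l : Fin n, (f (toLex (l, 0)) + f (toLex (l, 1))) := by
  rw [← Equiv.sum_comp toLex f, Fintype.sum_prod_type]
  simp [Fin.sum_univ_two]

theorem ι_eq_sum (v : Idx n → ℂ) : ExteriorAlgebra.ι ℂ v = ∑ A, v A • om A := by
  conv_lhs => rw [pi_eq_sum_univ' v]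
  rw [map_sum]
  refine Finset.sum_congr rfl fun A _ => ?_
  rw [map_smul, om]

theorem thetaEntry_add (a b : Quaternion ℝ) (l k : Fin n) :
    thetaEntry (a + b) l k = thetaEntry a l k + thetaEntry b l k := by
  have hz : zPart (a + b) = zPart a + zPart b := rfl
  have hw : wPart (a + b) = wPart a + wPart b := rfl
  simp only [thetaEntry, hz, hw, star_add, add_smul]
  abel

theorem thetaEntry_smul (t : ℝ) (a : Quaternion ℝ) (l k : Fin n) :
    thetaEntry (t • a) l k = (t : ℂ) • thetaEntry a l k := by
  have hz : zPart (t • a) = (t : ℂ) * zPart a := by apply Complex.ext <;> simp [zPart]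
  have hw : wPart (t • a) = (t : ℂ) * wPart a := by apply Complex.ext <;> simp [wPart]
  have ht : star (t : ℂ) = t := Complex.conj_ofReal t
  simp only [thetaEntry, hz, hw, star_mul', ht, smul_add, smul_sub, mul_smul]

theorem theta_add (A B : Matrix (Fin n) (Fin n) (Quaternion ℝ)) :
    theta (A + B) = theta A + theta B := by
  simp only [theta, Matrix.add_apply, thetaEntry_add, Finset.sum_add_distrib, smul_add]

theorem theta_smul (t : ℝ) (A : Matrix (Fin n) (Fin n) (Quaternion ℝ)) :
    theta (t • A) = (t : ℂ) • theta A := by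
  simp only [theta, Matrix.smul_apply, thetaEntry_smul, ← Finset.smul_sum]
  rw [smul_comm]

theorem theta_zero : theta (0 : Matrix (Fin n) (Fin n) (Quaternion ℝ)) = 0 := by
  have := theta_smul 0 (0 : Matrix (Fin n) (Fin n) (Quaternion ℝ))
  simpa using this

theorem theta_sum {ι : Type*} (s : Finset ι) (A : ι → Matrix (Fin n) (Fin n) (Quaternion ℝ)) :
    theta (∑ i ∈ s, A i) = ∑ i ∈ s, theta (A i) := by
  classical
  induction s using Finset.induction_on with
  | empty => simp [theta_zero]
  | insert i s hi ih => rw [Finset.sum_insert hi, Finset.sum_insert hi, theta_add, ih]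

theorem theta_mem_center (A : Matrix (Fin n) (Fin n) (Quaternion ℝ)) :
    theta A ∈ Subalgebra.center ℂ (Ext n) := by
  refine Subalgebra.smul_mem _ (Subalgebra.sum_mem _ fun l _ => Subalgebra.sum_mem _ fun k _ => ?_) _
  have h := fun A B : Idx n => om_mul_om_mem_center A B
  exact add_mem (sub_mem (add_mem (Subalgebra.smul_mem _ (h _ _) _) (Subalgebra.smul_mem _ (h _ _) _))
    (Subalgebra.smul_mem _ (h _ _) _)) (Subalgebra.smul_mem _ (h _ _) _)

/-- `theta` as an element of the centre. -/
def thetaC (A : Matrix (Fin n) (Fin n) (Quaternion ℝ)) : Subalgebra.center ℂ (Ext n) :=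
  ⟨theta A, theta_mem_center A⟩

/-- The two summands are exchanged by (p, l) ↔ (q, k). In the double sum for a rank one matrix they
contribute equally and cancel the factor 1/2 in `theta`. -/
theorem thetaEntry_mul_star (p q : Quaternion ℝ) (l k : Fin n) :
    thetaEntry (p * star q) l k =
      (zPart p • om (toLex (l, 0)) + star (wPart p) • om (toLex (l, 1))) *
        (-wPart q • om (toLex (k, 0)) + star (zPart q) • om (toLex (k, 1))) +
      (zPart q • om (toLex (k, 0)) + star (wPart q) • om (toLex (k, 1))) *
        (-wPart p • om (toLex (l, 0)) + star (zPart p) • om (toLex (l, 1))) := by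
  have hz : zPart (p * star q) = zPart p * star (zPart q) + wPart p * star (wPart q) := by
    apply Complex.ext <;> simp [zPart, wPart, Quaternion.re_mul, Quaternion.imI_mul] <;> ring
  have hw : wPart (p * star q) = -zPart p * wPart q + wPart p * zPart q := by
    apply Complex.ext <;> simp [zPart, wPart, Quaternion.imJ_mul, Quaternion.imK_mul] <;> ring
  simp only [thetaEntry, hz, hw, star_add, star_mul', star_neg, star_star, add_mul, mul_add,
    smul_mul_smul_comm, om_mul_swap (toLex (k, _)) (toLex (l, _))]
  module

/-- The rank one matrix `p p^*`. -/
def rankOne (p : Fin n → Quaternion ℝ) : Matrix (Fin n) (Fin n) (Quaternion ℝ) :=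
  Matrix.of fun l k => p l * star (p k)

/-- Rank one matrices give decomposable two-forms. This is the source of θ_y² = 0 and of the action
of a unitary matrix on forms. -/
theorem theta_rankOne (p : Fin n → Quaternion ℝ) :
    theta (rankOne p) = ExteriorAlgebra.ι ℂ (vecC p) * ExteriorAlgebra.ι ℂ (vecD p) := by
  rw [theta, ι_eq_sum, ι_eq_sum, sum_idx, sum_idx, Finset.sum_mul_sum]
  simp only [rankOne, Matrix.of_apply, thetaEntry_mul_star, Finset.sum_add_distrib]
  rw [Finset.sum_comm (f := fun l k => (zPart (p k) • om (toLex (k, 0)) +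
    star (wPart (p k)) • om (toLex (k, 1))) * (-wPart (p l) • om (toLex (l, 0)) +
    star (zPart (p l)) • om (toLex (l, 1)))), ← two_smul ℂ, smul_smul]
  rw [show (1 / 2 : ℂ) * 2 = 1 by norm_num, one_smul]
  rfl

theorem theta_one : theta (1 : Matrix (Fin n) (Fin n) (Quaternion ℝ)) = beta n := by
  have h0 : ∀ l k : Fin n, thetaEntry (0 : Quaternion ℝ) l k = 0 := fun l k => by
    have := thetaEntry_smul 0 0 l k
    simpa using this
  have h1 : ∀ l : Fin n, thetaEntry (1 : Quaternion ℝ) l l =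
      (2 : ℂ) • (om (toLex (l, 0)) * om (toLex (l, 1))) := fun l => by
    have hz : zPart (1 : Quaternion ℝ) = 1 := Complex.ext rfl rfl
    have hw : wPart (1 : Quaternion ℝ) = 0 := Complex.ext rfl rfl
    rw [thetaEntry, hz, hw, star_one, star_zero, om_mul_swap (toLex (l, 1)) (toLex (l, 0))]
    module
  rw [theta, beta, Finset.smul_sum]
  refine Finset.sum_congr rfl fun l _ => ?_
  rw [Finset.sum_eq_single l]
  · rw [Matrix.one_apply_eq, h1, smul_smul]; norm_num
  · intro k _ hk
    rw [Matrix.one_apply_ne hk.symm, h0]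
  · simp

theorem eq_sum_rankOne {U : Matrix (Fin n) (Fin n) (Quaternion ℝ)} (ev : Fin n → ℝ) :
    U * Matrix.diagonal (fun i => (ev i : Quaternion ℝ)) * star U =
      ∑ i, ev i • rankOne fun l => U l i := by
  ext1 l k
  rw [Matrix.mul_apply, Matrix.sum_apply]
  refine Finset.sum_congr rfl fun i _ => ?_
  rw [Matrix.mul_diagonal, Matrix.smul_apply, rankOne, Matrix.of_apply, Matrix.star_apply,
    ← Quaternion.coe_commutes, mul_assoc, Quaternion.coe_mul_eq_smul]

/-- The spectral decomposition over the columns of U, together with the resolution of the identity U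
U* = 1 by the same rank one matrices. -/
theorem HasEigenvalues.eq_sum {A : Matrix (Fin n) (Fin n) (Quaternion ℝ)} {ev : Fin n → ℝ}
    (h : HasEigenvalues A ev) : ∃ U : Matrix (Fin n) (Fin n) (Quaternion ℝ),
      (1 : Matrix (Fin n) (Fin n) (Quaternion ℝ)) = ∑ i, rankOne (fun l => U l i) ∧
        A = ∑ i, ev i • rankOne fun l => U l i := by
  obtain ⟨U, hU, h⟩ := h
  have hUU := Unitary.mul_star_self_of_mem hU
  refine ⟨U, ?_, ?_⟩
  · have := eq_sum_rankOne (U := U) fun _ => 1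
    simp only [Quaternion.coe_one, Matrix.diagonal_one, mul_one, one_smul, hUU] at this
    exact this
  · rw [← eq_sum_rankOne, ← h]
    calc A = U * star U * A * (U * star U) := by rw [hUU, one_mul, mul_one]
      _ = _ := by simp only [mul_assoc]

theorem rankOne_isHermitian (p : Fin n → Quaternion ℝ) : (rankOne p).IsHermitian := by
  ext1 l k
  simp [rankOne, Matrix.conjTranspose_apply]

theorem HasEigenvalues.isHermitian {A : Matrix (Fin n) (Fin n) (Quaternion ℝ)} {ev : Fin n → ℝ}
    (h : HasEigenvalues A ev) : A.IsHermitian := by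
  obtain ⟨U, _, h⟩ := h.eq_sum
  rw [h, Matrix.IsHermitian, Matrix.conjTranspose_sum]
  refine Finset.sum_congr rfl fun i _ => ?_
  ext1 l k
  simp [rankOne, Matrix.conjTranspose_apply, Quaternion.star_smul]

/-- A unitary diagonalization of `A` diagonalizes its two-form. -/
theorem HasEigenvalues.exists_algHom {A : Matrix (Fin n) (Fin n) (Quaternion ℝ)} {ev : Fin n → ℝ}
    (h : HasEigenvalues A ev) : ∃ T : Ext n →ₐ[ℂ] Ext n, T (beta n) = beta n ∧
      theta A = T (∑ i, (ev i : ℂ) • (pairForm i : Ext n)) := by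
  obtain ⟨U, h1, hA⟩ := h.eq_sum
  -- ω^l and ω^{n+l} go to the two complex vectors attached to the l-th column of U, so each pair
  -- form goes to the two-form of the corresponding rank one projection. The resolution of the
  -- identity then fixes β_n.
  let f : (Idx n → ℂ) →ₗ[ℂ] (Idx n → ℂ) := (Pi.basisFun ℂ (Idx n)).constr ℂ fun A =>
    match (ofLex A).2 with
    | 0 => vecC fun l => U l (ofLex A).1
    | 1 => vecD fun l => U l (ofLex A).1
  have hf : ∀ A : Idx n, ExteriorAlgebra.map f (om A) = ExteriorAlgebra.ι ℂ (match (ofLex A).2 with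
    | 0 => vecC fun l => U l (ofLex A).1
    | 1 => vecD fun l => U l (ofLex A).1) := by
    intro A
    rw [om, ExteriorAlgebra.map_apply_ι, ← Pi.basisFun_apply, Module.Basis.constr_basis]
  have hp : ∀ i, ExteriorAlgebra.map f (pairForm i : Ext n) = theta (rankOne fun l => U l i) := by
    intro i
    rw [theta_rankOne, pairForm, map_mul, hf, hf]
    rfl
  refine ⟨ExteriorAlgebra.map f, ?_, ?_⟩
  · conv_rhs => rw [← theta_one, h1, theta_sum]
    rw [beta, map_sum]
    exact Finset.sum_congr rfl fun i _ => hp i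
  · rw [hA, theta_sum, map_sum]
    exact Finset.sum_congr rfl fun i _ => by rw [theta_smul, map_smul, hp]

/-- The Hessian form of a shifted matrix is an elementary symmetric function of the shifted
eigenvalues. -/
theorem HasEigenvalues.topCoeff_pow {A : Matrix (Fin n) (Fin n) (Quaternion ℝ)} {ev : Fin n → ℝ}
    (h : HasEigenvalues A ev) {m : ℕ} (hmn : m ≤ n) (z : ℂ) :
    topCoeff n ((theta A + z • beta n) ^ m * beta n ^ (n - m)) =
      (m ! : ℂ) * ((n - m) ! : ℂ) *
        ∑ t ∈ Finset.powersetCard m (Finset.univ : Finset (Fin n)), ∏ i ∈ t, ((ev i : ℂ) + z) := by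
  obtain ⟨T, hβ, hA⟩ := h.exists_algHom
  let L : Subalgebra.center ℂ (Ext n) →ₗ[ℂ] ℂ :=
    (topCoeff n ∘ₗ T.toLinearMap) ∘ₗ (Subalgebra.center ℂ (Ext n)).val.toLinearMap
  have hLapply : ∀ w : Subalgebra.center ℂ (Ext n), L w = topCoeff n (T (w : Ext n)) :=
    fun w => rfl
  -- T fixes β_n, hence also β_n^n = n! Ω_{2n}; no determinant of the complexified unitary matrix
  -- has to be computed.
  have hvol : L (∏ i, pairForm i) = 1 := by
    have h1 := (sum_pow_card_of_sq_zero (pairForm (n := n)) pairForm_sq Finset.univ).1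
    rw [Finset.card_univ, Fintype.card_fin, ← nsmul_eq_mul] at h1
    have h2 : (n ! : ℕ) • volForm n = beta n ^ n := by
      rw [← coe_prod_pairForm, ← coe_betaC, betaC, ← SubmonoidClass.coe_pow, h1]
      rfl
    have h3 : (n ! : ℕ) • T (volForm n) = (n ! : ℕ) • volForm n := by
      rw [← map_nsmul, h2, map_pow, hβ]
    have h4 : T (volForm n) = volForm n := by
      rw [← Nat.cast_smul_eq_nsmul ℂ, ← Nat.cast_smul_eq_nsmul ℂ] at h3
      exact smul_right_injective _ (Nat.cast_ne_zero.mpr (Nat.factorial_ne_zero n)) h3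
    rw [hLapply, coe_prod_pairForm, h4, topCoeff_volForm]
  have key := map_sum_pow_mul_sum_pow hmn (pairForm (n := n)) pairForm_sq L
    fun i => (ev i : ℂ) + z
  rw [hvol, mul_one, hLapply] at key
  rw [← key]
  congr 1
  have hb : ((∑ i : Fin n, pairForm i : Subalgebra.center ℂ (Ext n)) : Ext n) = beta n := coe_betaC
  rw [MulMemClass.coe_mul, SubmonoidClass.coe_pow, SubmonoidClass.coe_pow, map_mul, map_pow,
    map_pow, hb, hβ, hA]
  congr 2
  simp only [add_smul, Finset.sum_add_distrib, ← Finset.smul_sum, AddMemClass.coe_add, map_add]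
  congr 1
  · rw [AddSubmonoidClass.coe_finsetSum, map_sum, map_sum]
    rfl
  · rw [SetLike.val_smul, map_smul, hb, hβ]

end Theta

/-! ### The spectral theorem for hyperhermitian matrices -/

section Spectral

variable {n : ℕ}

/-- The real Euclidean space underlying `ℍⁿ`, with quaternionic coordinates. -/
abbrev QVec (n : ℕ) : Type := PiLp 2 fun _ : Fin n => Quaternion ℝ

theorem re_mul_mul_rotate (a b c : Quaternion ℝ) : (a * b * c).re = (b * c * a).re := by
  simp only [Quaternion.re_mul, Quaternion.imI_mul, Quaternion.imJ_mul, Quaternion.imK_mul]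
  ring

/-- The real inner product is the real part of the quaternionic pairing, and the real part of a
product is cyclic. Real eigenvalues can then be found by real spectral theory. -/
theorem isSymmetric_of_isHermitian {A : Matrix (Fin n) (Fin n) (Quaternion ℝ)}
    (hA : A.IsHermitian)
    (T : QVec n →ₗ[ℝ] QVec n)
    (hT : ∀ x l, T x l = ∑ k, A l k * x k) : T.IsSymmetric := by
  intro x y
  simp only [PiLp.inner_apply, hT, Quaternion.inner_def, Finset.sum_mul, star_sum, Finset.mul_sum]
  have hre : ∀ (s : Finset (Fin n)) (f : Fin n → Quaternion ℝ),
      (∑ i ∈ s, f i).re = ∑ i ∈ s, (f i).re := fun s f =>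
    map_sum (QuaternionAlgebra.reₗ (R := ℝ) (-1 : ℝ) 0 (-1)) f s
  simp only [hre]
  rw [Finset.sum_comm]
  refine Finset.sum_congr rfl fun k _ => Finset.sum_congr rfl fun l _ => ?_
  rw [re_mul_mul_rotate, star_mul, ← mul_assoc, ← hA.apply l k]

/-- Eigenvectors are produced one at a time in the quaternionic orthogonal complement of those
already found, which A preserves. Orthogonality has to be quaternionic, not only real, for the
eigenvectors to form a unitary matrix. -/
theorem exists_orthonormal_eigenvectors {A : Matrix (Fin n) (Fin n) (Quaternion ℝ)}
    (hA : A.IsHermitian) (r : ℕ) (hr : r ≤ n) :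
    ∃ (v : Fin r → Fin n → Quaternion ℝ) (ev : Fin r → ℝ),
      (∀ i j, ∑ l, star (v i l) * v j l = if i = j then 1 else 0) ∧
      ∀ i l, ∑ k, A l k * v i k = ev i • v i l := by
  induction r with
  | zero => exact ⟨Fin.elim0, Fin.elim0, fun i => i.elim0, fun i => i.elim0⟩
  | succ r ih =>
    obtain ⟨v, ev, horth, heig⟩ := ih (by omega)
    let T : QVec n →ₗ[ℝ] QVec n :=
      { toFun := fun x => WithLp.toLp 2 fun l => ∑ k, A l k * x k
        map_add' := fun x y => by
          ext1 l
          simp [mul_add, Finset.sum_add_distrib]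
        map_smul' := fun t x => by
          ext1 l
          simp [Finset.smul_sum] }
    have hT : ∀ (x : QVec n) l, T x l = ∑ k, A l k * x k := fun x l => rfl
    let P : QVec n →ₗ[ℝ] (Fin r → Quaternion ℝ) :=
      { toFun := fun x i => ∑ l, star (v i l) * x l
        map_add' := fun x y => by
          funext i
          simp [mul_add, Finset.sum_add_distrib]
        map_smul' := fun t x => by
          funext i
          simp [Finset.smul_sum] }
    have hP : ∀ (x : QVec n) i, P x i = ∑ l, star (v i l) * x l := fun x i => rfl
    have hsymm := isSymmetric_of_isHermitian hA T hT
    have hinv : ∀ x ∈ LinearMap.ker P, T x ∈ LinearMap.ker P := by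
      intro x hx
      rw [LinearMap.mem_ker] at hx ⊢
      funext i
      have hxi : ∑ l, star (v i l) * x l = 0 := by rw [← hP, hx]; rfl
      rw [hP]
      simp only [hT, Finset.mul_sum]
      rw [Finset.sum_comm]
      have : ∀ k, ∑ l, star (v i l) * (A l k * x k) = ev i • (star (v i k) * x k) := by
        intro k
        have h1 := congrArg star (heig i k)
        rw [star_sum, Quaternion.star_smul] at h1
        rw [← smul_mul_assoc, ← h1, Finset.sum_mul]
        refine Finset.sum_congr rfl fun l _ => ?_
        rw [star_mul, hA.apply, mul_assoc]
      simp only [this]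
      rw [← Finset.smul_sum, hxi, smul_zero]
      rfl
    -- The complement is cut out by a real linear map from real dimension 4n to real dimension 4r <
    -- 4n.
    have hker : LinearMap.ker P ≠ ⊥ := by
      apply LinearMap.ker_ne_bot_of_finrank_lt
      have h1 : Module.finrank ℝ (QVec n) = n * 4 := by
        rw [(WithLp.linearEquiv 2 ℝ (Fin n → Quaternion ℝ)).finrank_eq, Module.finrank_pi_fintype]
        simp [Quaternion.finrank_eq_four]
      have h2 : Module.finrank ℝ (Fin r → Quaternion ℝ) = r * 4 := by
        rw [Module.finrank_pi_fintype]
        simp [Quaternion.finrank_eq_four]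
      rw [h1, h2]
      omega
    have : Nontrivial (LinearMap.ker P) := Submodule.nontrivial_iff_ne_bot.mpr hker
    have hev := (hsymm.restrict_invariant hinv).hasEigenvalue_iSup_of_finiteDimensional
    obtain ⟨⟨x, hx⟩, hxe⟩ := hev.exists_hasEigenvector
    set μ : ℝ := _ with hμ
    have hx0 : x ≠ 0 := fun h => hxe.2 (Subtype.ext h)
    have hTx : T x = μ • x := congrArg Subtype.val hxe.apply_eq_smul
    have hnx : ‖x‖ ≠ 0 := norm_ne_zero_iff.mpr hx0
    have hxP : ∀ i, ∑ l, star (v i l) * x l = 0 := fun i => by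
      rw [← hP, LinearMap.mem_ker.mp hx]; rfl
    have hxP' : ∀ i, ∑ l, star (x l) * v i l = 0 := fun i => by
      have := congrArg star (hxP i)
      simpa [star_sum] using this
    have hxx : ∑ l, star (x l) * x l = ((‖x‖ ^ 2 : ℝ) : Quaternion ℝ) := by
      rw [PiLp.norm_sq_eq_of_L2, ← Quaternion.algebraMap_def, map_sum]
      refine Finset.sum_congr rfl fun l _ => ?_
      rw [Quaternion.star_mul_self, Quaternion.normSq_eq_norm_mul_self, ← sq]
      rfl
    refine ⟨Fin.snoc v fun l => ‖x‖⁻¹ • x l, Fin.snoc ev μ, ?_, ?_⟩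
    · intro i j
      refine Fin.lastCases ?_ (fun i => ?_) i <;> refine Fin.lastCases ?_ (fun j => ?_) j
      · simp only [Fin.snoc_last, Quaternion.star_smul, smul_mul_smul_comm, ← Finset.smul_sum, hxx,
          if_true]
        rw [← Quaternion.coe_smul, smul_eq_mul]
        rw [show ‖x‖⁻¹ * ‖x‖⁻¹ * ‖x‖ ^ 2 = 1 by field_simp, Quaternion.coe_one]
      · simp only [Fin.snoc_last, Fin.snoc_castSucc, Quaternion.star_smul, smul_mul_assoc,
          ← Finset.smul_sum, hxP', smul_zero]
        rw [if_neg (Fin.castSucc_lt_last j).ne']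
      · simp only [Fin.snoc_last, Fin.snoc_castSucc, mul_smul_comm,
          ← Finset.smul_sum, hxP, smul_zero]
        rw [if_neg (Fin.castSucc_lt_last i).ne]
      · simp only [Fin.snoc_castSucc, horth, Fin.castSucc_inj]
    · intro i l
      refine Fin.lastCases ?_ (fun i => ?_) i
      · simp only [Fin.snoc_last, mul_smul_comm, ← Finset.smul_sum]
        rw [← hT, hTx, PiLp.smul_apply, smul_comm]
      · simp only [Fin.snoc_castSucc, heig]

theorem exists_hasEigenvalues {A : Matrix (Fin n) (Fin n) (Quaternion ℝ)} (hA : A.IsHermitian) :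
    ∃ ev, HasEigenvalues A ev := by
  obtain ⟨v, ev, horth, heig⟩ := exists_orthonormal_eigenvectors hA n le_rfl
  let U : Matrix (Fin n) (Fin n) (Quaternion ℝ) := Matrix.of fun l i => v i l
  have h1 : star U * U = 1 := by
    ext1 i j
    rw [Matrix.mul_apply, Matrix.one_apply, ← horth i j]
    rfl
  have h2 : A * U = U * Matrix.diagonal fun i => (ev i : Quaternion ℝ) := by
    ext1 l i
    rw [Matrix.mul_diagonal, Matrix.mul_apply]
    refine (heig i l).trans ?_
    rw [← Quaternion.mul_coe_eq_smul]
    rfl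
  -- A left inverse of a square quaternionic matrix is also a right inverse, although the entries do
  -- not commute.
  refine ⟨ev, U, Unitary.mem_iff.mpr ⟨h1, mul_eq_one_comm.mp h1⟩, ?_⟩
  rw [mul_assoc, h2, ← mul_assoc, h1, one_mul]

end Spectral

/-! ### Positivity of mixed Hessian forms -/

section Mixed

open scoped ComplexOrder

variable {n m : ℕ}

/-- The two-forms of hyperhermitian matrices. -/
def hermForms (n : ℕ) : AddSubgroup (Subalgebra.center ℂ (Ext n)) where
  carrier := {w | ∃ A : Matrix (Fin n) (Fin n) (Quaternion ℝ), A.IsHermitian ∧ w = thetaC A}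
  zero_mem' := ⟨0, Matrix.isHermitian_zero, Subtype.ext theta_zero.symm⟩
  add_mem' := by
    rintro _ _ ⟨A, hA, rfl⟩ ⟨B, hB, rfl⟩
    exact ⟨A + B, hA.add hB, Subtype.ext (theta_add A B).symm⟩
  neg_mem' := by
    rintro _ ⟨A, hA, rfl⟩
    refine ⟨-A, hA.neg, Subtype.ext ?_⟩
    have := theta_smul (-1) A
    simp only [neg_smul, one_smul, Complex.ofReal_neg, Complex.ofReal_one] at this
    exact this.symm

theorem ofReal_smul_mem_hermForms (t : ℝ) (w : Subalgebra.center ℂ (Ext n))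
    (hw : w ∈ hermForms n) : (t : ℂ) • w ∈ hermForms n := by
  obtain ⟨A, hA, rfl⟩ := hw
  refine ⟨t • A, ?_, Subtype.ext (theta_smul t A).symm⟩
  ext1 l k
  rw [Matrix.conjTranspose_apply, Matrix.smul_apply, Matrix.smul_apply, Quaternion.star_smul,
    hA.apply]

theorem thetaC_one : thetaC (1 : Matrix (Fin n) (Fin n) (Quaternion ℝ)) = betaC n :=
  Subtype.ext (theta_one.trans coe_betaC.symm)

theorem betaC_mem_hermForms : betaC n ∈ hermForms n :=
  ⟨1, Matrix.isHermitian_one, thetaC_one.symm⟩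

/-- The functional `w ↦ ∫ w ∧ β_n^{n-m}` on the centre. -/
def hessFunctional (n m : ℕ) : Subalgebra.center ℂ (Ext n) →ₗ[ℂ] ℂ :=
  (topCoeff n ∘ₗ (Subalgebra.center ℂ (Ext n)).val.toLinearMap) ∘ₗ
    LinearMap.mulRight ℂ (betaC n ^ (n - m))

theorem hessFunctional_apply (w : Subalgebra.center ℂ (Ext n)) :
    hessFunctional n m w = topCoeff n ((w : Ext n) * beta n ^ (n - m)) := by
  rw [← coe_betaC]
  rfl

theorem factorial_smul_volForm : (n ! : ℕ) • volForm n = beta n ^ n := by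
  have h := (sum_pow_card_of_sq_zero (pairForm (n := n)) pairForm_sq Finset.univ).1
  rw [Finset.card_univ, Fintype.card_fin, ← nsmul_eq_mul] at h
  rw [← coe_prod_pairForm, ← coe_betaC, betaC, ← SubmonoidClass.coe_pow, h]
  rfl

theorem hessFunctional_beta_pow (hmn : m ≤ n) :
    hessFunctional n m (betaC n ^ m) = (n ! : ℂ) := by
  rw [hessFunctional_apply, SubmonoidClass.coe_pow, coe_betaC, ← pow_add, Nat.add_sub_cancel' hmn,
    ← factorial_smul_volForm, map_nsmul, topCoeff_volForm, nsmul_eq_mul, mul_one]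

/-- For m = n the value is n! ∏ (λ_i + z) with real λ_i, nonzero for nonreal z. For smaller m the
factor β_n^{n-m} amounts to n - m derivatives in the direction β_n, and these preserve
hyperbolicity. -/
theorem hessFunctional_hyperbolic (hmn : m ≤ n) : ∀ x ∈ hermForms n, ∀ z : ℂ, z.im ≠ 0 →
    hessFunctional n m ((x + z • betaC n) ^ m) ≠ 0 := by
  have hn : ∀ x ∈ hermForms n, ∀ z : ℂ, z.im ≠ 0 →
      hessFunctional n n ((x + z • betaC n) ^ n) ≠ 0 := by
    rintro _ ⟨A, hA, rfl⟩ z hz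
    obtain ⟨ev, hev⟩ := exists_hasEigenvalues hA
    have := hev.topCoeff_pow le_rfl z
    rw [hessFunctional_apply, SubmonoidClass.coe_pow, AddMemClass.coe_add, SetLike.val_smul,
      coe_betaC, thetaC, this]
    refine mul_ne_zero (mul_ne_zero ?_ ?_) ?_
    · exact Nat.cast_ne_zero.mpr (Nat.factorial_ne_zero _)
    · exact Nat.cast_ne_zero.mpr (Nat.factorial_ne_zero _)
    · have hp := Finset.powersetCard_self (Finset.univ : Finset (Fin n))
      rw [Finset.card_univ, Fintype.card_fin] at hp
      rw [hp, Finset.sum_singleton, Finset.prod_ne_zero_iff]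
      intro i _ h
      have := congrArg Complex.im h
      simp at this
      exact hz this
  intro x hx z hz
  have h := hyperbolic_mul_pow (hessFunctional n n) (hermForms n) (betaC n) n hn
    (by rw [hessFunctional_beta_pow le_rfl]; exact Nat.cast_ne_zero.mpr (Nat.factorial_ne_zero _))
    (n - m) m (by omega) x hx z hz
  rw [mul_comm, hessFunctional_apply] at h
  rw [hessFunctional_apply]
  simpa [coe_betaC] using h

theorem hessFunctional_ne_zero_of_mem_gardingCone (hmn : m ≤ n)
    {A : Matrix (Fin n) (Fin n) (Quaternion ℝ)} (hA : A ∈ gardingCone n m) (t : ℝ) (ht : 0 ≤ t) :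
    hessFunctional n m ((thetaC A + (t : ℂ) • betaC n) ^ m) ≠ 0 := by
  obtain ⟨ev, hev, hpos⟩ := hA
  have := hev.topCoeff_pow hmn t
  rw [hessFunctional_apply, SubmonoidClass.coe_pow, AddMemClass.coe_add, SetLike.val_smul,
    coe_betaC, thetaC, this]
  refine mul_ne_zero (mul_ne_zero ?_ ?_) ?_
  · exact Nat.cast_ne_zero.mpr (Nat.factorial_ne_zero _)
  · exact Nat.cast_ne_zero.mpr (Nat.factorial_ne_zero _)
  · have h := (hpos t ht).ne'
    rw [elemSymm] at h
    have h' := Complex.ofReal_ne_zero.mpr h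
    push_cast at h'
    simpa only [add_comm] using h'

/-- The conjugate entries are listed separately because a complex subalgebra need not be closed
under conjugation. -/
theorem coordIn_theta {X : Type*} (S : Subalgebra ℂ (X → ℂ))
    {A : X → Matrix (Fin n) (Fin n) (Quaternion ℝ)}
    (h : ∀ l k, (fun x => zPart (A x l k)) ∈ S ∧ (fun x => wPart (A x l k)) ∈ S ∧
      (fun x => star (zPart (A x l k))) ∈ S ∧ (fun x => star (wPart (A x l k))) ∈ S) :
    CoordIn S fun x => theta (A x) := by
  have hc : (fun _ : X => (1 / 2 : ℂ)) ∈ S := S.algebraMap_mem _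
  refine CoordIn.smul hc (CoordIn.sum _ fun l _ => CoordIn.sum _ fun k _ => ?_)
  obtain ⟨h1, h2, h3, h4⟩ := h l k
  simp only [thetaEntry, sub_eq_add_neg]
  refine CoordIn.add (CoordIn.add (CoordIn.add ?_ ?_) ?_) ?_
  · exact CoordIn.smul h2 (CoordIn.const _)
  · exact CoordIn.smul h1 (CoordIn.const _)
  · simp only [← smul_neg]
    exact CoordIn.smul h3 (CoordIn.const _)
  · exact CoordIn.smul h4 (CoordIn.const _)

theorem continuous_zPart : Continuous zPart := by
  have h : zPart = fun a => (a.re : ℂ) + a.imI * Complex.I := by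
    funext a; apply Complex.ext <;> simp [zPart]
  rw [h]
  exact (Complex.continuous_ofReal.comp Quaternion.continuous_re).add
    ((Complex.continuous_ofReal.comp Quaternion.continuous_imI).mul continuous_const)

theorem continuous_wPart : Continuous wPart := by
  have h : wPart = fun a => (a.imJ : ℂ) + a.imK * Complex.I := by
    funext a; apply Complex.ext <;> simp [wPart]
  rw [h]
  exact (Complex.continuous_ofReal.comp Quaternion.continuous_imJ).add
    ((Complex.continuous_ofReal.comp Quaternion.continuous_imK).mul continuous_const)

/-- Gårding's inequality gives strict positivity for matrices in Γ_m after a shift by δ > 0. Passing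
to the closure of Γ_m and letting δ → 0 is done in one step, by continuity jointly in the matrices
and δ. -/
theorem mixed_hessian_nonneg (hm : 1 ≤ m) (hmn : m ≤ n)
    (A : Fin (m - 1) → Matrix (Fin n) (Fin n) (Quaternion ℝ))
    (hA : ∀ j, A j ∈ closure (gardingCone n m)) {y : Subalgebra.center ℂ (Ext n)}
    (hyR : y ∈ hermForms n)
    (hy : ∀ t : ℝ, 0 ≤ t → hessFunctional n m ((y + (t : ℂ) • betaC n) ^ m) ≠ 0) :
    0 ≤ topCoeff n ((List.ofFn fun j => theta (A j)).prod * beta n ^ (n - m) * (y : Ext n)) := by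
  let X := (Fin (m - 1) → Matrix (Fin n) (Fin n) (Quaternion ℝ)) × ℝ
  let f : X → ℂ := fun p => topCoeff n ((List.ofFn fun j => (theta (p.1 j) + (p.2 : ℂ) • beta n)).prod *
    beta n ^ (n - m) * ((y : Ext n) + (p.2 : ℂ) • beta n))
  have hf : Continuous f := by
    have hS : ∀ g : X → ℂ, g ∈ (continuousSubalgebra : Subalgebra ℂ (X → ℂ)) ↔ Continuous g :=
      fun g => Iff.rfl
    rw [← hS]
    have hδ : (fun p : X => (p.2 : ℂ)) ∈ (continuousSubalgebra : Subalgebra ℂ (X → ℂ)) :=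
      Complex.continuous_ofReal.comp continuous_snd
    have hent : ∀ j l k, Continuous fun p : X => p.1 j l k := fun j l k =>
      (continuous_apply_apply l k).comp ((continuous_apply j).comp continuous_fst)
    refine CoordIn.linear (((CoordIn.list_prod fun j => ?_).mul (CoordIn.const _)).mul
      ((CoordIn.const _).add (CoordIn.smul hδ (CoordIn.const _)))) _
    refine CoordIn.add (coordIn_theta _ fun l k => ⟨?_, ?_, ?_, ?_⟩)
      (CoordIn.smul hδ (CoordIn.const _))
    · exact continuous_zPart.comp (hent j l k)
    · exact continuous_wPart.comp (hent j l k)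
    · exact continuous_star.comp (continuous_zPart.comp (hent j l k))
    · exact continuous_star.comp (continuous_wPart.comp (hent j l k))
  have hpos : (Set.univ.pi fun _ => gardingCone n m) ×ˢ Set.Ioi (0 : ℝ) ⊆ f ⁻¹' {z | 0 ≤ z} := by
    rintro ⟨B, δ⟩ ⟨hB, hδ⟩
    have hB' : ∀ j, B j ∈ gardingCone n m := fun j => hB j (Set.mem_univ j)
    have hg := garding (hessFunctional n m) (hermForms n) (betaC n) m ofReal_smul_mem_hermForms
      betaC_mem_hermForms (by
        rw [hessFunctional_beta_pow hmn]
        exact_mod_cast Nat.factorial_pos n) (hessFunctional_hyperbolic hmn)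
      (ι := Fin (m - 1 + 1)) (by simp; omega)
      (Fin.snoc (α := fun _ => Subalgebra.center ℂ (Ext n)) (fun j => thetaC (B j)) y) ?_ ?_ hδ
    · rw [Fin.prod_univ_castSucc, hessFunctional_apply] at hg
      simp only [Fin.snoc_castSucc, Fin.snoc_last] at hg
      have hlist : ∀ L : List (Subalgebra.center ℂ (Ext n)),
          ((L.prod : Subalgebra.center ℂ (Ext n)) : Ext n) = (L.map Subtype.val).prod := fun L =>
        map_list_prod (Subalgebra.center ℂ (Ext n)).val L
      rw [MulMemClass.coe_mul, ← List.prod_ofFn, hlist, List.map_ofFn] at hg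
      change 0 ≤ f (B, δ)
      refine le_of_lt ?_
      convert hg using 2
      -- The last factor of the Gårding product is moved past β_n^{n-m} by centrality, to match the
      -- order in the statement.
      have hc := Subalgebra.mem_center_iff.mp (y + (δ : ℂ) • betaC n).2 (beta n ^ (n - m))
      rw [mul_assoc, mul_assoc, ← hc, ← coe_betaC]
      rfl
    · intro i
      refine Fin.lastCases ?_ (fun j => ?_) i
      · rw [Fin.snoc_last]
        exact hyR
      · rw [Fin.snoc_castSucc]
        obtain ⟨ev, hev, _⟩ := hB' j
        exact ⟨_, hev.isHermitian, rfl⟩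
    · intro i
      refine Fin.lastCases ?_ (fun j => ?_) i
      · simpa using hy
      · rw [Fin.snoc_castSucc]
        exact hessFunctional_ne_zero_of_mem_gardingCone hmn (hB' j)
  have hclosed : IsClosed (f ⁻¹' {z | 0 ≤ z}) :=
    (isClosed_le continuous_const continuous_id).preimage hf
  have hmem : ((A, 0) : X) ∈ closure ((Set.univ.pi fun _ => gardingCone n m) ×ˢ Set.Ioi (0 : ℝ)) := by
    rw [closure_prod_eq, closure_pi_set, closure_Ioi]
    exact ⟨fun j _ => hA j, Set.self_mem_Ici⟩
  have h := closure_minimal hpos hclosed hmem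
  change 0 ≤ f (A, 0) at h
  simpa [f] using h

end Mixed

/-! ### Calculus of forms -/

section Calculus

variable {n : ℕ}

/-- The coefficient of `∂_{4l+c}` in `∇_{A α}`, where `b` is the second component of `A`. -/
def nablaCoeff (b α : Fin 2) (c : Fin 4) : ℂ :=
  match b, α, c with
  | 0, 0, 0 => 1
  | 0, 0, 1 => Complex.I
  | 0, 1, 2 => -1
  | 0, 1, 3 => -Complex.I
  | 1, 0, 2 => 1
  | 1, 0, 3 => -Complex.I
  | 1, 1, 0 => 1
  | 1, 1, 1 => -Complex.I
  | _, _, _ => 0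

theorem nabla_eq_sum (A : Idx n) (α : Fin 2) (f : HSpace n → ℂ) (q : HSpace n) :
    nabla A α f q =
      ∑ c, nablaCoeff (ofLex A).2 α c * partialD ((ofLex A).1, c) f q := by
  obtain ⟨⟨l, b⟩, rfl⟩ := toLex.surjective A
  rw [Fin.sum_univ_four]
  fin_cases b <;> fin_cases α <;> simp [nabla, nablaCoeff] <;> ring

/-! ### Coordinate partial derivatives -/

section Partial

variable {E : Type*} [NormedAddCommGroup E] [NormedSpace ℝ E]

theorem partialD_congr {f g : HSpace n → E} {q : HSpace n} (h : f =ᶠ[𝓝 q] g)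
    (c : Fin n × Fin 4) : partialD c f q = partialD c g q := by
  rw [partialD, partialD, h.fderiv_eq]

theorem partialD_sum {ι : Type*} (s : Finset ι) {f : ι → HSpace n → E} {q : HSpace n}
    (h : ∀ i ∈ s, DifferentiableAt ℝ (f i) q) (c : Fin n × Fin 4) :
    partialD c (fun p => ∑ i ∈ s, f i p) q = ∑ i ∈ s, partialD c (f i) q := by
  simp only [partialD]
  rw [fderiv_fun_sum h, sum_apply]

theorem partialD_clm {E' : Type*} [NormedAddCommGroup E'] [NormedSpace ℝ E'] (L : E →L[ℝ] E')
    {f : HSpace n → E} {q : HSpace n} (h : DifferentiableAt ℝ f q) (c : Fin n × Fin 4) :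
    partialD c (fun p => L (f p)) q = L (partialD c f q) := by
  change fderiv ℝ (L ∘ f) q _ = _
  rw [(L.hasFDerivAt.comp q h.hasFDerivAt).fderiv]
  rfl

theorem partialD_mul {𝔸 : Type*} [NormedCommRing 𝔸] [NormedAlgebra ℝ 𝔸]
    {f g : HSpace n → 𝔸} {q : HSpace n} (hf : DifferentiableAt ℝ f q)
    (hg : DifferentiableAt ℝ g q) (c : Fin n × Fin 4) :
    partialD c (fun p => f p * g p) q = partialD c f q * g q + f q * partialD c g q := by
  simp only [partialD]
  rw [fderiv_fun_mul hf hg]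
  simp
  ring

theorem ContDiff.partialD {k l : WithTop ℕ∞} {f : HSpace n → E} (hf : ContDiff ℝ l f)
    (h : k + 1 ≤ l) (c : Fin n × Fin 4) : ContDiff ℝ k (QHessian.partialD c f) :=
  (hf.fderiv_right h).clm_apply contDiff_const

theorem partialD_comm {f : HSpace n → E} (hf : ContDiff ℝ 2 f) (c d : Fin n × Fin 4)
    (q : HSpace n) : partialD c (partialD d f) q = partialD d (partialD c f) q := by
  have hd : DifferentiableAt ℝ (fderiv ℝ f) q :=
    ((hf.fderiv_right (m := 1) (by norm_num)).differentiable one_ne_zero) q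
  have key : ∀ v w : HSpace n, fderiv ℝ (fun p => fderiv ℝ f p v) q w =
      fderiv ℝ (fderiv ℝ f) q w v := by
    intro v w
    rw [fderiv_clm_apply hd (differentiableAt_const _)]
    simp
  have hsymm : IsSymmSndFDerivAt ℝ f q :=
    hf.contDiffAt.isSymmSndFDerivAt (by simp)
  change fderiv ℝ (fun p => fderiv ℝ f p _) q _ = fderiv ℝ (fun p => fderiv ℝ f p _) q _
  rw [key, key, hsymm.eq]

end Partial

theorem nabla_congr {f g : HSpace n → ℂ} {q : HSpace n} (h : f =ᶠ[𝓝 q] g) (A : Idx n)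
    (α : Fin 2) : nabla A α f q = nabla A α g q := by
  simp only [nabla_eq_sum, partialD_congr h]

theorem nabla_const (A : Idx n) (α : Fin 2) (w : ℂ) (q : HSpace n) :
    nabla A α (fun _ => w) q = 0 := by
  simp [nabla_eq_sum, partialD]

theorem nabla_sum {ι : Type*} (s : Finset ι) {f : ι → HSpace n → ℂ} {q : HSpace n}
    (h : ∀ i ∈ s, DifferentiableAt ℝ (f i) q) (A : Idx n) (α : Fin 2) :
    nabla A α (fun p => ∑ i ∈ s, f i p) q = ∑ i ∈ s, nabla A α (f i) q := by
  simp only [nabla_eq_sum, partialD_sum s h, Finset.mul_sum]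
  exact Finset.sum_comm

theorem nabla_mul {f g : HSpace n → ℂ} {q : HSpace n} (hf : DifferentiableAt ℝ f q)
    (hg : DifferentiableAt ℝ g q) (A : Idx n) (α : Fin 2) :
    nabla A α (fun p => f p * g p) q = nabla A α f q * g q + f q * nabla A α g q := by
  simp only [nabla_eq_sum, partialD_mul hf hg, mul_add, Finset.sum_add_distrib, Finset.sum_mul,
    Finset.mul_sum]
  congr 1
  · exact Finset.sum_congr rfl fun c _ => by ring
  · exact Finset.sum_congr rfl fun c _ => by ring

theorem nabla_mul_const {f : HSpace n → ℂ} {q : HSpace n} (hf : DifferentiableAt ℝ f q) (w : ℂ)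
    (A : Idx n) (α : Fin 2) : nabla A α (fun p => f p * w) q = nabla A α f q * w := by
  rw [nabla_mul hf (differentiableAt_const _), nabla_const, mul_zero, add_zero]

theorem ContDiff.nabla {k l : WithTop ℕ∞} {f : HSpace n → ℂ} (hf : ContDiff ℝ l f)
    (h : k + 1 ≤ l) (A : Idx n) (α : Fin 2) : ContDiff ℝ k (QHessian.nabla A α f) := by
  have : QHessian.nabla A α f = fun q => ∑ c, nablaCoeff (ofLex A).2 α c *
      QHessian.partialD ((ofLex A).1, c) f q := funext fun q => nabla_eq_sum A α f q
  rw [this]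
  exact ContDiff.sum fun c _ => contDiff_const.mul (ContDiff.partialD hf h _)

theorem nabla_nabla {f : HSpace n → ℂ} (hf : ContDiff ℝ 2 f) (A B : Idx n) (α β : Fin 2)
    (q : HSpace n) : nabla B β (nabla A α f) q =
      ∑ d, ∑ c, nablaCoeff (ofLex B).2 β d * nablaCoeff (ofLex A).2 α c *
        partialD ((ofLex B).1, d) (partialD ((ofLex A).1, c) f) q := by
  have hA : nabla A α f = fun p => ∑ c, partialD ((ofLex A).1, c) f p *
      nablaCoeff (ofLex A).2 α c :=
    funext fun q => (nabla_eq_sum A α f q).trans (Finset.sum_congr rfl fun c _ => mul_comm _ _)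
  have hd : ∀ c, DifferentiableAt ℝ (partialD ((ofLex A).1, c) f) q := fun c =>
    (ContDiff.partialD (k := 1) hf (by norm_num) _).differentiable one_ne_zero q
  rw [hA, nabla_sum _ (fun c _ => (hd c).mul_const _), Finset.sum_comm]
  refine Finset.sum_congr rfl fun c _ => ?_
  rw [nabla_mul_const (hd c), nabla_eq_sum, Finset.sum_mul]
  exact Finset.sum_congr rfl fun d _ => by ring

theorem nabla_comm {f : HSpace n → ℂ} (hf : ContDiff ℝ 2 f) (A B : Idx n) (α β : Fin 2)
    (q : HSpace n) : nabla B β (nabla A α f) q = nabla A α (nabla B β f) q := by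
  rw [nabla_nabla hf, nabla_nabla hf, Finset.sum_comm]
  refine Finset.sum_congr rfl fun c _ => Finset.sum_congr rfl fun d _ => ?_
  rw [partialD_comm hf]
  ring

/-- The complex functions of class `C^k`. -/
def contDiffFun (n : ℕ) (k : WithTop ℕ∞) : Subalgebra ℂ (HSpace n → ℂ) where
  carrier := {f | ContDiff ℝ k f}
  mul_mem' hf hg := ContDiff.mul hf hg
  add_mem' hf hg := ContDiff.add hf hg
  algebraMap_mem' _ := contDiff_const

theorem contDiffFun_mono {k l : WithTop ℕ∞} (h : k ≤ l) : contDiffFun n l ≤ contDiffFun n k :=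
  fun _ hf => ContDiff.of_le hf h

theorem CoordIn.of_le {k l : WithTop ℕ∞} {F : HSpace n → Ext n}
    (hF : CoordIn (contDiffFun n l) F) (h : k ≤ l) : CoordIn (contDiffFun n k) F :=
  fun I => contDiffFun_mono h (hF I)

theorem CoordIn.contDiff {k : WithTop ℕ∞} {F : HSpace n → Ext n}
    (hF : CoordIn (contDiffFun n k) F) (I : Finset (Idx n)) :
    ContDiff ℝ k fun p => (extBasis n).repr (F p) I := hF I

theorem natCast_le_infty (k : ℕ) : (k : WithTop ℕ∞) ≤ ∞ := by
  exact_mod_cast le_top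

theorem CoordIn.differentiableAt {F : HSpace n → Ext n} (hF : CoordIn (contDiffFun n 1) F)
    (I : Finset (Idx n)) (q : HSpace n) :
    DifferentiableAt ℝ (fun p => (extBasis n).repr (F p) I) q :=
  (hF.contDiff I).differentiable one_ne_zero q

theorem CoordIn.dOp {k l : WithTop ℕ∞} {F : HSpace n → Ext n}
    (hF : CoordIn (contDiffFun n l) F) (h : k + 1 ≤ l) (α : Fin 2) :
    CoordIn (contDiffFun n k) (QHessian.dOp α F) :=
  CoordIn.sum _ fun I _ => CoordIn.sum _ fun A _ =>
    CoordIn.smul (S := contDiffFun n k) (ContDiff.nabla (hF I) h A α) (CoordIn.const _)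

theorem CoordIn.ofFun {k : WithTop ℕ∞} {u : HSpace n → ℝ} (hu : ContDiff ℝ k u) :
    CoordIn (contDiffFun n k) (QHessian.ofFun u) := by
  have hu' : (fun q => (u q : ℂ)) ∈ contDiffFun n k := Complex.ofRealCLM.contDiff.comp hu
  have := CoordIn.smul hu' (CoordIn.const (1 : Ext n))
  simp only [← Algebra.algebraMap_eq_smul_one] at this
  exact this

/-- The derivative `∇_{A α}` of the coordinates of a form. -/
def nablaForm (A : Idx n) (α : Fin 2) (F : HSpace n → Ext n) (q : HSpace n) : Ext n :=
  ∑ I, nabla A α (fun p => (extBasis n).repr (F p) I) q • extBasis n I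

theorem dOp_eq_sum_nablaForm (α : Fin 2) (F : HSpace n → Ext n) (q : HSpace n) :
    dOp α F q = ∑ A, om A * nablaForm A α F q := by
  simp only [dOp, nablaForm, Finset.mul_sum, mul_smul_comm]
  exact Finset.sum_comm

theorem repr_nablaForm (A : Idx n) (α : Fin 2) (F : HSpace n → Ext n) (q : HSpace n)
    (I : Finset (Idx n)) : (extBasis n).repr (nablaForm A α F q) I =
      nabla A α (fun p => (extBasis n).repr (F p) I) q := by
  rw [nablaForm, (extBasis n).repr_sum_self]

theorem nablaForm_congr {F G : HSpace n → Ext n} {q : HSpace n} (h : F =ᶠ[𝓝 q] G) (A : Idx n)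
    (α : Fin 2) : nablaForm A α F q = nablaForm A α G q :=
  Finset.sum_congr rfl fun I _ => by
    rw [nabla_congr (h.mono fun p hp => by rw [hp]) A α]

theorem nablaForm_mul {F G : HSpace n → Ext n} (hF : CoordIn (contDiffFun n 1) F)
    (hG : CoordIn (contDiffFun n 1) G) (A : Idx n) (α : Fin 2) (q : HSpace n) :
    nablaForm A α (fun p => F p * G p) q = nablaForm A α F q * G q + F q * nablaForm A α G q := by
  apply (extBasis n).repr.injective
  ext K
  rw [repr_nablaForm, map_add, Finsupp.add_apply, repr_mul, repr_mul,
    show (fun p => (extBasis n).repr (F p * G p) K) = _ from funext fun p => repr_mul _ _ _]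
  simp only [repr_nablaForm]
  have hd : ∀ I J, DifferentiableAt ℝ
      (fun p => (extBasis n).repr (F p) I * (extBasis n).repr (G p) J) q := fun I J =>
    (hF.differentiableAt I q).fun_mul (hG.differentiableAt J q)
  rw [nabla_sum _ fun I _ => DifferentiableAt.fun_sum fun J _ => (hd I J).mul_const _,
    ← Finset.sum_add_distrib]
  refine Finset.sum_congr rfl fun I _ => ?_
  rw [nabla_sum _ fun J _ => (hd I J).mul_const _,
    ← Finset.sum_add_distrib]
  refine Finset.sum_congr rfl fun J _ => ?_
  rw [nabla_mul_const (hd I J),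
    nabla_mul (hF.differentiableAt I q) (hG.differentiableAt J q), add_mul]

/-- The sign in Leibniz' rule depends only on how the value F(q) moves past one-forms, so no degree
bookkeeping is needed. -/
theorem dOp_mul_of_commute {F G : HSpace n → Ext n} (hF : CoordIn (contDiffFun n 1) F)
    (hG : CoordIn (contDiffFun n 1) G) (α : Fin 2) (q : HSpace n)
    (hc : ∀ A, om A * F q = F q * om A) :
    dOp α (fun p => F p * G p) q = dOp α F q * G q + F q * dOp α G q := by
  simp only [dOp_eq_sum_nablaForm, nablaForm_mul hF hG, mul_add, Finset.sum_add_distrib,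
    Finset.sum_mul, Finset.mul_sum, ← mul_assoc, hc]

theorem dOp_mul_of_anticommute {F G : HSpace n → Ext n} (hF : CoordIn (contDiffFun n 1) F)
    (hG : CoordIn (contDiffFun n 1) G) (α : Fin 2) (q : HSpace n)
    (hc : ∀ A, om A * F q = -(F q * om A)) :
    dOp α (fun p => F p * G p) q = dOp α F q * G q - F q * dOp α G q := by
  simp only [dOp_eq_sum_nablaForm, nablaForm_mul hF hG, mul_add, Finset.sum_add_distrib,
    Finset.sum_mul, Finset.mul_sum, ← mul_assoc, hc, neg_mul, Finset.sum_neg_distrib,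
    sub_eq_add_neg]

theorem dOp_congr {F G : HSpace n → Ext n} {q : HSpace n} (h : F =ᶠ[𝓝 q] G) (α : Fin 2) :
    dOp α F q = dOp α G q := by
  simp only [dOp_eq_sum_nablaForm, nablaForm_congr h]

theorem dOp_const (α : Fin 2) (w : Ext n) (q : HSpace n) : dOp α (fun _ => w) q = 0 := by
  simp [dOp, nabla_const]

theorem dOp_sum_smul {ι : Type*} (s : Finset ι) {f : ι → HSpace n → ℂ} {q : HSpace n}
    (hf : ∀ i ∈ s, DifferentiableAt ℝ (f i) q) (w : ι → Ext n) (α : Fin 2) :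
    dOp α (fun p => ∑ i ∈ s, f i p • w i) q =
      ∑ i ∈ s, ∑ A, nabla A α (f i) q • (om A * w i) := by
  have hn : ∀ A, nablaForm A α (fun p => ∑ i ∈ s, f i p • w i) q =
      ∑ i ∈ s, nabla A α (f i) q • w i := by
    intro A
    apply (extBasis n).repr.injective
    ext K
    rw [repr_nablaForm]
    simp only [map_sum, map_smul, Finsupp.coe_finsetSum, Finset.sum_apply, Finsupp.smul_apply,
      smul_eq_mul]
    rw [nabla_sum _ fun i hi => (hf i hi).mul_const _]
    exact Finset.sum_congr rfl fun i hi => nabla_mul_const (hf i hi) _ _ _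
  simp only [dOp_eq_sum_nablaForm, hn, Finset.mul_sum, mul_smul_comm]
  exact Finset.sum_comm

theorem dOp_dOp {F : HSpace n → Ext n} (hF : CoordIn (contDiffFun n 2) F) (α β : Fin 2)
    (q : HSpace n) : dOp β (dOp α F) q = ∑ I, ∑ A, ∑ B,
      nabla B β (nabla A α fun p => (extBasis n).repr (F p) I) q •
        (om B * (om A * extBasis n I)) := by
  have hd : ∀ I A, DifferentiableAt ℝ (nabla A α fun p => (extBasis n).repr (F p) I) q :=
    fun I A => (ContDiff.nabla (k := 1) (hF.contDiff I) (by norm_num) A α).differentiable one_ne_zero q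
  have h1 : dOp α F = fun p => ∑ x : Finset (Idx n) × Idx n,
      nabla x.2 α (fun p => (extBasis n).repr (F p) x.1) p • (om x.2 * extBasis n x.1) := by
    funext p
    rw [Fintype.sum_prod_type]
    rfl
  rw [h1, dOp_sum_smul _ fun x _ => hd x.1 x.2, Fintype.sum_prod_type]

/-- Second derivatives commute while the ω^A anticommute. -/
theorem dOp_dOp_swap {F : HSpace n → Ext n} (hF : CoordIn (contDiffFun n 2) F) (α β : Fin 2)
    (q : HSpace n) : dOp β (dOp α F) q = -dOp α (dOp β F) q := by
  rw [dOp_dOp hF, dOp_dOp hF, ← Finset.sum_neg_distrib]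
  refine Finset.sum_congr rfl fun I _ => ?_
  rw [Finset.sum_comm, ← Finset.sum_neg_distrib]
  refine Finset.sum_congr rfl fun B _ => ?_
  rw [← Finset.sum_neg_distrib]
  refine Finset.sum_congr rfl fun A _ => ?_
  rw [nabla_comm (hF I), ← mul_assoc, ← mul_assoc, om_mul_swap B A, neg_mul, smul_neg]

theorem dOp_dOp_self {F : HSpace n → Ext n} (hF : CoordIn (contDiffFun n 2) F) (α : Fin 2)
    (q : HSpace n) : dOp α (dOp α F) q = 0 := by
  have h := dOp_dOp_swap hF α α q
  have h2 : (2 : ℂ) • dOp α (dOp α F) q = 0 := by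
    rw [two_smul]
    nth_rewrite 1 [h]
    exact neg_add_cancel _
  exact (smul_eq_zero.mp h2).resolve_left two_ne_zero

/-- d_0 d_0 = 0, and d_1 d_0 d_1 = -d_0 d_1 d_1 = 0. This closedness drives every integration by
parts. -/
theorem dOp_baston {F : HSpace n → Ext n} (hF : CoordIn (contDiffFun n 3) F) (α : Fin 2)
    (q : HSpace n) : dOp α (baston F) q = 0 := by
  have h1 : CoordIn (contDiffFun n 2) (dOp 1 F) := hF.dOp (by norm_num) 1
  have h0 : CoordIn (contDiffFun n 2) (dOp 0 F) := hF.dOp (by norm_num) 0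
  have hF2 : CoordIn (contDiffFun n 2) F := hF.of_le (by norm_num)
  fin_cases α
  · exact dOp_dOp_self h1 0 q
  · have hz : dOp 1 (dOp 1 F) = fun _ => 0 := funext fun p => dOp_dOp_self hF2 1 p
    change dOp 1 (dOp 0 (dOp 1 F)) q = 0
    rw [dOp_dOp_swap h1, hz, dOp_const, neg_zero]

/-! ### Compact supports and Stokes' formula -/

theorem dOp_eq_zero_of_notMem {F : HSpace n → Ext n} {q : HSpace n} (hq : q ∉ tsupport F)
    (α : Fin 2) : dOp α F q = 0 := by
  have h : F =ᶠ[𝓝 q] fun _ => 0 := notMem_tsupport_iff_eventuallyEq.mp hq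
  rw [dOp_congr h, dOp_const]

theorem tsupport_dOp_subset (F : HSpace n → Ext n) (α : Fin 2) :
    tsupport (dOp α F) ⊆ tsupport F :=
  closure_minimal (fun q hq => by
    by_contra h
    exact hq (dOp_eq_zero_of_notMem h α)) (isClosed_tsupport F)

theorem integral_partialD_eq_zero {f : HSpace n → ℂ} (hf : ContDiff ℝ 1 f)
    (hc : HasCompactSupport f) (c : Fin n × Fin 4) : ∫ q, partialD c f q = 0 := by
  have hint : Integrable (fun q => partialD c f q) := by
    refine Continuous.integrable_of_hasCompactSupport
      (ContDiff.partialD (k := 0) hf (by norm_num) c).continuous ?_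
    refine HasCompactSupport.intro hc.isCompact fun q hq => ?_
    rw [partialD, fderiv_of_notMem_tsupport ℝ hq]
    rfl
  have h := integral_smul_fderiv_eq_neg_fderiv_smul_of_integrable (𝕜 := ℝ) (μ := volume) (g := f)
    (f := fun _ : HSpace n => (1 : ℝ)) (v := EuclideanSpace.single c 1) (by simp)
    (by simpa [partialD] using hint)
    (by simpa using hf.continuous.integrable_of_hasCompactSupport hc)
    (fun _ _ => differentiableAt_const _) fun q _ => hf.differentiable one_ne_zero q
  simp only [one_smul, fderiv_fun_const, Pi.zero_apply, zero_apply, zero_smul,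
    integral_zero, neg_zero] at h
  exact h

/-- Stokes' formula without boundary: the top coefficient is a constant combination of partial
derivatives of compactly supported functions. -/
theorem integral_topCoeff_dOp {G : HSpace n → Ext n} (hG : CoordIn (contDiffFun n 1) G)
    (hc : HasCompactSupport G) (α : Fin 2) :
    Integrable (fun q => topCoeff n (dOp α G q)) ∧ ∫ q, topCoeff n (dOp α G q) = 0 := by
  have hcI : ∀ I, HasCompactSupport fun p => (extBasis n).repr (G p) I := fun I =>
    HasCompactSupport.intro hc.isCompact fun q hq => by
      rw [image_eq_zero_of_notMem_tsupport hq]; simp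
  have hint : ∀ I c, Integrable (partialD c fun p => (extBasis n).repr (G p) I) := fun I c => by
    refine Continuous.integrable_of_hasCompactSupport
      (ContDiff.partialD (k := 0) (hG.contDiff I) (by norm_num) c).continuous ?_
    refine HasCompactSupport.intro (hcI I).isCompact fun q hq => ?_
    rw [partialD, fderiv_of_notMem_tsupport ℝ hq]
    rfl
  have heq : (fun q => topCoeff n (dOp α G q)) = fun q => ∑ I, ∑ A, ∑ c,
      (nablaCoeff (ofLex A).2 α c * topCoeff n (om A * extBasis n I)) *
        partialD ((ofLex A).1, c) (fun p => (extBasis n).repr (G p) I) q := by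
    funext q
    rw [dOp, map_sum]
    refine Finset.sum_congr rfl fun I _ => ?_
    rw [map_sum]
    refine Finset.sum_congr rfl fun A _ => ?_
    rw [map_smul, smul_eq_mul, nabla_eq_sum, Finset.sum_mul]
    exact Finset.sum_congr rfl fun c _ => by ring
  have hint' : ∀ (I : Finset (Idx n)) (A : Idx n) (c : Fin 4), Integrable fun q =>
      (nablaCoeff (ofLex A).2 α c * topCoeff n (om A * extBasis n I)) *
        partialD ((ofLex A).1, c) (fun p => (extBasis n).repr (G p) I) q := fun I A c =>
    (hint I _).const_mul _
  rw [heq]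
  refine ⟨integrable_finsetSum _ fun I _ => integrable_finsetSum _ fun A _ =>
    integrable_finsetSum _ fun c _ => hint' I A c, ?_⟩
  rw [integral_finsetSum _ fun I _ => integrable_finsetSum _ fun A _ =>
    integrable_finsetSum _ fun c _ => hint' I A c]
  refine Finset.sum_eq_zero fun I _ => ?_
  rw [integral_finsetSum _ fun A _ => integrable_finsetSum _ fun c _ => hint' I A c]
  refine Finset.sum_eq_zero fun A _ => ?_
  rw [integral_finsetSum _ fun c _ => hint' I A c]
  refine Finset.sum_eq_zero fun c _ => ?_
  rw [integral_const_mul, integral_partialD_eq_zero (hG I) (hcI I), mul_zero]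

/-- A closed form of class `C^1` with central values. -/
structure IsClosedCentral (S : HSpace n → Ext n) : Prop where
  coordIn : CoordIn (contDiffFun n 1) S
  center : ∀ q, S q ∈ Subalgebra.center ℂ (Ext n)
  closed : ∀ α q, dOp α S q = 0

theorem IsClosedCentral.om_mul {S : HSpace n → Ext n} (hS : IsClosedCentral S) (q : HSpace n)
    (A : Idx n) : om A * S q = S q * om A := Subalgebra.mem_center_iff.mp (hS.center q) _

theorem IsClosedCentral.const {w : Ext n} (hw : w ∈ Subalgebra.center ℂ (Ext n)) :
    IsClosedCentral fun _ : HSpace n => w :=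
  ⟨CoordIn.const w, fun _ => hw, fun α q => dOp_const α w q⟩

theorem IsClosedCentral.mul {S T : HSpace n → Ext n} (hS : IsClosedCentral S)
    (hT : IsClosedCentral T) : IsClosedCentral fun q => S q * T q :=
  ⟨hS.coordIn.mul hT.coordIn, fun q => mul_mem (hS.center q) (hT.center q), fun α q => by
    rw [dOp_mul_of_commute hS.coordIn hT.coordIn α q (hS.om_mul q), hS.closed, hT.closed,
      zero_mul, mul_zero, add_zero]⟩

theorem IsClosedCentral.pow {S : HSpace n → Ext n} (hS : IsClosedCentral S) (k : ℕ) :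
    IsClosedCentral fun q => S q ^ k := by
  induction k with
  | zero => simpa using const (n := n) (Subalgebra.one_mem _)
  | succ k ih => simpa only [pow_succ] using ih.mul hS

theorem IsClosedCentral.list_prod {k : ℕ} {S : Fin k → HSpace n → Ext n}
    (hS : ∀ j, IsClosedCentral (S j)) :
    IsClosedCentral fun q => (List.ofFn fun j => S j q).prod := by
  induction k with
  | zero => simpa using const (n := n) (Subalgebra.one_mem _)
  | succ k ih =>
    simp only [List.ofFn_succ, List.prod_cons]
    exact (hS 0).mul (ih fun j => hS j.succ)

theorem dOp_ofFun {u : HSpace n → ℝ} {q : HSpace n} (hu : DifferentiableAt ℝ u q) (α : Fin 2) :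
    dOp α (ofFun u) q = ∑ A, nabla A α (fun p => (u p : ℂ)) q • om A := by
  have h : ofFun u = fun p => ∑ _i : Fin 1, (u p : ℂ) • (1 : Ext n) := by
    funext p
    simp [ofFun, Algebra.algebraMap_eq_smul_one]
  have hd : DifferentiableAt ℝ (fun p => (u p : ℂ)) q :=
    Complex.ofRealCLM.differentiableAt.comp q hu
  rw [h, dOp_sum_smul (f := fun (_ : Fin 1) p => (u p : ℂ)) _ fun _ _ => hd]
  simp

theorem baston_ofFun {u : HSpace n → ℝ} (hu : ContDiff ℝ 2 u) (q : HSpace n) :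
    baston (ofFun u) q = ∑ A, ∑ B, nabla B 0 (nabla A 1 fun p => (u p : ℂ)) q • (om B * om A) := by
  have h : dOp 1 (ofFun u) = fun p => ∑ A, nabla A 1 (fun p => (u p : ℂ)) p • om A :=
    funext fun p => dOp_ofFun (hu.differentiable two_ne_zero p) 1
  have hu' : ContDiff ℝ 2 fun p => (u p : ℂ) := Complex.ofRealCLM.contDiff.comp hu
  rw [baston, h, dOp_sum_smul _ fun A _ =>
    (ContDiff.nabla (k := 1) hu' (by norm_num) A 1).differentiable one_ne_zero q]

/-- Two derivatives form Δu and a third expresses its closedness, so C^3 is what the argument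
consumes. -/
theorem isClosedCentral_baston_ofFun {u : HSpace n → ℝ} (hu : ContDiff ℝ 3 u) :
    IsClosedCentral (baston (ofFun u)) where
  coordIn := ((CoordIn.ofFun hu).dOp (k := 2) (by norm_num) 1).dOp (by norm_num) 0
  center q := by
    rw [baston_ofFun (hu.of_le (by norm_num))]
    exact Subalgebra.sum_mem _ fun A _ => Subalgebra.sum_mem _ fun B _ =>
      Subalgebra.smul_mem _ (om_mul_om_mem_center _ _) _
  closed α q := dOp_baston (CoordIn.ofFun hu) α q

theorem integrable_topCoeff {G : HSpace n → Ext n} (hG : CoordIn (contDiffFun n 0) G)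
    (hc : HasCompactSupport G) : Integrable fun q => topCoeff n (G q) := by
  refine Continuous.integrable_of_hasCompactSupport
    (ContDiff.continuous (𝕜 := ℝ) (n := 0) (hG.linear (topCoeff n))) ?_
  refine HasCompactSupport.intro hc.isCompact fun q hq => ?_
  rw [image_eq_zero_of_notMem_tsupport hq, map_zero]

/-- Integration by parts for the Baston operator. -/
theorem integral_mul_baston {S F : HSpace n → Ext n} {u : HSpace n → ℝ} (hS : IsClosedCentral S)
    (hu : ContDiff ℝ ∞ u) (hF : CoordIn (contDiffFun n ∞) F) (hc : HasCompactSupport F) :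
    ∫ q, (u q : ℂ) * topCoeff n (S q * baston F q) =
      ∫ q, topCoeff n (S q * baston (ofFun u) q * F q) := by
  have hU := CoordIn.ofFun hu
  have hU1 : CoordIn (contDiffFun n 1) (ofFun u) := hU.of_le (by exact_mod_cast le_top)
  have hF1 : CoordIn (contDiffFun n 1) F := hF.of_le (by exact_mod_cast le_top)
  have hdF : CoordIn (contDiffFun n ∞) (dOp 1 F) := hF.dOp (by exact_mod_cast le_top) 1
  have hdF1 : CoordIn (contDiffFun n 1) (dOp 1 F) := hdF.of_le (by exact_mod_cast le_top)
  have hdU : CoordIn (contDiffFun n ∞) (dOp 0 (ofFun u)) := hU.dOp (by exact_mod_cast le_top) 0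
  have hdU1 : CoordIn (contDiffFun n 1) (dOp 0 (ofFun u)) := hdU.of_le (by exact_mod_cast le_top)
  have hcd : ∀ q, q ∉ tsupport F → dOp 1 F q = 0 := fun q hq => dOp_eq_zero_of_notMem hq 1
  have hcb : ∀ q, q ∉ tsupport F → baston F q = 0 := fun q hq =>
    dOp_eq_zero_of_notMem (fun h => hq (tsupport_dOp_subset F 1 h)) 0
  have hcF : ∀ q, q ∉ tsupport F → F q = 0 := fun q hq => image_eq_zero_of_notMem_tsupport hq
  -- The two exact forms are d_0(S u d_1F) and d_1(S d_0u F). In their sum the terms S d_0u ∧ d_1F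
  -- cancel, and d_1 d_0 u = -Δu leaves u S ΔF - S Δu F.
  have hG1 := integral_topCoeff_dOp (hS.coordIn.mul (hU1.mul hdF1))
    (HasCompactSupport.intro hc.isCompact fun q hq => by simp [hcd q hq]) 0
  have hG2 := integral_topCoeff_dOp (hS.coordIn.mul (hdU1.mul hF1))
    (HasCompactSupport.intro hc.isCompact fun q hq => by simp [hcF q hq]) 1
  have hcu : ∀ q A, om A * ofFun u q = ofFun u q * om A := fun q A => (Algebra.commutes _ _).symm
  have hdu : ∀ q A, om A * dOp 0 (ofFun u) q = -(dOp 0 (ofFun u) q * om A) := by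
    intro q A
    rw [dOp_ofFun (hu.differentiable (by simp) q), Finset.mul_sum, Finset.sum_mul,
      ← Finset.sum_neg_distrib]
    refine Finset.sum_congr rfl fun B _ => ?_
    rw [mul_smul_comm, smul_mul_assoc, om_mul_swap A B, smul_neg]
  have hsum : ∀ q, topCoeff n (dOp 0 (fun p => S p * (ofFun u p * dOp 1 F p)) q) +
      topCoeff n (dOp 1 (fun p => S p * (dOp 0 (ofFun u) p * F p)) q) =
      (u q : ℂ) * topCoeff n (S q * baston F q) -
        topCoeff n (S q * baston (ofFun u) q * F q) := by
    intro q
    rw [dOp_mul_of_commute hS.coordIn (hU1.mul hdF1) 0 q (hS.om_mul q),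
      dOp_mul_of_commute hS.coordIn (hdU1.mul hF1) 1 q (hS.om_mul q),
      dOp_mul_of_commute hU1 hdF1 0 q (hcu q), dOp_mul_of_anticommute hdU1 hF1 1 q (hdu q),
      hS.closed, hS.closed, zero_mul, zero_mul, zero_add, zero_add,
      dOp_dOp_swap (hU.of_le (by exact_mod_cast natCast_le_infty 2)) 0 1 q, ← map_add,
      ← smul_eq_mul (a := (u q : ℂ)), ← map_smul, ← map_sub]
    congr 1
    have h1 : S q * (ofFun u q * dOp 0 (dOp 1 F) q) = (u q : ℂ) • (S q * baston F q) := by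
      rw [ofFun, ← Algebra.smul_def, mul_smul_comm]
      rfl
    rw [← h1]
    simp only [baston]
    noncomm_ring
  have hI := integral_add hG1.1 hG2.1
  rw [hG1.2, hG2.2, add_zero] at hI
  simp only [hsum] at hI
  have hi1 : Integrable fun q => (u q : ℂ) * topCoeff n (S q * baston F q) := by
    have hb : CoordIn (contDiffFun n 1) (baston F) := hdF.dOp (by exact_mod_cast natCast_le_infty 2) 0
    have := integrable_topCoeff (((hU1.mul (hS.coordIn.mul hb))).of_le (k := 0) (by norm_num))
      (HasCompactSupport.intro hc.isCompact fun q hq => by simp [hcb q hq])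
    refine this.congr (Filter.Eventually.of_forall fun q => ?_)
    simp only [ofFun, ← Algebra.smul_def, map_smul, smul_eq_mul]
  have hi2 : Integrable fun q => topCoeff n (S q * baston (ofFun u) q * F q) := by
    have hb : CoordIn (contDiffFun n 1) (baston (ofFun u)) :=
      (hU.dOp (k := 2) (by exact_mod_cast natCast_le_infty 3) 1).dOp (by norm_num) 0
    exact integrable_topCoeff (((hS.coordIn.mul hb).mul hF1).of_le (k := 0) (by norm_num))
      (HasCompactSupport.intro hc.isCompact fun q hq => by simp [hcF q hq])
  rw [integral_sub hi1 hi2] at hI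
  exact sub_eq_zero.mp hI

end Calculus

/-! ### The Baston operator and the quaternionic Hessian -/

section Hessian

variable {n : ℕ}

theorem re_unit (c : Fin 4) : (unit c).re = ![1, 0, 0, 0] c := by fin_cases c <;> rfl

theorem imI_unit (c : Fin 4) : (unit c).imI = ![0, 1, 0, 0] c := by fin_cases c <;> rfl

theorem imJ_unit (c : Fin 4) : (unit c).imJ = ![0, 0, 1, 0] c := by fin_cases c <;> rfl

theorem imK_unit (c : Fin 4) : (unit c).imK = ![0, 0, 0, 1] c := by fin_cases c <;> rfl

theorem qHessian_eq_sum {v : HSpace n → ℝ} (hv : ContDiff ℝ 2 v) (q : HSpace n) (l k : Fin n) :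
    qHessian v q l k = ∑ c, ∑ d, partialD (l, c) (partialD (k, d) v) q •
      (unit c * star (unit d)) := by
  have hv1 : ∀ p, DifferentiableAt ℝ v p := fun p => hv.differentiable two_ne_zero p
  have h1 : ∀ d p, partialD (k, d) (fun p => (v p : Quaternion ℝ)) p =
      ((partialD (k, d) v p : ℝ) : Quaternion ℝ) := fun d p =>
    partialD_clm (algebraMapCLM ℝ (Quaternion ℝ)) (hv1 p) _
  have h2 : ∀ d, DifferentiableAt ℝ (partialD (k, d) v) q := fun d =>
    (ContDiff.partialD (k := 1) hv (by norm_num) (k, d)).differentiable one_ne_zero q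
  have h3 : (cauchyFueterConj k fun p => (v p : Quaternion ℝ)) =
      fun p => ∑ d, ((ContinuousLinearMap.id ℝ ℝ).smulRight (star (unit d)))
        (partialD (k, d) v p) := by
    funext p
    refine Finset.sum_congr rfl fun d _ => ?_
    rw [h1, Quaternion.mul_coe_eq_smul]
    rfl
  rw [qHessian, Matrix.of_apply, h3, cauchyFueter]
  refine Finset.sum_congr rfl fun c _ => ?_
  have h4 : ∀ d, DifferentiableAt ℝ (fun p => ((ContinuousLinearMap.id ℝ ℝ).smulRight
      (star (unit d))) (partialD (k, d) v p)) q := fun d =>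
    ((ContinuousLinearMap.id ℝ ℝ).smulRight (star (unit d))).differentiableAt.comp q (h2 d)
  rw [partialD_sum _ fun d _ => h4 d, Finset.mul_sum]
  refine Finset.sum_congr rfl fun d _ => ?_
  rw [partialD_clm _ (h2 d)]
  simp

theorem nabla_nabla_ofReal {v : HSpace n → ℝ} (hv : ContDiff ℝ 2 v) (A B : Idx n) (α β : Fin 2)
    (q : HSpace n) : nabla B β (nabla A α fun p => (v p : ℂ)) q =
      ∑ d, ∑ c, nablaCoeff (ofLex B).2 β d * nablaCoeff (ofLex A).2 α c *
        (partialD ((ofLex B).1, d) (partialD ((ofLex A).1, c) v) q : ℝ) := by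
  have hv1 : ∀ p, DifferentiableAt ℝ v p := fun p => hv.differentiable two_ne_zero p
  have hv' : ContDiff ℝ 2 fun p => (v p : ℂ) := Complex.ofRealCLM.contDiff.comp hv
  rw [nabla_nabla hv']
  refine Finset.sum_congr rfl fun d _ => Finset.sum_congr rfl fun c _ => ?_
  have h1 : partialD ((ofLex A).1, c) (fun p => (v p : ℂ)) =
      fun p => Complex.ofRealCLM (partialD ((ofLex A).1, c) v p) :=
    funext fun p => partialD_clm Complex.ofRealCLM (hv1 p) _
  have h2 : DifferentiableAt ℝ (partialD ((ofLex A).1, c) v) q :=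
    (ContDiff.partialD (k := 1) hv (by norm_num) _).differentiable one_ne_zero q
  rw [h1, partialD_clm _ h2]
  rfl

/-- H stands for the 4×4 block of second derivatives between q_l and q_k. Its transpose enters with
l and k exchanged; the identity itself does not require H to be symmetric. -/
theorem thetaEntry_hessian (H : Fin 4 → Fin 4 → ℝ) (l k : Fin n) :
    thetaEntry (∑ c, ∑ d, H c d • (unit c * star (unit d))) l k =
      ∑ b, ∑ a, ((∑ c, ∑ d, nablaCoeff b 0 c * nablaCoeff a 1 d * (H c d : ℂ)) •
          (om (toLex (l, b)) * om (toLex (k, a))) +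
        (∑ c, ∑ d, nablaCoeff b 0 c * nablaCoeff a 1 d * (H d c : ℂ)) •
          (om (toLex (k, b)) * om (toLex (l, a)))) := by
  have hz : zPart (∑ c, ∑ d, H c d • (unit c * star (unit d))) =
      (∑ c, ∑ d, nablaCoeff 0 0 c * nablaCoeff 1 1 d * (H c d : ℂ)) -
        ∑ c, ∑ d, nablaCoeff 1 0 c * nablaCoeff 0 1 d * (H d c : ℂ) := by
    simp only [Fin.sum_univ_four, nablaCoeff]
    apply Complex.ext <;> simp [zPart, re_unit, imI_unit, imJ_unit, imK_unit] <;> ring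
  have hw : wPart (∑ c, ∑ d, H c d • (unit c * star (unit d))) =
      (∑ c, ∑ d, nablaCoeff 0 0 c * nablaCoeff 0 1 d * (H c d : ℂ)) -
        ∑ c, ∑ d, nablaCoeff 0 0 c * nablaCoeff 0 1 d * (H d c : ℂ) := by
    simp only [Fin.sum_univ_four, nablaCoeff]
    apply Complex.ext <;> simp [wPart, re_unit, imI_unit, imJ_unit, imK_unit] <;> ring
  have hz' : star (zPart (∑ c, ∑ d, H c d • (unit c * star (unit d)))) =
      -(∑ c, ∑ d, nablaCoeff 1 0 c * nablaCoeff 0 1 d * (H c d : ℂ)) +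
        ∑ c, ∑ d, nablaCoeff 0 0 c * nablaCoeff 1 1 d * (H d c : ℂ) := by
    rw [hz]
    simp only [Fin.sum_univ_four, nablaCoeff]
    apply Complex.ext <;> simp <;> ring
  have hw' : star (wPart (∑ c, ∑ d, H c d • (unit c * star (unit d)))) =
      (∑ c, ∑ d, nablaCoeff 1 0 c * nablaCoeff 1 1 d * (H c d : ℂ)) -
        ∑ c, ∑ d, nablaCoeff 1 0 c * nablaCoeff 1 1 d * (H d c : ℂ) := by
    rw [hw]
    simp only [Fin.sum_univ_four, nablaCoeff]
    apply Complex.ext <;> simp <;> ring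
  rw [thetaEntry, hz', hw', hz, hw]
  simp only [Fin.sum_univ_two, om_mul_swap (toLex (k, _)) (toLex (l, _))]
  module

/-- On functions the Baston operator is the two-form of the quaternionic Hessian. -/
theorem baston_eq_theta {v : HSpace n → ℝ} (hv : ContDiff ℝ 2 v) (q : HSpace n) :
    baston (ofFun v) q = theta (qHessian v q) := by
  have h1 : baston (ofFun v) q = ∑ l, ∑ k, ∑ b, ∑ a,
      (∑ c, ∑ d, nablaCoeff b 0 c * nablaCoeff a 1 d *
        ((partialD (l, c) (partialD (k, d) v) q : ℝ) : ℂ)) •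
          (om (toLex (l, b)) * om (toLex (k, a)) : Ext n) := by
    rw [baston_ofFun hv, Finset.sum_comm]
    have hidx : ∀ f : Idx n → Ext n, ∑ A, f A = ∑ l, ∑ b, f (toLex (l, b)) := fun f => by
      rw [sum_idx]
      exact Finset.sum_congr rfl fun l _ =>
        (Fin.sum_univ_two fun b => f (toLex (l, b))).symm
    rw [hidx]
    refine Finset.sum_congr rfl fun l _ => ?_
    refine (Finset.sum_congr rfl fun b _ => hidx _).trans ?_
    rw [Finset.sum_comm]
    refine Finset.sum_congr rfl fun k _ => Finset.sum_congr rfl fun b _ =>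
      Finset.sum_congr rfl fun a _ => ?_
    rw [nabla_nabla_ofReal hv]
    rfl
  have h2 : ∀ l k, thetaEntry (qHessian v q l k) l k =
      (∑ b, ∑ a, (∑ c, ∑ d, nablaCoeff b 0 c * nablaCoeff a 1 d *
        ((partialD (l, c) (partialD (k, d) v) q : ℝ) : ℂ)) •
          (om (toLex (l, b)) * om (toLex (k, a)) : Ext n)) +
      ∑ b, ∑ a, (∑ c, ∑ d, nablaCoeff b 0 c * nablaCoeff a 1 d *
        ((partialD (k, c) (partialD (l, d) v) q : ℝ) : ℂ)) •
          (om (toLex (k, b)) * om (toLex (l, a)) : Ext n) := by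
    intro l k
    rw [qHessian_eq_sum hv, thetaEntry_hessian]
    simp only [Finset.sum_add_distrib]
    congr 1
    refine Finset.sum_congr rfl fun b _ => Finset.sum_congr rfl fun a _ => ?_
    congr 1
    refine Finset.sum_congr rfl fun c _ => Finset.sum_congr rfl fun d _ => ?_
    rw [partialD_comm hv (k, c) (l, d)]
  rw [theta]
  simp only [h2, Finset.sum_add_distrib]
  -- Renaming l ↔ k identifies the second family with the first, and the two copies absorb the
  -- factor 1/2.
  rw [Finset.sum_comm (f := fun l k => ∑ b, ∑ a, (∑ c, ∑ d, nablaCoeff b 0 c *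
    nablaCoeff a 1 d * ((partialD (k, c) (partialD (l, d) v) q : ℝ) : ℂ)) •
    (om (toLex (k, b)) * om (toLex (l, a)) : Ext n)), ← h1, ← two_smul ℂ, smul_smul]
  norm_num

/-! ### Radial functions -/

/-- The quaternionic coordinates of a point of `ℍⁿ`. -/
def toQuat (x : HSpace n) (l : Fin n) : Quaternion ℝ := ⟨x (l, 0), x (l, 1), x (l, 2), x (l, 3)⟩

theorem toQuat_eq_sum (x : HSpace n) (l : Fin n) : toQuat x l = ∑ c, x (l, c) • unit c := by
  rw [Fin.sum_univ_four]
  ext <;> simp [toQuat, re_unit, imI_unit, imJ_unit, imK_unit]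

theorem partialD_coord (a : HSpace n) (c d : Fin n × Fin 4) (q : HSpace n) :
    partialD c (fun p => (p - a) d) q = if c = d then 1 else 0 := by
  have h0 : HasFDerivAt (fun p : HSpace n => p - a) (ContinuousLinearMap.id ℝ _) q :=
    (hasFDerivAt_id q).sub_const a
  have h := ((EuclideanSpace.proj d : HSpace n →L[ℝ] ℝ).hasFDerivAt (x := q - a)).comp q h0
  change fderiv ℝ ((EuclideanSpace.proj d : HSpace n →L[ℝ] ℝ) ∘ fun p => p - a) q _ = _
  rw [h.fderiv]
  simp [eq_comm]

theorem partialD_radial {ψ : ℝ → ℝ} {a q : HSpace n} {r : ℝ}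
    (h : HasDerivAt ψ r (‖q - a‖ ^ 2)) (c : Fin n × Fin 4) :
    partialD c (fun p => ψ (‖p - a‖ ^ 2)) q = r * (2 * (q - a) c) := by
  have h1 : HasFDerivAt (fun p : HSpace n => ‖p - a‖ ^ 2) (2 • innerSL ℝ (q - a)) q := by
    have := (hasStrictFDerivAt_norm_sq (q - a)).hasFDerivAt.comp q ((hasFDerivAt_id q).sub_const a)
    exact this
  have h2 := h.comp_hasFDerivAt q h1
  rw [partialD, show (fun p => ψ (‖p - a‖ ^ 2)) = ψ ∘ fun p => ‖p - a‖ ^ 2 from rfl, h2.fderiv]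
  simp [EuclideanSpace.inner_single_right]

/-- The real second derivatives are 4ψ'' x_c x_d + 2ψ' δ_{cd}. Summed against the quaternionic
units, the first part gives a rank one matrix, and the second gives 8ψ' on the diagonal because the
four units satisfy ∑ e ē = 4. -/
theorem qHessian_radial {ψ ψ' : ℝ → ℝ} {a : HSpace n} {r : ℝ} (q : HSpace n)
    (hψ : ContDiff ℝ 2 fun p : HSpace n => ψ (‖p - a‖ ^ 2))
    (h1 : ∀ t, 0 ≤ t → HasDerivAt ψ (ψ' t) t) (h2 : HasDerivAt ψ' r (‖q - a‖ ^ 2)) :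
    qHessian (fun p => ψ (‖p - a‖ ^ 2)) q =
      (8 * ψ' (‖q - a‖ ^ 2)) • 1 + (4 * r) • rankOne (toQuat (q - a)) := by
  have hcoord : ∀ d, DifferentiableAt ℝ (fun p : HSpace n => (p - a) d) q := fun d =>
    (EuclideanSpace.proj d : HSpace n →L[ℝ] ℝ).differentiableAt.comp q
      (differentiableAt_id.sub_const a)
  have hrad : DifferentiableAt ℝ (fun p : HSpace n => ψ' (‖p - a‖ ^ 2)) q := by
    have h0 : DifferentiableAt ℝ (fun p : HSpace n => ‖p - a‖ ^ 2) q :=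
      (differentiableAt_id.sub_const a).norm_sq ℝ
    exact h2.differentiableAt.comp q h0
  have hH : ∀ c d, partialD c (partialD d fun p => ψ (‖p - a‖ ^ 2)) q =
      4 * r * ((q - a) c * (q - a) d) + 2 * ψ' (‖q - a‖ ^ 2) * (if c = d then 1 else 0) := by
    intro c d
    have heq : (partialD d fun p => ψ (‖p - a‖ ^ 2)) =
        fun p => ψ' (‖p - a‖ ^ 2) * (2 * (p - a) d) :=
      funext fun p => partialD_radial (h1 _ (by positivity)) d
    rw [heq, partialD_mul hrad ((hcoord d).const_mul 2), partialD_radial h2,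
      partialD_mul (differentiableAt_const _) (hcoord d), partialD_coord]
    have h0 : partialD c (fun _ : HSpace n => (2 : ℝ)) q = 0 := by simp [partialD]
    rw [h0]
    ring
  ext1 l k
  rw [qHessian_eq_sum hψ]
  simp only [hH, add_smul, Finset.sum_add_distrib, Matrix.add_apply, Matrix.smul_apply]
  rw [add_comm]
  congr 1
  · rcases eq_or_ne l k with rfl | hlk
    · rw [Matrix.one_apply_eq]
      simp only [Prod.mk.injEq, true_and, mul_ite, mul_one, mul_zero, ite_smul, zero_smul,
        Finset.sum_ite_eq, Finset.mem_univ, if_true, ← Finset.smul_sum]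
      have : ∑ c, unit c * star (unit c) = (4 : ℝ) • (1 : Quaternion ℝ) := by
        rw [Fin.sum_univ_four]
        ext <;> simp [re_unit, imI_unit, imJ_unit, imK_unit] <;> norm_num <;> rfl
      rw [this, smul_smul]
      congr 1
      ring
    · rw [Matrix.one_apply_ne hlk, smul_zero]
      refine Finset.sum_eq_zero fun c _ => Finset.sum_eq_zero fun d _ => ?_
      rw [if_neg (fun h => hlk (Prod.mk.inj h).1), mul_zero, zero_smul]
  · rw [rankOne, Matrix.of_apply, toQuat_eq_sum, toQuat_eq_sum, star_sum, Finset.sum_mul_sum,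
      Finset.smul_sum]
    refine Finset.sum_congr rfl fun c _ => ?_
    rw [Finset.smul_sum]
    refine Finset.sum_congr rfl fun d _ => ?_
    rw [Quaternion.star_smul, smul_mul_smul_comm, smul_smul]

/-! ### Hessian forms of rank one perturbations of `β_n` -/

theorem thetaC_rankOne_sq (p : Fin n → Quaternion ℝ) :
    thetaC (rankOne p) * thetaC (rankOne p) = 0 := by
  apply Subtype.ext
  change theta (rankOne p) * theta (rankOne p) = 0
  rw [theta_rankOne, mul_assoc, ← mul_assoc (ExteriorAlgebra.ι ℂ (vecD p)),
    show ExteriorAlgebra.ι ℂ (vecD p) * ExteriorAlgebra.ι ℂ (vecC p) =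
      -(ExteriorAlgebra.ι ℂ (vecC p) * ExteriorAlgebra.ι ℂ (vecD p)) from
      eq_neg_of_add_eq_zero_left (ExteriorAlgebra.ι_add_mul_swap _ _),
    neg_mul, mul_assoc, ExteriorAlgebra.ι_sq_zero, mul_zero, neg_zero, mul_zero]

/-- Over the quaternions only the real part of the trace is cyclic, and this is enough for unitary
invariance. -/
theorem HasEigenvalues.sum_eq {A : Matrix (Fin n) (Fin n) (Quaternion ℝ)} {ev : Fin n → ℝ}
    (h : HasEigenvalues A ev) : ∑ i, ev i = ∑ i, (A i i).re := by
  obtain ⟨U, hU, h⟩ := h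
  have hre : ∀ (f : Fin n → Quaternion ℝ), (∑ i, f i).re = ∑ i, (f i).re := fun f =>
    map_sum (QuaternionAlgebra.reₗ (R := ℝ) (-1 : ℝ) 0 (-1)) f _
  have hcomm : ∀ M N : Matrix (Fin n) (Fin n) (Quaternion ℝ),
      ∑ i, ((M * N) i i).re = ∑ i, ((N * M) i i).re := by
    intro M N
    simp only [Matrix.mul_apply, hre]
    rw [Finset.sum_comm]
    refine Finset.sum_congr rfl fun i _ => Finset.sum_congr rfl fun j _ => ?_
    simp only [Quaternion.re_mul]
    ring
  have h1 : ∑ i, ev i = ∑ i, ((star U * A * U) i i).re := by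
    rw [h]
    simp
  rw [h1, mul_assoc, hcomm, mul_assoc, Unitary.mul_star_self_of_mem hU, mul_one]

/-- The case m = 1 of the eigenvalue formula; expressed through the trace it can be evaluated
without knowing the eigenvalues. -/
theorem topCoeff_theta_mul_beta_pow (hn : 1 ≤ n) {A : Matrix (Fin n) (Fin n) (Quaternion ℝ)}
    (hA : A.IsHermitian) : topCoeff n (theta A * beta n ^ (n - 1)) =
      ((n - 1) ! : ℂ) * ((∑ i, (A i i).re : ℝ) : ℂ) := by
  obtain ⟨ev, hev⟩ := exists_hasEigenvalues hA
  have h := hev.topCoeff_pow hn 0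
  rw [zero_smul, add_zero, pow_one, Finset.powersetCard_one] at h
  rw [h, ← hev.sum_eq]
  simp

theorem sum_re_rankOne_toQuat (x : HSpace n) :
    ∑ l, (rankOne (toQuat x) l l).re = ‖x‖ ^ 2 := by
  rw [EuclideanSpace.real_norm_sq_eq, Fintype.sum_prod_type]
  refine Finset.sum_congr rfl fun l _ => ?_
  rw [Fin.sum_univ_four]
  rw [rankOne, Matrix.of_apply, Quaternion.re_mul, Quaternion.re_star, Quaternion.imI_star,
    Quaternion.imJ_star, Quaternion.imK_star]
  simp only [toQuat]
  ring

/-- The rank one form squares to zero, so the power is x^m β^m + m x^{m-1} y θ β^{m-1}. The trace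
|q|² evaluates the second term. -/
theorem hessFunctional_rankOne {m : ℕ} (hm : 1 ≤ m) (hmn : m ≤ n) (x y : ℂ) (q : HSpace n) :
    hessFunctional n m ((x • betaC n + y • thetaC (rankOne (toQuat q))) ^ m) =
      ((n - 1) ! : ℂ) * x ^ (m - 1) * (n * x + m * y * ((‖q‖ ^ 2 : ℝ) : ℂ)) := by
  obtain ⟨k, rfl⟩ : ∃ k, m = k + 1 := ⟨m - 1, by omega⟩
  obtain ⟨N, rfl⟩ : ∃ N, n = N + 1 := ⟨n - 1, by omega⟩
  have hsq : (y • thetaC (rankOne (toQuat q))) * (y • thetaC (rankOne (toQuat q))) = 0 := by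
    rw [smul_mul_smul_comm, thetaC_rankOne_sq, smul_zero]
  have hX : hessFunctional (N + 1) (k + 1) (thetaC (rankOne (toQuat q)) * betaC (N + 1) ^ k) =
      (N ! : ℂ) * ((‖q‖ ^ 2 : ℝ) : ℂ) := by
    have := topCoeff_theta_mul_beta_pow (by omega) (rankOne_isHermitian (toQuat q))
    rw [sum_re_rankOne_toQuat] at this
    rw [hessFunctional_apply, MulMemClass.coe_mul, SubmonoidClass.coe_pow, coe_betaC, mul_assoc,
      ← pow_add, show k + (N + 1 - (k + 1)) = N + 1 - 1 by omega]
    exact this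
  rw [add_comm (x • betaC (N + 1)), add_pow_succ_of_sq_zero hsq, map_add, smul_pow, map_smul,
    hessFunctional_beta_pow hmn]
  have h2 : ((k + 1 : ℕ) : Subalgebra.center ℂ (Ext (N + 1))) *
      (y • thetaC (rankOne (toQuat q))) * (x • betaC (N + 1)) ^ k =
      (((k + 1 : ℕ) : ℂ) * y * x ^ k) • (thetaC (rankOne (toQuat q)) * betaC (N + 1) ^ k) := by
    rw [← nsmul_eq_mul, ← Nat.cast_smul_eq_nsmul ℂ, smul_pow, smul_mul_smul_comm,
      smul_mul_assoc, smul_smul]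
    congr 1
    ring
  rw [h2, map_smul, hX, Nat.factorial_succ, Nat.add_sub_cancel, Nat.add_sub_cancel]
  simp only [smul_eq_mul]
  push_cast
  ring

end Hessian

/-! ### Regularized powers of the distance -/

section Analysis

open Filter

variable {E : Type*} [NormedAddCommGroup E]

/-- The regularized squared distance `|q - a|² + ε`. -/
def regDist (a : E) (ε : ℝ) (q : E) : ℝ := ‖q - a‖ ^ 2 + ε

theorem regDist_nonneg {ε : ℝ} (hε : 0 ≤ ε) (a q : E) : 0 ≤ regDist a ε q :=
  add_nonneg (sq_nonneg _) hε

theorem regDist_pos {ε : ℝ} (hε : 0 < ε) (a q : E) : 0 < regDist a ε q :=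
  add_pos_of_nonneg_of_pos (sq_nonneg _) hε

theorem regDist_zero_pos {a q : E} (h : q ≠ a) : 0 < regDist a 0 q := by
  have : 0 < ‖q - a‖ := norm_pos_iff.mpr (sub_ne_zero.mpr h)
  rw [regDist]
  positivity

theorem continuous_regDist (a : E) (ε : ℝ) : Continuous (regDist a ε) := by
  unfold regDist
  fun_prop

theorem tendsto_regDist (a q : E) : Tendsto (fun ε => regDist a ε q) (𝓝[>] 0) (𝓝 (regDist a 0 q)) :=
  ((continuous_const.add continuous_id).tendsto _).mono_left nhdsWithin_le_nhds

theorem measurable_regDist [MeasurableSpace E] [BorelSpace E] (a : E) (ε : ℝ) :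
    Measurable (regDist a ε) :=
  (continuous_regDist a ε).measurable

variable [NormedSpace ℝ E]

/-- The regularized direction `(q - a) / (|q - a|² + ε)^{1/2}`. -/
def regDir (a : E) (ε : ℝ) (q : E) : E := (√(regDist a ε q))⁻¹ • (q - a)

theorem norm_regDir_sq {ε : ℝ} (hε : 0 ≤ ε) (a q : E) :
    ‖regDir a ε q‖ ^ 2 = (regDist a ε q)⁻¹ * ‖q - a‖ ^ 2 := by
  rw [regDir, norm_smul, mul_pow, norm_inv, inv_pow, Real.norm_eq_abs, sq_abs,
    Real.sq_sqrt (regDist_nonneg hε a q)]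

theorem norm_regDir_le {ε : ℝ} (hε : 0 ≤ ε) (a q : E) : ‖regDir a ε q‖ ≤ 1 := by
  rw [← sq_le_one_iff₀ (norm_nonneg _), norm_regDir_sq hε]
  exact inv_mul_le_one_of_le₀ (le_add_of_nonneg_right hε) (regDist_nonneg hε a q)

theorem tendsto_regDir {a q : E} (h : q ≠ a) :
    Tendsto (fun ε => regDir a ε q) (𝓝[>] 0) (𝓝 (regDir a 0 q)) :=
  (((Real.continuous_sqrt.tendsto _).comp (tendsto_regDist a q)).inv₀
    (Real.sqrt_ne_zero'.mpr (regDist_zero_pos h))).smul_const _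

variable [MeasurableSpace E] [BorelSpace E]

variable [FiniteDimensional ℝ E] (μ : Measure E) [μ.IsAddHaarMeasure]

theorem measurable_regDir (a : E) (ε : ℝ) : Measurable (regDir a ε) :=
  (measurable_regDist a ε).sqrt.inv.smul (measurable_id.sub_const a)

theorem ae_ne_of_finrank (hd : 1 ≤ Module.finrank ℝ E) (a : E) : ∀ᵐ q ∂μ, q ≠ a := by
  have : Nontrivial E := Module.nontrivial_of_finrank_pos (R := ℝ) hd
  exact compl_mem_ae_iff.mpr (measure_singleton a)

theorem locallyIntegrable_regDist_rpow (hd : 1 ≤ Module.finrank ℝ E) {γ : ℝ}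
    (hγ : 2 * γ < Module.finrank ℝ E) (a : E) :
    LocallyIntegrable (fun q => regDist a 0 q ^ (-γ)) μ := by
  have h0 : LocallyIntegrable (fun x : E => (‖x‖ ^ 2) ^ (-γ)) μ := by
    refine locallyIntegrable_of_norm_le_rpow hd (C := 1) hγ ?_ ?_
    · refine Eventually.of_forall fun x => le_of_eq ?_
      rw [one_mul, Real.norm_of_nonneg (by positivity), ← Real.rpow_natCast, ← Real.rpow_mul
        (norm_nonneg x)]
      congr 1
      push_cast
      ring
    · exact ((measurable_norm.pow_const 2).pow_const _).aestronglyMeasurable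
  intro q
  obtain ⟨U, hU, hi⟩ := h0 (q - a)
  refine ⟨(fun p => p - a) ⁻¹' U, (continuous_id.sub continuous_const).continuousAt hU, ?_⟩
  have := (measurePreserving_sub_right μ a).integrableOn_comp_preimage
    (MeasurableEquiv.subRight a).measurableEmbedding (f := fun x : E => (‖x‖ ^ 2) ^ (-γ)) (s := U)
  simpa [Function.comp_def, regDist] using this.mpr hi

/-- A continuous function of the direction times an integrable power of the distance is locally
integrable. -/
theorem locallyIntegrable_regDist_rpow_mul (hd : 1 ≤ Module.finrank ℝ E) {γ : ℝ}
    (hγ : 2 * γ < Module.finrank ℝ E) (a : E) {g : E → ℂ} (hg : Continuous g) :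
    LocallyIntegrable (fun q => ((regDist a 0 q ^ (-γ) : ℝ) : ℂ) * g (regDir a 0 q)) μ := by
  have : ProperSpace E := FiniteDimensional.proper ℝ E
  obtain ⟨M, hM⟩ := (isCompact_closedBall (0 : E) 1).exists_bound_of_continuousOn hg.continuousOn
  refine ((locallyIntegrable_regDist_rpow μ hd hγ a).smul M).mono ?_ ?_
  · exact ((Complex.measurable_ofReal.comp ((measurable_regDist a 0).pow_const _)).mul
      (hg.measurable.comp (measurable_regDir a 0))).aestronglyMeasurable
  · refine Eventually.of_forall fun q => ?_
    have h1 := hM (regDir a 0 q) (by simpa using norm_regDir_le le_rfl a q)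
    rw [norm_mul, Complex.norm_real, mul_comm, Pi.smul_apply, norm_smul, Real.norm_eq_abs M]
    gcongr
    exact h1.trans (le_abs_self M)

/-- Dominated convergence. The regularized directions stay in the closed unit ball, so G is bounded
along them even though the limiting direction is singular at a, and the radial factor increases as ε
decreases to 0. -/
theorem tendsto_integral_regDist_rpow_mul (hd : 1 ≤ Module.finrank ℝ E) {γ : ℝ} (hγ0 : 0 ≤ γ)
    (hγ : 2 * γ < Module.finrank ℝ E) (a : E) {G : E × E → ℂ} (hG : Continuous G) {K : Set E}
    (hK : IsCompact K) (hGK : ∀ y, ∀ q ∉ K, G (y, q) = 0) :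
    Tendsto (fun ε => ∫ q, ((regDist a ε q ^ (-γ) : ℝ) : ℂ) * G (regDir a ε q, q) ∂μ) (𝓝[>] 0)
      (𝓝 (∫ q, ((regDist a 0 q ^ (-γ) : ℝ) : ℂ) * G (regDir a 0 q, q) ∂μ)) := by
  have : ProperSpace E := FiniteDimensional.proper ℝ E
  obtain ⟨M, hM⟩ := ((isCompact_closedBall (0 : E) 1).prod hK).exists_bound_of_continuousOn
    hG.continuousOn
  have hMG : ∀ ε, 0 ≤ ε → ∀ q, ‖G (regDir a ε q, q)‖ ≤ K.indicator (fun _ => |M|) q := by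
    intro ε hε q
    by_cases hq : q ∈ K
    · rw [Set.indicator_of_mem hq]
      exact (hM (regDir a ε q, q) ⟨by simpa using norm_regDir_le hε a q, hq⟩).trans (le_abs_self M)
    · rw [Set.indicator_of_notMem hq, hGK _ _ hq, norm_zero]
  refine tendsto_integral_filter_of_dominated_convergence
    (fun q => regDist a 0 q ^ (-γ) * K.indicator (fun _ => |M|) q) ?_ ?_ ?_ ?_
  · refine Eventually.of_forall fun ε => Measurable.aestronglyMeasurable ?_
    exact (Complex.measurable_ofReal.comp ((measurable_regDist a ε).pow_const _)).mul
      (hG.measurable.comp ((measurable_regDir a ε).prodMk measurable_id))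
  · filter_upwards [self_mem_nhdsWithin] with ε (hε : 0 < ε)
    filter_upwards [ae_ne_of_finrank μ hd a] with q hq
    rw [norm_mul, Complex.norm_real, Real.norm_of_nonneg
      (Real.rpow_nonneg (regDist_nonneg hε.le a q) _)]
    refine mul_le_mul ?_ (hMG ε hε.le q) (norm_nonneg _)
      (Real.rpow_nonneg (regDist_nonneg le_rfl a q) _)
    exact Real.rpow_le_rpow_of_nonpos (regDist_zero_pos hq)
      (add_le_add_right hε.le _) (neg_nonpos.mpr hγ0)
  · have h1 : IntegrableOn (fun q => regDist a 0 q ^ (-γ)) K μ :=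
      (locallyIntegrable_regDist_rpow μ hd hγ a).integrableOn_isCompact hK
    have h2 : IntegrableOn (fun q => regDist a 0 q ^ (-γ) * |M|) K μ := h1.mul_const |M|
    replace h2 := h2.integrable_indicator hK.measurableSet
    refine h2.congr (Eventually.of_forall fun q => ?_)
    by_cases hq : q ∈ K <;> simp [hq]
  · filter_upwards [ae_ne_of_finrank μ hd a] with q hq
    have h1 : Tendsto (fun ε => regDist a ε q ^ (-γ)) (𝓝[>] 0) (𝓝 (regDist a 0 q ^ (-γ))) :=
      (tendsto_regDist a q).rpow_const (Or.inl (regDist_zero_pos hq).ne')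
    exact ((Complex.continuous_ofReal.tendsto _).comp h1).mul
      ((hG.tendsto _).comp ((tendsto_regDir hq).prodMk_nhds tendsto_const_nhds))

/-! ### An approximate identity -/

/-- An antiderivative is (y²/(1+y²))^N / (2N). -/
theorem integral_Ioi_pow_mul_inv (N : ℕ) (hN : 1 ≤ N) :
    ∫ y in Set.Ioi (0 : ℝ), y ^ (2 * N - 1) • ((1 + y ^ 2) ^ (N + 1))⁻¹ = (2 * N : ℝ)⁻¹ := by
  have hd : ∀ y : ℝ, HasDerivAt (fun y : ℝ => (y ^ 2 / (1 + y ^ 2)) ^ N * (2 * N : ℝ)⁻¹)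
      (y ^ (2 * N - 1) • ((1 + y ^ 2) ^ (N + 1))⁻¹) y := by
    intro y
    have h0 : (1 + y ^ 2 : ℝ) ≠ 0 := by positivity
    have h1 : HasDerivAt (fun y : ℝ => y ^ 2) (2 * y) y := by simpa using hasDerivAt_pow 2 y
    have h2 := ((h1.div (h1.const_add 1) h0).pow N).mul_const (2 * N : ℝ)⁻¹
    refine h2.congr_deriv ?_
    obtain ⟨k, rfl⟩ : ∃ k, N = k + 1 := ⟨N - 1, by omega⟩
    rw [smul_eq_mul, show 2 * (k + 1) - 1 = 2 * k + 1 by omega, Nat.add_sub_cancel]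
    simp only [Pi.div_apply]
    rw [div_pow, ← pow_mul]
    have hk : ((k + 1 : ℕ) : ℝ) ≠ 0 := by positivity
    field_simp
    ring
  have hlim : Tendsto (fun y : ℝ => (y ^ 2 / (1 + y ^ 2)) ^ N * (2 * N : ℝ)⁻¹) atTop
      (𝓝 (2 * N : ℝ)⁻¹) := by
    have h1 : Tendsto (fun y : ℝ => 1 - (1 + y ^ 2)⁻¹) atTop (𝓝 (1 - 0)) :=
      tendsto_const_nhds.sub (tendsto_inv_atTop_zero.comp
        (tendsto_atTop_add_const_left _ _ (tendsto_pow_atTop two_ne_zero)))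
    have h2 := (h1.pow N).mul_const (2 * N : ℝ)⁻¹
    rw [sub_zero, one_pow, one_mul] at h2
    refine h2.congr fun y => ?_
    have h0 : (1 + y ^ 2 : ℝ) ≠ 0 := by positivity
    congr 2
    field_simp
    ring
  rw [integral_Ioi_of_hasDerivAt_of_nonneg' (fun y _ => hd y) (fun y hy => ?_) hlim]
  · simp [show N ≠ 0 by omega]
  · have : 0 < y := hy
    positivity

/-- In polar coordinates the factor dim E = 2N cancels the radial integral 1/(2N). -/
theorem integral_inv_one_add_sq (N : ℕ) (hN : 1 ≤ N) (hd : Module.finrank ℝ E = 2 * N) :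
    ∫ x : E, ((1 + ‖x‖ ^ 2) ^ (N + 1))⁻¹ ∂μ = μ.real (Metric.ball 0 1) := by
  have : Nontrivial E := Module.nontrivial_of_finrank_pos (R := ℝ) (by omega)
  rw [integral_fun_norm_addHaar μ fun y : ℝ => ((1 + y ^ 2) ^ (N + 1))⁻¹, hd,
    integral_Ioi_pow_mul_inv N hN]
  have : (N : ℝ) ≠ 0 := by positivity
  simp only [nsmul_eq_mul, smul_eq_mul]
  push_cast
  field_simp

/-- With x = (q-a)/√ε the kernel is ε^{-N} (1+|x|²)^{-(N+1)}. In dimension 2N this is the rescaling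
by 1/√ε of a fixed profile, normalized in the proof by the volume of the unit ball. -/
theorem tendsto_integral_regDist_peak (N : ℕ) (hN : 1 ≤ N) (hd : Module.finrank ℝ E = 2 * N)
    (a : E) {g : E → ℂ} (hg : Integrable g μ) (hga : ContinuousAt g a) :
    Tendsto (fun ε : ℝ => ∫ q, (ε * (regDist a ε q ^ (N + 1))⁻¹) • g q ∂μ) (𝓝[>] 0)
      (𝓝 (μ.real (Metric.ball 0 1) • g a)) := by
  have : ProperSpace E := FiniteDimensional.proper ℝ E
  set V := μ.real (Metric.ball (0 : E) 1) with hV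
  have hVpos : 0 < V := ENNReal.toReal_pos (Metric.measure_ball_pos μ 0 one_pos).ne'
    measure_ball_lt_top.ne
  let p : E → ℝ := fun x => V⁻¹ * ((1 + ‖x‖ ^ 2) ^ (N + 1))⁻¹
  have hp : ∀ x, 0 ≤ p x := fun x => by positivity
  have hp1 : ∫ x, p x ∂μ = 1 := by
    rw [integral_const_mul, integral_inv_one_add_sq μ N hN hd, ← hV, inv_mul_cancel₀ hVpos.ne']
  have hp2 : Tendsto (fun x => ‖x‖ ^ Module.finrank ℝ E * p x) (Bornology.cobounded E) (𝓝 0) := by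
    have h1 : Tendsto (fun x : E => V⁻¹ * (‖x‖ ^ 2)⁻¹) (Bornology.cobounded E) (𝓝 (V⁻¹ * 0)) :=
      (tendsto_inv_atTop_zero.comp ((tendsto_pow_atTop two_ne_zero).comp
        tendsto_norm_cobounded_atTop)).const_mul _
    rw [mul_zero] at h1
    refine squeeze_zero' (Eventually.of_forall fun x => mul_nonneg (by positivity) (hp x)) ?_ h1
    have h0 : ∀ᶠ x : E in Bornology.cobounded E, 0 < ‖x‖ :=
      tendsto_norm_cobounded_atTop.eventually (eventually_gt_atTop 0)
    filter_upwards [h0] with x hx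
    rw [hd, mul_left_comm, pow_mul]
    refine mul_le_mul_of_nonneg_left ?_ (by positivity)
    calc (‖x‖ ^ 2) ^ N * ((1 + ‖x‖ ^ 2) ^ (N + 1))⁻¹
        ≤ (‖x‖ ^ 2) ^ N * ((‖x‖ ^ 2) ^ (N + 1))⁻¹ := by
          gcongr
          linarith
      _ = (‖x‖ ^ 2)⁻¹ := by
          field_simp
          ring
  have h := tendsto_integral_comp_smul_smul_of_integrable' hp hp1 hp2 hg hga
  have hc : Tendsto (fun ε : ℝ => (√ε)⁻¹) (𝓝[>] 0) atTop := by
    refine tendsto_inv_nhdsGT_zero.comp (tendsto_nhdsWithin_iff.mpr ⟨?_, ?_⟩)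
    · have := (Real.continuous_sqrt.tendsto 0).mono_left (nhdsWithin_le_nhds (s := Set.Ioi 0))
      rwa [Real.sqrt_zero] at this
    · filter_upwards [self_mem_nhdsWithin] with ε hε
      exact Real.sqrt_pos.mpr hε
  have h2 := (h.comp hc).const_smul V
  refine h2.congr' ?_
  filter_upwards [self_mem_nhdsWithin] with ε (hε : 0 < ε)
  rw [Function.comp_apply, ← integral_smul]
  refine integral_congr_ae (Eventually.of_forall fun q => ?_)
  simp only [p]
  rw [smul_smul, hd]
  congr 1
  have h3 : 1 + ‖(√ε)⁻¹ • (a - q)‖ ^ 2 = ε⁻¹ * regDist a ε q := by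
    rw [norm_smul, mul_pow, norm_inv, inv_pow, Real.norm_eq_abs, sq_abs, Real.sq_sqrt hε.le,
      regDist, norm_sub_rev]
    field_simp
    ring
  have h4 : 0 < regDist a ε q := regDist_pos hε a q
  rw [h3, pow_mul, inv_pow, Real.sq_sqrt hε.le, mul_pow]
  field_simp
  rw [pow_succ]
  field_simp

end Analysis

/-! ### The regularized fundamental solution -/

section Regularization

open Filter

variable {n m : ℕ}

theorem finrank_hSpace : Module.finrank ℝ (HSpace n) = 2 * (2 * n) := by
  simp
  ring

/-- The identity that singles out κ_m: it cancels the top current away from a and places the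
singularities exactly at the integrability threshold. -/
theorem mul_kappa_add_one (hm : 1 ≤ m) : (m : ℝ) * (kappa n m + 1) = 2 * n := by
  have : (m : ℝ) ≠ 0 := by positivity
  rw [kappa]
  field_simp
  ring

theorem one_le_kappa (hm : 1 ≤ m) (hmn : m ≤ n) : 1 ≤ kappa n m := by
  have h0 : (0 : ℝ) < m := by positivity
  have h1 : (m : ℝ) ≤ n := by exact_mod_cast hmn
  rw [kappa, le_sub_iff_add_le, le_div_iff₀ h0]
  linarith

theorem kappa_pos (hm : 1 ≤ m) (hmn : m ≤ n) : 0 < kappa n m :=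
  one_pos.trans_le (one_le_kappa hm hmn)

/-- The regularization `-(|q - a|² + ε)^{-κ_m}` of `K_m`. -/
def regSol (m : ℕ) (a : HSpace n) (ε : ℝ) (q : HSpace n) : ℝ := -regDist a ε q ^ (-kappa n m)

/-- The two-form `2 β_n - (κ_m + 1) θ_y`, where `θ_y` belongs to the projection onto `y`. -/
def dirForm (m : ℕ) (y : HSpace n) : Subalgebra.center ℂ (Ext n) :=
  ((2 : ℝ) : ℂ) • betaC n - ((kappa n m + 1 : ℝ) : ℂ) • thetaC (rankOne (toQuat y))

/-- The two-form `Δ` of the regularization of `K_m`. -/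
def regBaston (m : ℕ) (a : HSpace n) (ε : ℝ) (q : HSpace n) : Subalgebra.center ℂ (Ext n) :=
  ((4 * kappa n m * regDist a ε q ^ (-(kappa n m + 1)) : ℝ) : ℂ) • dirForm m (regDir a ε q)

/-- The density of the current `(Δu)^k ∧ β_n^{n-m}` for the regularization `u` of `K_m`. -/
def regCurrent (m k : ℕ) (a : HSpace n) (ε : ℝ) (q : HSpace n) : Subalgebra.center ℂ (Ext n) :=
  betaC n ^ (n - m) * regBaston m a ε q ^ k

theorem regCurrent_succ (k : ℕ) (a : HSpace n) (ε : ℝ) (q : HSpace n) :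
    regCurrent m (k + 1) a ε q = regCurrent m k a ε q * regBaston m a ε q := by
  rw [regCurrent, regCurrent, pow_succ, mul_assoc]

/-- This separates the singular radial power from a polynomial in the bounded direction, uniformly
in ε ≥ 0. -/
theorem regCurrent_eq_smul (k : ℕ) (a : HSpace n) {ε : ℝ} (hε : 0 ≤ ε) (q : HSpace n) :
    regCurrent m k a ε q = (((4 * kappa n m) ^ k : ℝ) : ℂ) •
      ((regDist a ε q ^ (-((kappa n m + 1) * k)) : ℝ) : ℂ) •
        (betaC n ^ (n - m) * dirForm m (regDir a ε q) ^ k) := by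
  rw [regCurrent, regBaston, smul_pow, mul_smul_comm, smul_smul, ← Complex.ofReal_mul,
    ← Complex.ofReal_pow, mul_pow, ← neg_mul, Real.rpow_mul_natCast (regDist_nonneg hε a q)]

theorem contDiff_regSol {ε : ℝ} (hε : 0 < ε) (a : HSpace n) : ContDiff ℝ ∞ (regSol m a ε) := by
  have h : ContDiff ℝ ∞ (regDist a ε) :=
    ((contDiff_norm_sq ℝ).comp (contDiff_id.sub contDiff_const)).add contDiff_const
  exact (h.rpow_const_of_ne fun q => (regDist_pos hε a q).ne').neg

theorem rankOne_toQuat_smul (c : ℝ) (x : HSpace n) :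
    rankOne (toQuat (c • x)) = (c ^ 2) • rankOne (toQuat x) := by
  ext1 l k
  have h : ∀ l, toQuat (c • x) l = c • toQuat x l := fun l => by
    rw [toQuat_eq_sum, toQuat_eq_sum, Finset.smul_sum]
    exact Finset.sum_congr rfl fun c' _ => mul_smul _ _ _
  rw [rankOne, Matrix.of_apply, h, h, Quaternion.star_smul, smul_mul_smul_comm, ← sq]
  rfl

theorem dirForm_mem_hermForms (y : HSpace n) : dirForm m y ∈ hermForms n :=
  sub_mem (ofReal_smul_mem_hermForms _ _ betaC_mem_hermForms)
    (ofReal_smul_mem_hermForms _ _ ⟨_, rankOne_isHermitian _, rfl⟩)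

theorem coe_thetaC (A : Matrix (Fin n) (Fin n) (Quaternion ℝ)) : (thetaC A : Ext n) = theta A := rfl

/-- The radial formula with ψ(t) = -(t+ε)^{-κ}, for which 8ψ' = 8κ s^{-κ-1} and 4ψ'' = -4κ(κ+1)
s^{-κ-2}. The extra 1/s is absorbed by normalizing q - a to `regDir`. -/
theorem baston_regSol {ε : ℝ} (hε : 0 < ε) (a q : HSpace n) :
    baston (ofFun (regSol m a ε)) q = regBaston m a ε q := by
  set κ := kappa n m with hκ
  have hsm : ContDiff ℝ 2 (regSol m a ε) :=
    (contDiff_regSol hε a).of_le (by exact_mod_cast natCast_le_infty 2)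
  have hpow : ∀ (γ t : ℝ), 0 ≤ t → HasDerivAt (fun t => (t + ε) ^ γ) (γ * (t + ε) ^ (γ - 1)) t := by
    intro γ t ht
    have h0 : t + ε ≠ 0 := (add_pos_of_nonneg_of_pos ht hε).ne'
    simpa using ((hasDerivAt_id t).add_const ε).rpow_const (p := γ) (Or.inl h0)
  have h1 : ∀ t, 0 ≤ t → HasDerivAt (fun t => -(t + ε) ^ (-κ)) (κ * (t + ε) ^ (-κ - 1)) t :=
    fun t ht => (hpow (-κ) t ht).neg.congr_deriv (by ring)
  have h2 := (hpow (-κ - 1) (‖q - a‖ ^ 2) (sq_nonneg _)).const_mul κ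
  have h := qHessian_radial (ψ := fun t => -(t + ε) ^ (-κ))
    (ψ' := fun t => κ * (t + ε) ^ (-κ - 1)) q hsm h1 h2
  have hs : 0 < regDist a ε q := regDist_pos hε a q
  have hs1 : ((√(regDist a ε q))⁻¹) ^ 2 = (regDist a ε q)⁻¹ := by
    rw [inv_pow, Real.sq_sqrt hs.le]
  have hs2 : regDist a ε q ^ (-κ - 1 - 1) = regDist a ε q ^ (-(κ + 1)) * (regDist a ε q)⁻¹ := by
    rw [Real.rpow_sub_one hs.ne', div_eq_mul_inv]
    congr 2
    ring
  rw [baston_eq_theta hsm]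
  refine (congrArg theta h).trans ?_
  change theta ((8 * (κ * regDist a ε q ^ (-κ - 1))) • 1 +
    (4 * (κ * ((-κ - 1) * regDist a ε q ^ (-κ - 1 - 1)))) • rankOne (toQuat (q - a))) = _
  rw [regBaston, dirForm, regDir, rankOne_toQuat_smul, hs1, hs2, theta_add, theta_smul, theta_smul,
    theta_one, SetLike.val_smul, AddSubgroupClass.coe_sub, SetLike.val_smul, SetLike.val_smul,
    coe_betaC, coe_thetaC, theta_smul, show -κ - 1 = -(κ + 1) by ring, ← hκ]
  push_cast
  module

/-- The linear factor of `hessFunctional_rankOne` is 2n - m(κ+1)|y|² = 2n(1 - |y|²), which vanishes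
on the unit sphere. -/
theorem hessFunctional_dirForm (hm : 1 ≤ m) (hmn : m ≤ n) (y : HSpace n) :
    hessFunctional n m (dirForm m y ^ m) = (((n ! : ℝ) * 2 ^ m * (1 - ‖y‖ ^ 2) : ℝ) : ℂ) := by
  have h := hessFunctional_rankOne hm hmn ((2 : ℝ) : ℂ) (-((kappa n m + 1 : ℝ) : ℂ)) y
  rw [neg_smul, ← sub_eq_add_neg] at h
  rw [dirForm, h]
  have h2 : (m : ℂ) * ((kappa n m + 1 : ℝ) : ℂ) = 2 * n := by
    exact_mod_cast congrArg (Complex.ofReal) (mul_kappa_add_one (n := n) hm)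
  obtain ⟨k, rfl⟩ : ∃ k, m = k + 1 := ⟨m - 1, by omega⟩
  obtain ⟨N, rfl⟩ : ∃ N, n = N + 1 := ⟨n - 1, by omega⟩
  rw [mul_neg, h2, Nat.factorial_succ, Nat.add_sub_cancel, Nat.add_sub_cancel]
  push_cast
  ring

theorem hessFunctional_regBaston (hm : 1 ≤ m) (hmn : m ≤ n) {ε : ℝ} (hε : 0 < ε)
    (a q : HSpace n) : hessFunctional n m (regBaston m a ε q ^ m) =
      (((8 * kappa n m) ^ m * (n ! : ℝ) * (ε * (regDist a ε q ^ (2 * n + 1))⁻¹) : ℝ) : ℂ) := by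
  have hs : 0 < regDist a ε q := regDist_pos hε a q
  rw [regBaston, smul_pow, map_smul, hessFunctional_dirForm hm hmn, norm_regDir_sq hε.le,
    smul_eq_mul, ← Complex.ofReal_pow, ← Complex.ofReal_mul]
  congr 1
  have h1 : (regDist a ε q ^ (-(kappa n m + 1))) ^ m = (regDist a ε q ^ (2 * n))⁻¹ := by
    rw [← Real.rpow_mul_natCast hs.le, neg_mul, mul_comm, mul_kappa_add_one hm,
      Real.rpow_neg hs.le, ← Real.rpow_natCast]
    push_cast
    rfl
  have h2 : 1 - (regDist a ε q)⁻¹ * ‖q - a‖ ^ 2 = ε * (regDist a ε q)⁻¹ := by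
    have : ‖q - a‖ ^ 2 = regDist a ε q - ε := by rw [regDist]; ring
    rw [this]
    field_simp
    ring
  rw [h2, mul_pow, h1, mul_pow, mul_pow, pow_succ, mul_inv, show (8 : ℝ) = 4 * 2 by norm_num,
    mul_pow]
  ring

/-- The regularized Hessian satisfies the cone hypothesis: the linear factor is n t + 2nc(1 - |y|²),
and |y| < 1 because ε > 0. -/
theorem hessFunctional_regBaston_add_ne_zero (hm : 1 ≤ m) (hmn : m ≤ n) {ε : ℝ} (hε : 0 < ε)
    (a q : HSpace n) {t : ℝ} (ht : 0 ≤ t) :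
    hessFunctional n m ((regBaston m a ε q + (t : ℂ) • betaC n) ^ m) ≠ 0 := by
  have hs : 0 < regDist a ε q := regDist_pos hε a q
  set c : ℝ := 4 * kappa n m * regDist a ε q ^ (-(kappa n m + 1)) with hc
  have hcpos : 0 < c := mul_pos (mul_pos four_pos (kappa_pos hm hmn)) (Real.rpow_pos_of_pos hs _)
  have h := hessFunctional_rankOne hm hmn ((2 * c + t : ℝ) : ℂ)
    ((-(c * (kappa n m + 1)) : ℝ) : ℂ) (regDir a ε q)
  have heq : regBaston m a ε q + (t : ℂ) • betaC n = ((2 * c + t : ℝ) : ℂ) • betaC n +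
      ((-(c * (kappa n m + 1)) : ℝ) : ℂ) • thetaC (rankOne (toQuat (regDir a ε q))) := by
    rw [regBaston, ← hc, dirForm]
    push_cast
    module
  have hn : (0 : ℝ) < n := by exact_mod_cast (by omega : 0 < n)
  have hy : ‖regDir a ε q‖ ^ 2 < 1 := by
    rw [norm_regDir_sq hε.le, inv_mul_lt_one₀ hs, regDist]
    linarith
  have h1 : 0 < (n : ℝ) * (2 * c + t) + m * -(c * (kappa n m + 1)) * ‖regDir a ε q‖ ^ 2 := by
    have : (n : ℝ) * (2 * c + t) + m * -(c * (kappa n m + 1)) * ‖regDir a ε q‖ ^ 2 =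
        n * t + 2 * n * c * (1 - ‖regDir a ε q‖ ^ 2) := by
      linear_combination (-(c * ‖regDir a ε q‖ ^ 2)) * mul_kappa_add_one (n := n) hm
    rw [this]
    have h3 : 0 < 1 - ‖regDir a ε q‖ ^ 2 := by linarith
    positivity
  rw [heq, h]
  refine mul_ne_zero (mul_ne_zero (Nat.cast_ne_zero.mpr (Nat.factorial_ne_zero _)) (pow_ne_zero _ ?_)) ?_
  · exact Complex.ofReal_ne_zero.mpr (by positivity)
  · exact_mod_cast h1.ne'

theorem regBaston_mem_hermForms (a : HSpace n) (ε : ℝ) (q : HSpace n) :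
    regBaston m a ε q ∈ hermForms n :=
  ofReal_smul_mem_hermForms _ _ (dirForm_mem_hermForms _)

theorem isClosedCentral_regCurrent {ε : ℝ} (hε : 0 < ε) (k : ℕ) (a : HSpace n) :
    IsClosedCentral fun q => (regCurrent m k a ε q : Ext n) := by
  have h1 : IsClosedCentral fun q => (regBaston m a ε q : Ext n) := by
    have := isClosedCentral_baston_ofFun ((contDiff_regSol (m := m) hε a).of_le
      (by exact_mod_cast natCast_le_infty 3))
    rwa [funext (baston_regSol hε a)] at this
  have h2 := (IsClosedCentral.const (n := n) (betaC n ^ (n - m)).2).mul (h1.pow k)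
  exact h2

theorem integral_regSol_mul_baston {ε : ℝ} (hε : 0 < ε) (a : HSpace n) {S F : HSpace n → Ext n}
    (hS : IsClosedCentral S) (hF : CoordIn (contDiffFun n ∞) F) (hc : HasCompactSupport F) :
    ∫ q, (regSol m a ε q : ℂ) * topCoeff n (S q * baston F q) =
      ∫ q, topCoeff n (S q * regBaston m a ε q * F q) := by
  simp only [integral_mul_baston hS (contDiff_regSol hε a) hF hc, baston_regSol hε a]

/-! ### Degrees -/

theorem mul_mem_exteriorPower {v w : Ext n} {i j : ℕ} (hv : v ∈ ⋀[ℂ]^i (Idx n → ℂ))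
    (hw : w ∈ ⋀[ℂ]^j (Idx n → ℂ)) : v * w ∈ ⋀[ℂ]^(i + j) (Idx n → ℂ) := by
  have := Submodule.mul_mem_mul hv hw
  rwa [ExteriorAlgebra.exteriorPower, ExteriorAlgebra.exteriorPower, ← pow_add] at this

theorem om_mul_om_mem (A B : Idx n) : om A * om B ∈ ⋀[ℂ]^2 (Idx n → ℂ) := by
  have h : ∀ A : Idx n, (om A : Ext n) ∈ ⋀[ℂ]^1 (Idx n → ℂ) := fun A => by
    rw [ExteriorAlgebra.exteriorPower, pow_one]
    exact ⟨_, rfl⟩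
  exact mul_mem_exteriorPower (h A) (h B)

theorem theta_mem_exteriorPower (A : Matrix (Fin n) (Fin n) (Quaternion ℝ)) :
    theta A ∈ ⋀[ℂ]^2 (Idx n → ℂ) := by
  refine Submodule.smul_mem _ _ (Submodule.sum_mem _ fun l _ => Submodule.sum_mem _ fun k _ => ?_)
  have h := fun A B : Idx n => om_mul_om_mem A B
  exact add_mem (sub_mem (add_mem (Submodule.smul_mem _ _ (h _ _)) (Submodule.smul_mem _ _ (h _ _)))
    (Submodule.smul_mem _ _ (h _ _))) (Submodule.smul_mem _ _ (h _ _))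

theorem beta_mem_exteriorPower : beta n ∈ ⋀[ℂ]^2 (Idx n → ℂ) :=
  Submodule.sum_mem _ fun _ _ => om_mul_om_mem _ _

theorem pow_mem_exteriorPower {w : Ext n} {p : ℕ} (hw : w ∈ ⋀[ℂ]^p (Idx n → ℂ)) (k : ℕ) :
    w ^ k ∈ ⋀[ℂ]^(p * k) (Idx n → ℂ) := by
  have := Submodule.pow_mem_pow _ hw k
  rwa [ExteriorAlgebra.exteriorPower, ← pow_mul] at this

theorem regCurrent_mem_exteriorPower (k : ℕ) (a : HSpace n) (ε : ℝ) (q : HSpace n) :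
    (regCurrent m k a ε q : Ext n) ∈ ⋀[ℂ]^(2 * (n - m + k)) (Idx n → ℂ) := by
  obtain ⟨A, -, hA⟩ := regBaston_mem_hermForms (m := m) a ε q
  rw [regCurrent, hA, mul_add, MulMemClass.coe_mul, SubmonoidClass.coe_pow,
    SubmonoidClass.coe_pow, coe_betaC]
  exact mul_mem_exteriorPower (pow_mem_exteriorPower beta_mem_exteriorPower _)
    (pow_mem_exteriorPower (theta_mem_exteriorPower A) _)

theorem volForm_mem_exteriorPower : volForm n ∈ ⋀[ℂ]^(2 * n) (Idx n → ℂ) := by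
  have h : (n ! : ℂ) • volForm n = beta n ^ n := by
    rw [Nat.cast_smul_eq_nsmul, factorial_smul_volForm]
  rw [← inv_smul_smul₀ (Nat.cast_ne_zero (R := ℂ).mpr (Nat.factorial_ne_zero n)) (volForm n), h]
  exact Submodule.smul_mem _ _ (pow_mem_exteriorPower beta_mem_exteriorPower _)

end Regularization

/-! ### Limits of the regularizations -/

section Limits

open Filter
open scoped ComplexOrder

variable {n m : ℕ}

theorem continuous_dirForm {X : Type*} [TopologicalSpace X] {F : X → Ext n}
    {y : X → HSpace n} (hy : Continuous y) (k : ℕ)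
    (hF : CoordIn (continuousSubalgebra : Subalgebra ℂ (X → ℂ)) F) (L : Ext n →ₗ[ℂ] ℂ) :
    Continuous fun x => L ((betaC n ^ (n - m) * dirForm m (y x) ^ k :
      Subalgebra.center ℂ (Ext n)) * F x) := by
  have hcoord : ∀ c, Continuous fun x => y x c := fun c =>
    (EuclideanSpace.proj c : HSpace n →L[ℝ] ℝ).continuous.comp hy
  have hquat : ∀ l, Continuous fun x => toQuat (y x) l := fun l => by
    simp only [toQuat_eq_sum]
    exact continuous_finsetSum _ fun c _ => (hcoord (l, c)).smul continuous_const
  have hent : ∀ l k, Continuous fun x => rankOne (toQuat (y x)) l k := fun l k =>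
    (hquat l).mul (continuous_star.comp (hquat k))
  have hdir : CoordIn (continuousSubalgebra : Subalgebra ℂ (X → ℂ))
      fun x => (dirForm m (y x) : Ext n) := by
    have h : CoordIn (continuousSubalgebra : Subalgebra ℂ (X → ℂ)) fun x =>
        ((2 : ℝ) : ℂ) • beta n + (-((kappa n m + 1 : ℝ) : ℂ)) • theta (rankOne (toQuat (y x))) := by
      refine (CoordIn.const _).add (CoordIn.smul (Subalgebra.algebraMap_mem _ _)
        (coordIn_theta _ fun l k => ⟨?_, ?_, ?_, ?_⟩))
      · exact continuous_zPart.comp (hent l k)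
      · exact continuous_wPart.comp (hent l k)
      · exact continuous_star.comp (continuous_zPart.comp (hent l k))
      · exact continuous_star.comp (continuous_wPart.comp (hent l k))
    have heq : (fun x => (dirForm m (y x) : Ext n)) = fun x => ((2 : ℝ) : ℂ) • beta n +
        (-((kappa n m + 1 : ℝ) : ℂ)) • theta (rankOne (toQuat (y x))) := by
      funext x
      rw [neg_smul, ← sub_eq_add_neg, ← coe_betaC]
      rfl
    rwa [heq]
  exact (((CoordIn.const ((betaC n : Ext n) ^ (n - m))).mul (hdir.pow k)).mul hF).linear L

theorem coordIn_continuous {F : HSpace n → Ext n} (hF : CoordIn (contDiffFun n 0) F) :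
    CoordIn (continuousSubalgebra : Subalgebra ℂ (HSpace n → ℂ)) F := fun I =>
  (hF.contDiff I).continuous

theorem linear_regCurrent_mul (k : ℕ) (a : HSpace n) {ε : ℝ} (hε : 0 ≤ ε) (q : HSpace n)
    (L : Ext n →ₗ[ℂ] ℂ) (w : Ext n) : L (regCurrent m k a ε q * w) =
      (((4 * kappa n m) ^ k : ℝ) : ℂ) * (((regDist a ε q ^ (-((kappa n m + 1) * k)) : ℝ) : ℂ) *
        L ((betaC n ^ (n - m) * dirForm m (regDir a ε q) ^ k : Subalgebra.center ℂ (Ext n)) * w)) := by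
  rw [regCurrent_eq_smul k a hε, SetLike.val_smul, SetLike.val_smul, smul_mul_assoc,
    smul_mul_assoc, map_smul, map_smul, smul_eq_mul, smul_eq_mul]

theorem regSol_mul_linear_regCurrent_mul (hm : 1 ≤ m) (hmn : m ≤ n) (k : ℕ) (a : HSpace n) {ε : ℝ}
    (hε : 0 ≤ ε) (q : HSpace n) (L : Ext n →ₗ[ℂ] ℂ) (w : Ext n) :
    (regSol m a ε q : ℂ) * L (regCurrent m k a ε q * w) =
      (-((4 * kappa n m) ^ k) : ℝ) *
        (((regDist a ε q ^ (-(kappa n m + (kappa n m + 1) * k)) : ℝ) : ℂ) *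
        L ((betaC n ^ (n - m) * dirForm m (regDir a ε q) ^ k : Subalgebra.center ℂ (Ext n)) * w)) := by
  have hκ := kappa_pos hm hmn
  have h : regDist a ε q ^ (-(kappa n m + (kappa n m + 1) * k)) =
      regDist a ε q ^ (-kappa n m) * regDist a ε q ^ (-((kappa n m + 1) * k)) := by
    rw [neg_add]
    -- The base may vanish (q = a, ε = 0). The exponents still add, because their sum is nonzero.
    refine Real.rpow_add' (regDist_nonneg hε a q) ?_
    have : 0 < kappa n m + (kappa n m + 1) * k := by positivity
    linarith
  rw [linear_regCurrent_mul k a hε, h, regSol]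
  push_cast
  ring

/-- Since (κ+1)(k+1) ≤ (κ+1)m = 2n, the exponent is at most 4n - 2, below the real dimension 4n. -/
theorem exponent_lt (hm : 1 ≤ m) (hmn : m ≤ n) {k : ℕ} (hk : k < m) :
    2 * (kappa n m + (kappa n m + 1) * k) < Module.finrank ℝ (HSpace n) := by
  have h1 : (kappa n m + 1) * (k + 1) ≤ (kappa n m + 1) * m := by
    have := kappa_pos hm hmn
    gcongr
    exact_mod_cast hk
  have h2 := mul_kappa_add_one (n := n) hm
  rw [finrank_hSpace]
  push_cast
  linarith

theorem exponent_lt' (hm : 1 ≤ m) (hmn : m ≤ n) {k : ℕ} (hk : k < m) :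
    2 * ((kappa n m + 1) * k) < Module.finrank ℝ (HSpace n) := by
  have := exponent_lt hm hmn hk
  have := kappa_pos hm hmn
  linarith

theorem one_le_finrank_hSpace (hm : 1 ≤ m) (hmn : m ≤ n) : 1 ≤ Module.finrank ℝ (HSpace n) := by
  rw [finrank_hSpace]
  omega

theorem tendsto_integral_regCurrent (hm : 1 ≤ m) (hmn : m ≤ n) {k : ℕ} (hk : k < m)
    (a : HSpace n) {F : HSpace n → Ext n} (hF : CoordIn (contDiffFun n 0) F)
    (hc : HasCompactSupport F) :
    Tendsto (fun ε => ∫ q, topCoeff n (regCurrent m k a ε q * F q)) (𝓝[>] 0)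
      (𝓝 (∫ q, topCoeff n (regCurrent m k a 0 q * F q))) := by
  have hκ := kappa_pos hm hmn
  have h := tendsto_integral_regDist_rpow_mul volume (one_le_finrank_hSpace hm hmn)
    (by positivity) (exponent_lt' hm hmn hk) a
    (continuous_dirForm (m := m) (F := fun p : HSpace n × HSpace n => F p.2) continuous_fst k
      (fun I => (coordIn_continuous hF I).comp continuous_snd) (topCoeff n)) hc.isCompact
    fun y q hq => by simp only [image_eq_zero_of_notMem_tsupport hq, mul_zero, map_zero]
  replace h := h.const_mul (((4 * kappa n m) ^ k : ℝ) : ℂ)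
  simp only [linear_regCurrent_mul k a le_rfl, integral_const_mul]
  refine h.congr' ?_
  filter_upwards [self_mem_nhdsWithin] with ε (hε : 0 < ε)
  simp only [linear_regCurrent_mul k a hε.le, integral_const_mul]

theorem tendsto_integral_regSol_regCurrent (hm : 1 ≤ m) (hmn : m ≤ n) {k : ℕ} (hk : k < m)
    (a : HSpace n) {F : HSpace n → Ext n} (hF : CoordIn (contDiffFun n 0) F)
    (hc : HasCompactSupport F) :
    Tendsto (fun ε => ∫ q, (regSol m a ε q : ℂ) * topCoeff n (regCurrent m k a ε q * F q)) (𝓝[>] 0)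
      (𝓝 (∫ q, (regSol m a 0 q : ℂ) * topCoeff n (regCurrent m k a 0 q * F q))) := by
  have hκ := kappa_pos hm hmn
  have h := tendsto_integral_regDist_rpow_mul volume (one_le_finrank_hSpace hm hmn)
    (by positivity) (exponent_lt hm hmn hk) a
    (continuous_dirForm (m := m) (F := fun p : HSpace n × HSpace n => F p.2) continuous_fst k
      (fun I => (coordIn_continuous hF I).comp continuous_snd) (topCoeff n)) hc.isCompact
    fun y q hq => by simp only [image_eq_zero_of_notMem_tsupport hq, mul_zero, map_zero]
  replace h := h.const_mul ((-((4 * kappa n m) ^ k) : ℝ) : ℂ)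
  simp only [regSol_mul_linear_regCurrent_mul hm hmn k a le_rfl, integral_const_mul]
  refine h.congr' ?_
  filter_upwards [self_mem_nhdsWithin] with ε (hε : 0 < ε)
  simp only [regSol_mul_linear_regCurrent_mul hm hmn k a hε.le, integral_const_mul]

theorem coordIn_baston {F : HSpace n → Ext n} (hF : CoordIn (contDiffFun n ∞) F) :
    CoordIn (contDiffFun n 0) (baston F) :=
  (hF.dOp (k := 1) (by exact_mod_cast natCast_le_infty 2) 1).dOp (by norm_num) 0

theorem hasCompactSupport_baston {F : HSpace n → Ext n} (hF : HasCompactSupport F) :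
    HasCompactSupport (baston F) :=
  HasCompactSupport.intro hF.isCompact fun _ hq =>
    dOp_eq_zero_of_notMem (fun h => hq (tsupport_dOp_subset F 1 h)) 0

/-- The currents with the regularized densities converge to the next current. -/
theorem tendsto_integral_regCurrent_succ (hm : 1 ≤ m) (hmn : m ≤ n) {k : ℕ} (hk : k < m)
    (a : HSpace n) {F : HSpace n → Ext n} (hF : CoordIn (contDiffFun n ∞) F)
    (hc : HasCompactSupport F) :
    Tendsto (fun ε => ∫ q, topCoeff n (regCurrent m (k + 1) a ε q * F q)) (𝓝[>] 0)
      (𝓝 (∫ q, (regSol m a 0 q : ℂ) * topCoeff n (regCurrent m k a 0 q * baston F q))) := by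
  refine (tendsto_integral_regSol_regCurrent hm hmn hk a (coordIn_baston hF)
    (hasCompactSupport_baston hc)).congr' ?_
  filter_upwards [self_mem_nhdsWithin] with ε (hε : 0 < ε)
  rw [integral_regSol_mul_baston hε a (isClosedCentral_regCurrent hε k a) hF hc]
  simp only [regCurrent_succ, MulMemClass.coe_mul]

/-- The mass of the top degree current concentrates at `a`. -/
theorem tendsto_integral_regCurrent_top (hm : 1 ≤ m) (hmn : m ≤ n) (a : HSpace n)
    {f : HSpace n → ℂ} (hf : Continuous f) (hc : HasCompactSupport f) :
    Tendsto (fun ε => ∫ q, topCoeff n (regCurrent m m a ε q * algebraMap ℂ (Ext n) (f q))) (𝓝[>] 0)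
      (𝓝 (((m ! * (n - m)! * fundConst n m : ℝ) : ℂ) * f a)) := by
  have h := (tendsto_integral_regDist_peak volume (2 * n) (by omega) finrank_hSpace a
    (hf.integrable_of_hasCompactSupport hc) hf.continuousAt).const_mul
    (((8 * kappa n m) ^ m * (n ! : ℝ) : ℝ) : ℂ)
  have hV : (volume : Measure (HSpace n)).real (Metric.ball 0 1) =
      Real.pi ^ (2 * n) / (2 * n)! := by
    have : Nontrivial (HSpace n) := Module.nontrivial_of_finrank_pos (R := ℝ)
      (one_le_finrank_hSpace hm hmn)
    rw [measureReal_def, InnerProductSpace.volume_ball_of_dim_even finrank_hSpace,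
      ENNReal.ofReal_one, one_pow, one_mul, ENNReal.toReal_ofReal (by positivity)]
  have hC : (((8 * kappa n m) ^ m * (n ! : ℝ) : ℝ) : ℂ) *
      ((volume : Measure (HSpace n)).real (Metric.ball 0 1) • f a) =
      ((m ! * (n - m)! * fundConst n m : ℝ) : ℂ) * f a := by
    rw [hV, Complex.real_smul, ← mul_assoc, ← Complex.ofReal_mul, fundConst]
    congr 2
    have h1 : (m ! : ℝ) ≠ 0 := by positivity
    have h2 : ((n - m)! : ℝ) ≠ 0 := by positivity
    rw [mul_pow]
    field_simp
  rw [hC] at h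
  refine h.congr' ?_
  filter_upwards [self_mem_nhdsWithin] with ε (hε : 0 < ε)
  rw [← integral_const_mul]
  refine integral_congr_ae (Eventually.of_forall fun q => ?_)
  simp only
  have h1 := hessFunctional_regBaston hm hmn hε a q
  rw [hessFunctional_apply, ← coe_betaC, ← SubmonoidClass.coe_pow, ← MulMemClass.coe_mul,
    mul_comm, ← regCurrent] at h1
  rw [← Algebra.commutes, ← Algebra.smul_def, map_smul, h1, Complex.real_smul, smul_eq_mul]
  push_cast
  ring

/-- Mixed Hessian measures of the regularizations are nonnegative. -/
theorem topCoeff_mul_regBaston_nonneg (hm : 1 ≤ m) (hmn : m ≤ n) {ε : ℝ} (hε : 0 < ε)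
    (a q : HSpace n) {v : Fin (m - 1) → HSpace n → ℝ} (hv : ∀ j, IsC4QSH m Set.univ (v j)) :
    0 ≤ topCoeff n ((List.ofFn fun j => baston (ofFun (v j)) q).prod * beta n ^ (n - m) *
      regBaston m a ε q) := by
  have h : ∀ j, baston (ofFun (v j)) q = theta (qHessian (v j) q) := fun j =>
    baston_eq_theta ((contDiffOn_univ.mp (hv j).contDiffOn).of_le (by norm_num)) q
  simp only [h]
  exact mixed_hessian_nonneg hm hmn _ (fun j => (hv j).hessian_mem q (Set.mem_univ q))
    (regBaston_mem_hermForms a ε q) fun t ht =>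
      hessFunctional_regBaston_add_ne_zero hm hmn hε a q ht

/-- For ε > 0 integration by parts moves Δ from η to `regSol`, leaving η times a nonnegative mixed
Hessian form. The inequality survives ε → 0, the singularity |q-a|^{-2κ} being locally integrable.
-/
theorem integral_regSol_nonneg (hm : 1 ≤ m) (hmn : m ≤ n) (a : HSpace n)
    {v : Fin (m - 1) → HSpace n → ℝ} (hv : ∀ j, IsC4QSH m Set.univ (v j)) {η : HSpace n → ℝ}
    (hη : ContDiff ℝ ∞ η) (hc : HasCompactSupport η) (hη0 : ∀ q, 0 ≤ η q) :
    0 ≤ ∫ q, (regSol m a 0 q : ℂ) *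
      topCoeff n ((List.ofFn fun j => baston (ofFun (v j)) q).prod * beta n ^ (n - m) *
        baston (ofFun η) q) := by
  set S : HSpace n → Ext n := fun q =>
    (List.ofFn fun j => baston (ofFun (v j)) q).prod * beta n ^ (n - m) with hSdef
  have hS : IsClosedCentral S := by
    refine (IsClosedCentral.list_prod fun j => isClosedCentral_baston_ofFun
      ((contDiffOn_univ.mp (hv j).contDiffOn).of_le (by norm_num))).mul (IsClosedCentral.const ?_)
    rw [← coe_betaC]
    exact (betaC n ^ (n - m)).2
  have hF : CoordIn (contDiffFun n ∞) (ofFun η) := CoordIn.ofFun hη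
  have hcF : HasCompactSupport (ofFun η) := HasCompactSupport.intro hc.isCompact fun q hq => by
    rw [ofFun, image_eq_zero_of_notMem_tsupport hq, Complex.ofReal_zero, map_zero]
  have hcB := hasCompactSupport_baston hcF
  have hG : Continuous fun q => topCoeff n (S q * baston (ofFun η) q) :=
    (coordIn_continuous ((hS.coordIn.of_le (by norm_num)).mul (coordIn_baston hF))).linear _
  have hlim := tendsto_integral_regDist_rpow_mul volume (one_le_finrank_hSpace hm hmn)
    (kappa_pos hm hmn).le (by simpa using exponent_lt hm hmn (k := 0) hm) a
    (hG.neg.comp (continuous_snd (X := HSpace n))) hcB.isCompact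
    fun y q hq => by simp [image_eq_zero_of_notMem_tsupport hq]
  have hval : ∀ (ε : ℝ) (q : HSpace n), (regSol m a ε q : ℂ) * topCoeff n (S q * baston (ofFun η) q) =
      ((regDist a ε q ^ (-kappa n m) : ℝ) : ℂ) *
        ((fun q => -topCoeff n (S q * baston (ofFun η) q)) ∘ Prod.snd) (regDir a ε q, q) := by
    intro ε q
    simp [regSol]
  replace hlim : Tendsto (fun ε => ∫ q, (regSol m a ε q : ℂ) *
      topCoeff n (S q * baston (ofFun η) q)) (𝓝[>] 0)
      (𝓝 (∫ q, (regSol m a 0 q : ℂ) * topCoeff n (S q * baston (ofFun η) q))) := by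
    simp only [hval]
    exact hlim
  refine isClosed_Ici.mem_of_tendsto hlim ?_
  filter_upwards [self_mem_nhdsWithin] with ε (hε : 0 < ε)
  rw [Set.mem_Ici, integral_regSol_mul_baston hε a hS hF hcF]
  refine integral_nonneg fun q => ?_
  rw [ofFun, ← Algebra.commutes, ← Algebra.smul_def, map_smul, smul_eq_mul]
  exact mul_nonneg (Complex.zero_le_real.mpr (hη0 q))
    (topCoeff_mul_regBaston_nonneg hm hmn hε a q hv)

end Limits

/-! ### The function `K_m` and its Hessian currents -/

section FundamentalSolution

open Filter

variable {n m : ℕ}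

theorem toReal_fundSol (hm : 1 ≤ m) (hmn : m ≤ n) (a q : HSpace n) :
    (fundSol m a q).toReal = regSol m a 0 q := by
  have hκ := kappa_pos hm hmn
  rw [fundSol, regSol, regDist, add_zero]
  split_ifs with h
  -- At a both sides take the default value 0: the real part of -∞, and the power 0^{-κ} with
  -- nonzero exponent.
  · rw [h, sub_self, norm_zero, EReal.toReal_bot, zero_pow two_ne_zero,
      Real.zero_rpow (neg_ne_zero.mpr hκ.ne'), neg_zero]
  · rw [EReal.toReal_coe, Real.rpow_neg (sq_nonneg _), ← Real.rpow_natCast,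
      ← Real.rpow_mul (norm_nonneg _), neg_div, one_div]
    rfl

/-- Written with the inverse on [0, ∞], which sends 0 to ∞, the function is a composition of
continuous maps, including at a. -/
theorem continuous_fundSol (hm : 1 ≤ m) (hmn : m ≤ n) (a : HSpace n) :
    Continuous fun q => fundSol m a q := by
  have hκ := kappa_pos hm hmn
  have h : (fun q => fundSol m a q) =
      fun q => -(((‖q - a‖ₑ ^ (2 * kappa n m))⁻¹ : ENNReal) : EReal) := by
    funext q
    rw [fundSol]
    split_ifs with h
    · rw [h, sub_self, enorm_zero, ENNReal.zero_rpow_of_pos (by positivity), ENNReal.inv_zero]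
      rfl
    · have h0 : 0 < ‖q - a‖ := norm_pos_iff.mpr (sub_ne_zero.mpr h)
      rw [← ofReal_norm, ENNReal.ofReal_rpow_of_pos h0,
        ← ENNReal.ofReal_inv_of_pos (by positivity), EReal.coe_ennreal_ofReal,
        max_eq_left (by positivity), ← EReal.coe_neg, neg_div, one_div]
  rw [h]
  exact continuous_neg.comp (continuous_coe_ennreal_ereal.comp
    (continuous_inv.comp (ENNReal.continuous_rpow_const.comp
      (continuous_enorm.comp (continuous_id.sub continuous_const)))))

theorem fundSol_ne_top (a q : HSpace n) : fundSol m a q ≠ ⊤ := by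
  rw [fundSol]
  split_ifs
  · exact bot_ne_top
  · exact EReal.coe_ne_top _

theorem fundSol_ne_bot {a q : HSpace n} (h : q ≠ a) : fundSol m a q ≠ ⊥ := by
  rw [fundSol, if_neg h]
  exact EReal.coe_ne_bot _

theorem isQSH_fundSol (hm : 1 ≤ m) (hmn : m ≤ n) (a : HSpace n) :
    IsQSH m Set.univ fun q => fundSol m a q where
  upperSemicontinuousOn := (continuous_fundSol hm hmn a).upperSemicontinuous.upperSemicontinuousOn _
  ne_top q _ := fundSol_ne_top a q
  ae_ne_bot := by
    rw [Measure.restrict_univ]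
    filter_upwards [ae_ne_of_finrank volume (one_le_finrank_hSpace hm hmn) a] with q hq
    exact fundSol_ne_bot hq
  locallyIntegrableOn := by
    simp only [toReal_fundSol hm hmn]
    exact (locallyIntegrable_regDist_rpow volume (one_le_finrank_hSpace hm hmn)
      (by simpa using exponent_lt hm hmn (k := 0) hm) a).neg.locallyIntegrableOn _
  nonneg v hv η hη hc _ hη0 := by
    have h := integral_regSol_nonneg hm hmn a hv hη hc hη0
    obtain ⟨hre, him⟩ := Complex.nonneg_iff.mp h
    refine ⟨_, hre, ?_⟩
    simp only [toReal_fundSol hm hmn, Measure.restrict_univ]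
    exact Complex.ext rfl him.symm

theorem isMeasureCurrent_regCurrent (hm : 1 ≤ m) (hmn : m ≤ n) {k : ℕ} (hk : k < m)
    (a : HSpace n) :
    IsMeasureCurrent (2 * (n - m + k)) Set.univ volume
      fun q => (regCurrent m k a 0 q : Ext n) where
  finite_of_compact K _ hK := hK.measure_lt_top
  degree q := regCurrent_mem_exteriorPower k a 0 q
  locallyIntegrableOn I := by
    have hval : ∀ q, (extBasis n).repr (regCurrent m k a 0 q : Ext n) I =
        (extBasis n).coord I (regCurrent m k a 0 q * 1) := fun q => by
      rw [mul_one]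
      rfl
    simp only [hval, linear_regCurrent_mul k a le_rfl]
    exact ((locallyIntegrable_regDist_rpow_mul volume (one_le_finrank_hSpace hm hmn)
      (exponent_lt' hm hmn hk) a (continuous_dirForm continuous_id k (CoordIn.const 1)
        ((extBasis n).coord I))).smul (((4 * kappa n m) ^ k : ℝ) : ℂ)).locallyIntegrableOn _

theorem locIntegrableCurrent_regCurrent (hm : 1 ≤ m) (hmn : m ≤ n) {k : ℕ} (hk : k < m)
    (a : HSpace n) :
    LocIntegrableCurrent Set.univ (fun q => fundSol m a q) volume
      fun q => (regCurrent m k a 0 q : Ext n) where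
  ae_finite := by
    rw [Measure.restrict_univ]
    filter_upwards [ae_ne_of_finrank volume (one_le_finrank_hSpace hm hmn) a] with q hq _
    exact ⟨fundSol_ne_bot hq, fundSol_ne_top a q⟩
  locallyIntegrableOn I := by
    have hval : ∀ q, (extBasis n).repr (regCurrent m k a 0 q : Ext n) I =
        (extBasis n).coord I (regCurrent m k a 0 q * 1) := fun q => by
      rw [mul_one]
      rfl
    simp only [hval, toReal_fundSol hm hmn, regSol_mul_linear_regCurrent_mul hm hmn k a le_rfl]
    exact ((locallyIntegrable_regDist_rpow_mul volume (one_le_finrank_hSpace hm hmn)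
      (exponent_lt hm hmn hk) a (continuous_dirForm continuous_id k (CoordIn.const 1)
        ((extBasis n).coord I))).smul ((-((4 * kappa n m) ^ k) : ℝ) : ℂ)).locallyIntegrableOn _

/-- Below the top degree the currents have locally integrable densities, obtained by setting ε = 0.
Both sides of the recurrence are limits of the same regularized integral. -/
theorem isHessianCurrent_regCurrent (hm : 1 ≤ m) (hmn : m ≤ n) (a : HSpace n) (k : ℕ) (hk : k < m) :
    IsHessianCurrent m Set.univ (fun q => fundSol m a q) k volume
      fun q => (regCurrent m k a 0 q : Ext n) := by
  induction k with
  | zero =>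
    refine ⟨isMeasureCurrent_regCurrent hm hmn hk a, fun F _ => ?_⟩
    simp only [regCurrent, pow_zero, mul_one, SubmonoidClass.coe_pow, coe_betaC]
  | succ k ih =>
    refine ⟨isMeasureCurrent_regCurrent hm hmn hk a, volume, _, ih (by omega),
      locIntegrableCurrent_regCurrent hm hmn (by omega) a, fun F hF => ?_⟩
    have hF' : CoordIn (contDiffFun n ∞) F := hF.smooth
    simp only [Measure.restrict_univ, toReal_fundSol hm hmn]
    exact tendsto_nhds_unique
      (tendsto_integral_regCurrent hm hmn hk a (hF'.of_le (by exact_mod_cast le_top)) hF.compact)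
      (tendsto_integral_regCurrent_succ hm hmn (by omega) a hF' hF.compact)

/-- At the last step the regularized integrals have a Dirac mass as limit. The current of degree m -
1 still has the density with ε = 0, so the recurrence is again uniqueness of limits. -/
theorem isHessianMeasure_fundSol (hm : 1 ≤ m) (hmn : m ≤ n) (a : HSpace n) :
    IsHessianMeasure m Set.univ (fun q => fundSol m a q)
      (ENNReal.ofReal (fundConst n m) • Measure.dirac a) := by
  obtain ⟨k, rfl⟩ : ∃ k, m = k + 1 := ⟨m - 1, by omega⟩
  have hfin : IsFiniteMeasure (ENNReal.ofReal (fundConst n (k + 1)) • Measure.dirac a) :=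
    Measure.smul_finite _ ENNReal.ofReal_ne_top
  refine ⟨⟨fun K _ _ => measure_lt_top _ K, fun q => Submodule.smul_mem _ _ ?_, fun I =>
    (locallyIntegrable_const _).locallyIntegrableOn _⟩, volume, _,
    isHessianCurrent_regCurrent hm hmn a k (by omega),
    locIntegrableCurrent_regCurrent hm hmn (by omega) a, fun F hF => ?_⟩
  · rw [Nat.sub_add_cancel hmn]
    exact volForm_mem_exteriorPower
  have hF' : CoordIn (contDiffFun n ∞) F := hF.smooth
  -- Test forms of degree 2(m - m) = 0 are scalar functions; f is that function.
  set f : HSpace n → ℂ := fun q => ExteriorAlgebra.algebraMapInv (F q) with hf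
  have hFf : ∀ q, F q = algebraMap ℂ (Ext n) (f q) := fun q => by
    have h := hF.degree q
    rw [Nat.sub_self, mul_zero, ExteriorAlgebra.exteriorPower, pow_zero] at h
    obtain ⟨c, hc⟩ := Submodule.mem_one.mp h
    simp only [hf, ← hc]
    rw [ExteriorAlgebra.algebraMap_leftInverse]
  have hfc : Continuous f := (coordIn_continuous (hF'.of_le (by exact_mod_cast le_top))).linear
    ExteriorAlgebra.algebraMapInv.toLinearMap
  have hfs : HasCompactSupport f := HasCompactSupport.intro hF.compact.isCompact fun q hq => by
    rw [hf]
    simp only [image_eq_zero_of_notMem_tsupport hq, map_zero]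
  have h1 := tendsto_integral_regCurrent_succ hm hmn (Nat.lt_succ_self k) a hF' hF.compact
  have h2 := tendsto_integral_regCurrent_top hm hmn a hfc hfs
  simp only [← hFf] at h2
  -- Nonnegativity is needed for the constant to survive the conversion to [0, ∞] in the Dirac
  -- measure.
  have hC : 0 ≤ fundConst n (k + 1) := by
    have := kappa_pos hm hmn
    rw [fundConst]
    positivity
  simp only [Measure.restrict_univ, toReal_fundSol hm hmn]
  rw [← tendsto_nhds_unique h2 h1, integral_smul_measure, integral_dirac, hFf,
    ENNReal.toReal_ofReal hC, ← Algebra.commutes, ← Algebra.smul_def, map_smul, map_smul,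
    topCoeff_volForm, Complex.real_smul]
  push_cast
  simp only [smul_eq_mul, mul_one]
  ring

end FundamentalSolution

end QHessian

end

theorem mainTheorem5 (n m : ℕ) (hm : 1 ≤ m) (hmn : m ≤ n) (a : QHessian.HSpace n) :
    QHessian.IsQSH m Set.univ (fun q => QHessian.fundSol m a q) ∧
      QHessian.IsHessianMeasure m Set.univ (fun q => QHessian.fundSol m a q)
        (ENNReal.ofReal (QHessian.fundConst n m) • MeasureTheory.Measure.dirac a) :=
  ⟨QHessian.isQSH_fundSol hm hmn a, QHessian.isHessianMeasure_fundSol hm hmn a⟩
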